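/- Let $M$ be a smooth (Hausdorff) $n$-dimensional manifold, let $X_1,\dots,X_l$ be smooth vector fields on $M$, let $q_0\in M$ and $T>0$. For a control $u\in L^2([0,T],\mathbb{R}^l)$ consider the (Carathéodory) Cauchy problem $$\dot q(t)=\sum_{i=1}^l u_i(t)X_i(q(t)),\qquad q(0)=q_0,$$ and let $\mathrm{End}^T:u\mapsto q(T)$ be the end-point map, defined for those $u$ whose trajectory exists on $[0,T]$. For such a $u$ and for $\Delta u\in L^2([0,T],\mathbb{R}^l)$ let $\mathrm{D}_u\mathrm{End}^T[\Delta u]\in \mathrm{T}_{q(T)}M$ and $\mathrm{D}^2_u\mathrm{End}^T[\Delta u]$ be the first and the second derivative of $s\mapsto \mathrm{End}^T(u+s\,\Delta u)$ at $s=0$, the second one being computed in local coordinates around $q(T)$ (if $\mathrm{D}_u\mathrm{End}^T[\Delta u]=0$, its class modulo $\operatorname{Im}\mathrm{D}_u\mathrm{End}^T$ does not depend on the coordinates). A curve of covectors $\phi(t)\in\mathrm{T}^*_{q(t)}M$, $t\in[0,T]$, is called a Pontryagin covector along $q$ if in local coordinates $$\langle\dot\phi(t),b\rangle+\Big\langle\phi(t),\sum_i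 u_i(t)\,\mathrm{D}_{q(t)}X_i[b]\Big\rangle=0\qquad\text{for every } b\in \mathrm{T}_{q(t)}M .$$ Given a basis of $\mathrm{T}^*_{q(0)}M$, let $\Phi^{(1)}_1(t),\dots,\Phi^{(1)}_n(t)$ be the Pontryagin covectors along $q$ which at $t=0$ are equal to the elements of this basis. Let $q(t)$, $t\in[0,T]$, be the trajectory corresponding to a control $u\in L^2([0,T],\mathbb{R}^l)$. Assume that a nonzero covector $\phi_0\in\mathrm{T}^*_{q(T)}M$ satisfies the conditions (i) $\phi_0$ annihilates the image $\operatorname{Im}\mathrm{D}_u\mathrm{End}^T$; (ii) the negative index of the quadratic form $\langle\phi_0,\mathrm{D}^2_u\mathrm{End}^T\rangle$ on $\ker \mathrm{D}_u\mathrm{End}^T$ (the supremum of the dimensions of the linear subspaces of $\ker \mathrm{D}_u\mathrm{End}^T$ on which the form is negative definite) is zero. Then $\Phi^{(1)}_1,\dots,\Phi^{(1)}_n$ exist, and for every choice of the basis at $t=0$ there is an $n$-tuple $(\phi^1,\dots,\phi^n)\in\mathbb{R}^n\setminus\{0\}$ such that the (nowhere vanishing) Pontryagin covector $\phi(t)=\sum_a\phi^a\Phi^{(1)}_a(t)$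 satisfies the Goh conditions $$\langle\phi(t),X_i(q(t))\rangle=0\quad\text{and}\quad\langle\phi(t),[X_i,X_j](q(t))\rangle=0\qquad\text{for all } i,j=1,\dots,l \text{ and all } t\in[0,T].$$ -/

import Mathlib

open Set MeasureTheory
open scoped Manifold ContDiff

noncomputable section

namespace Goh

/-- The space `L²([0,T], ℝˡ)` of controls. -/
abbrev Control (T : ℝ) (l : ℕ) : Type :=
  Lp (EuclideanSpace ℝ (Fin l)) 2 (volume.restrict (Icc (0 : ℝ) T))

section

variable {n l : ℕ} {M : Type*} [TopologicalSpace M]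
  [ChartedSpace (EuclideanSpace ℝ (Fin n)) M]

/-- The expression of a vector field `Y` in the coordinates given by the chart at `x`. -/
def coordField (x : M) (Y : (p : M) → TangentSpace (𝓡 n) p) :
    EuclideanSpace ℝ (Fin n) → EuclideanSpace ℝ (Fin n) :=
  VectorField.mpullback 𝓘(ℝ, EuclideanSpace ℝ (Fin n)) (𝓡 n) (extChartAt (𝓡 n) x).symm Y

/-- The expression of a covector `φ ∈ T*_p M` in the coordinates given by the chart at `x`
(meaningful if `p` belongs to the domain of this chart). -/
def coordCovector (x : M) {p : M} (φ : TangentSpace (𝓡 n) p →L[ℝ] ℝ) :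
    EuclideanSpace ℝ (Fin n) →L[ℝ] ℝ :=
  φ.comp (mfderiv 𝓘(ℝ, EuclideanSpace ℝ (Fin n)) (𝓡 n) (extChartAt (𝓡 n) x).symm
    (extChartAt (𝓡 n) x p) :
      EuclideanSpace ℝ (Fin n) →L[ℝ] EuclideanSpace ℝ (Fin n))

/-- `q : [0,T] → M` is a (Carathéodory) solution of `q' = ∑ᵢ uᵢ(t) Xᵢ(q)`, `q(0) = q₀`: it is
continuous, and on every time interval on which it stays in the domain of a chart it satisfies the
integrated equation in that chart. The values of `q` outside `[0,T]` are irrelevant. -/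
structure IsTrajectory (X : Fin l → (p : M) → TangentSpace (𝓡 n) p) (q₀ : M) (T : ℝ)
    (u : Control T l) (q : ℝ → M) : Prop where
  continuousOn : ContinuousOn q (Icc 0 T)
  init : q 0 = q₀
  ode : ∀ (x : M) (a b : ℝ), 0 ≤ a → a ≤ b → b ≤ T →
    (∀ t ∈ Icc a b, q t ∈ (extChartAt (𝓡 n) x).source) →
    extChartAt (𝓡 n) x (q b) = extChartAt (𝓡 n) x (q a) +
      ∫ t in a..b, ∑ i, u t i • coordField x (X i) (extChartAt (𝓡 n) x (q t))

open Classical in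
/-- The end-point map `End^T : u ↦ q(T)`, where `q` is the trajectory of the control `u`
(unique if it exists); off its domain, that is, when the trajectory does not exist on the whole of
`[0,T]`, it has the junk value `q₀`. -/
def endPoint (X : Fin l → (p : M) → TangentSpace (𝓡 n) p) (q₀ : M) (T : ℝ)
    (u : Control T l) : M :=
  if h : ∃ q : ℝ → M, IsTrajectory X q₀ T u q then h.choose T else q₀

/-- The curve `s ↦ End^T(u + s Δu)` in the preferred chart at `End^T(u)`. -/
def endCurve (X : Fin l → (p : M) → TangentSpace (𝓡 n) p) (q₀ : M) (T : ℝ)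
    (u Δu : Control T l) (s : ℝ) : EuclideanSpace ℝ (Fin n) :=
  extChartAt (𝓡 n) (endPoint X q₀ T u) (endPoint X q₀ T (u + s • Δu))

/-- The first derivative `D_u End^T[Δu]`. The tangent space at a point is identified with `ℝⁿ`
through the preferred chart at that point. -/
def dEnd (X : Fin l → (p : M) → TangentSpace (𝓡 n) p) (q₀ : M) (T : ℝ)
    (u Δu : Control T l) : TangentSpace (𝓡 n) (endPoint X q₀ T u) :=
  (deriv (endCurve X q₀ T u Δu) 0 : EuclideanSpace ℝ (Fin n))

/-- The second derivative `D²_u End^T[Δu]` in the preferred chart at `End^T(u)`. For `Δu` in the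
kernel of the first derivative, its class modulo the image of the first derivative does not depend
on the chart. -/
def d2End (X : Fin l → (p : M) → TangentSpace (𝓡 n) p) (q₀ : M) (T : ℝ)
    (u Δu : Control T l) : TangentSpace (𝓡 n) (endPoint X q₀ T u) :=
  (iteratedDeriv 2 (endCurve X q₀ T u Δu) 0 : EuclideanSpace ℝ (Fin n))

/-- `φ(t) ∈ T*_{q(t)}M`, `t ∈ [0,T]`, is a Pontryagin covector along the trajectory `q` of the
control `u`: it is continuous and, in every chart and for every vector `v`, satisfies
`⟨φ'(t), v⟩ + ⟨φ(t), ∑ᵢ uᵢ(t) D_{q(t)}Xᵢ[v]⟩ = 0` in integrated form. -/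
structure IsPontryagin (X : Fin l → (p : M) → TangentSpace (𝓡 n) p) (T : ℝ)
    (u : Control T l) (q : ℝ → M) (φ : (t : ℝ) → TangentSpace (𝓡 n) (q t) →L[ℝ] ℝ) :
    Prop where
  continuousOn : ∀ (x : M) (a b : ℝ), 0 ≤ a → a ≤ b → b ≤ T →
    (∀ t ∈ Icc a b, q t ∈ (extChartAt (𝓡 n) x).source) →
    ContinuousOn (fun t => coordCovector x (φ t)) (Icc a b)
  ode : ∀ (x : M) (a b : ℝ), 0 ≤ a → a ≤ b → b ≤ T →
    (∀ t ∈ Icc a b, q t ∈ (extChartAt (𝓡 n) x).source) →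
    ∀ v : EuclideanSpace ℝ (Fin n),
      coordCovector x (φ b) v = coordCovector x (φ a) v -
        ∫ t in a..b, coordCovector x (φ t)
          (∑ i, u t i • fderiv ℝ (coordField x (X i)) (extChartAt (𝓡 n) x (q t)) v)

/-- The covectors `Φ⁽¹⁾ₐ(t)`, `a = 1, …, n`: Pontryagin covectors along `q` which form a basis
of `T*_{q(0)}M` at `t = 0`. -/
structure IsAdaptedCoframe (X : Fin l → (p : M) → TangentSpace (𝓡 n) p) (T : ℝ)
    (u : Control T l) (q : ℝ → M)
    (Φ : Fin n → (t : ℝ) → TangentSpace (𝓡 n) (q t) →L[ℝ] ℝ) : Prop where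
  pontryagin : ∀ a, IsPontryagin X T u q (Φ a)
  linearIndependent : LinearIndependent ℝ (fun a => Φ a 0)
  span_eq_top : Submodule.span ℝ (range fun a => Φ a 0) = ⊤

end

/-- The negative index of (the restriction to `K` of) a real-valued form `Q`: the supremum of the
dimensions of the finite-dimensional linear subspaces of `K` on which `Q` is negative definite. -/
def negIndex {V : Type*} [AddCommGroup V] [Module ℝ V] (K : Set V) (Q : V → ℝ) : ℕ∞ :=
  ⨆ (W : Submodule ℝ V) (_ : FiniteDimensional ℝ W ∧ (W : Set V) ⊆ K ∧
    ∀ w ∈ W, w ≠ 0 → Q w < 0), (Module.finrank ℝ W : ℕ∞)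

end Goh

end

/-! Only variations of the control supported in short intervals [τ,b] are used. Read in a chart, the
Cauchy problem on such an interval is a fixed point equation in C([τ,b],ℝⁿ) for the superposition
operator of the fields, and the implicit function theorem makes its solution a C² function of the
initial point and of the size s of the perturbation u + sv (`IsAdapted.exists_family`). From b to T
the perturbation acts through the flow of u, whose differential transports Pontryagin covectors
(`hasFlow`). Let φ be the Pontryagin covector with φ(T) = φ₀. Pairing φ with the variational
equations cancels their linear part: the first variation becomes ∫⟨φ, v·X⟩, and on variations with
ξ(b) = 0 the second becomes ∫⟨φ, u·D²X(ξ,ξ) + 2v·DX ξ⟩, where ξ is the first variation of the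
trajectory (`IsAdapted.variation_conditions`).

With v constantly equal to e_i, condition (i) says that ⟨φ, X_i⟩ has zero integral over every short
interval, so it vanishes.

For the brackets, index zero means that the second variation is nonnegative on the kernel. Put h = b
- τ and let w be the primitive of v. For bounded v one has ξ ≈ w·X(q(τ)), and the second variation
is 2∫β(v,w) + o(h²), uniformly in v, with β(g,g') = ⟨φ(τ), g·DX(g'·X)⟩
(`exists_quadratic_expansion`). The symmetric part of β integrates to boundary terms, while λ =
β(e_i,e_j) - β(e_j,e_i) = -⟨φ(τ), [X_i,X_j]⟩. For v = p' e_i - σ p'' e_j, with p a rescaled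
polynomial flat at both ends and σ = ±1 a suitable sign, the leading term is -2|λ|h²∫p'²
(`integral_bilin_testControl`). The variation has to lie exactly in the kernel: among n+1
independent polynomials some normalised combination has ξ(b) = 0, and compactness of the unit sphere
bounds ∫p'² below independently of h (`exists_testPoly_bounds`). If λ ≠ 0, the second variation
would then be negative for small h.

The variations need room to the right of τ, so time T is reached by continuity. Uniqueness for the
linear Pontryagin equation shows that φ never vanishes and that a coframe independent at 0 is a
basis at T; the tuple consists of the coefficients of φ₀ in that basis. -/

noncomputable section

namespace Goh

open Filter Topology

/-! ### Absolutely continuous curves: indefinite integrals, chain rule, uniqueness. -/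

section Primitive

variable {E F G : Type*} [NormedAddCommGroup E]
  [NormedAddCommGroup F] [NormedSpace ℝ F] [NormedAddCommGroup G] [NormedSpace ℝ G]

/-- A continuous function whose increments are locally dominated by arbitrarily small multiples of
the increments of a continuous function is constant. -/
theorem eq_of_forall_eventually_norm_sub_le {f : ℝ → E} {m : ℝ → ℝ} {a b : ℝ} (hab : a ≤ b)
    (hf : ContinuousOn f (Icc a b)) (hm : ContinuousOn m (Icc a b))
    (h : ∀ ε > 0, ∀ s ∈ Ico a b, ∀ᶠ t in 𝓝[>] s, ‖f t - f s‖ ≤ ε * (m t - m s)) :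
    f b = f a := by
  -- Continuous induction for a fixed ε: the set where the bound holds is closed, and each of its
  -- points before b is followed by another. Afterwards ε tends to 0.
  have key : ∀ ε > 0, ‖f b - f a‖ ≤ ε * (m b - m a) := by
    intro ε hε
    have hcl : IsClosed ({t | ‖f t - f a‖ ≤ ε * (m t - m a)} ∩ Icc a b) := by
      have : ContinuousOn (fun t => ε * (m t - m a) - ‖f t - f a‖) (Icc a b) := by fun_prop
      convert this.preimage_isClosed_of_isClosed isClosed_Icc (isClosed_Ici (a := (0:ℝ))) using 1
      ext t; simp [and_comm]
    have := hcl.Icc_subset_of_forall_exists_gt (by simp) ?_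
    · exact this (right_mem_Icc.2 hab)
    · rintro s ⟨hs, hs'⟩ y hy
      have h1 := (h ε hε s hs').and (Ioc_mem_nhdsGT hy)
      obtain ⟨t, ht, ht'⟩ := h1.exists
      refine ⟨t, ?_, ht'⟩
      have h2 : ‖f t - f a‖ ≤ ‖f t - f s‖ + ‖f s - f a‖ := by
        simpa using norm_add_le (f t - f s) (f s - f a)
      simp only [mem_ofPred_eq] at hs ⊢
      linarith
  have h0 : ‖f b - f a‖ ≤ 0 := by
    have : Tendsto (fun ε : ℝ => ε * (m b - m a)) (𝓝[>] 0) (𝓝 0) := by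
      have : Tendsto (fun ε : ℝ => ε * (m b - m a)) (𝓝 0) (𝓝 (0 * (m b - m a))) := by
        exact (Continuous.tendsto (by fun_prop) 0)
      simpa using this.mono_left nhdsWithin_le_nhds
    exact ge_of_tendsto this (by filter_upwards [self_mem_nhdsWithin] with ε hε using key ε hε)
  exact sub_eq_zero.1 (norm_le_zero_iff.1 h0)

variable [NormedSpace ℝ E]

/-- `x` is an indefinite integral of the integrable function `g` on `[a,b]`. -/
structure IsPrimitiveOn (x g : ℝ → E) (a b : ℝ) : Prop where
  le : a ≤ b
  integrable : IntervalIntegrable g volume a b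
  eq : ∀ t ∈ Icc a b, x t = x a + ∫ s in a..t, g s

theorem _root_.IntervalIntegrable.clm_comp {g : ℝ → E} {a b : ℝ}
    (h : IntervalIntegrable g volume a b) (L : E →L[ℝ] F) :
    IntervalIntegrable (fun t => L (g t)) volume a b :=
  ⟨L.integrable_comp h.1, L.integrable_comp h.2⟩

namespace IsPrimitiveOn

variable {x g : ℝ → E} {a b c : ℝ}

theorem intervalIntegrable (h : IsPrimitiveOn x g a b) {s t : ℝ} (hs : s ∈ Icc a b)
    (ht : t ∈ Icc a b) : IntervalIntegrable g volume s t := by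
  refine h.integrable.mono_set ?_
  rw [uIcc_of_le (hs.1.trans hs.2)]
  exact Set.ordConnected_Icc.uIcc_subset hs ht

theorem sub_eq (h : IsPrimitiveOn x g a b) {s t : ℝ} (hs : s ∈ Icc a b)
    (ht : t ∈ Icc a b) : x t - x s = ∫ τ in s..t, g τ := by
  have ha : a ∈ Icc a b := left_mem_Icc.2 (hs.1.trans hs.2)
  rw [h.eq t ht, h.eq s hs, add_sub_add_left_eq_sub,
    intervalIntegral.integral_interval_sub_left (h.intervalIntegrable ha ht)
      (h.intervalIntegrable ha hs)]

theorem mono (h : IsPrimitiveOn x g a b) {a' b' : ℝ} (ha : a ≤ a') (hab : a' ≤ b') (hb : b' ≤ b) :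
    IsPrimitiveOn x g a' b' := by
  have ha' : a' ∈ Icc a b := ⟨ha, hab.trans hb⟩
  refine ⟨hab, h.intervalIntegrable ha' ⟨ha.trans hab, hb⟩, fun t ht => ?_⟩
  rw [← h.sub_eq ha' ⟨ha.trans ht.1, ht.2.trans hb⟩]
  abel

theorem continuousOn_integral {g : ℝ → E} (hab : a ≤ b) (h : IntervalIntegrable g volume a b) :
    ContinuousOn (fun t => ∫ s in a..t, g s) (Icc a b) := by
  have h1 := intervalIntegral.continuousOn_primitive_interval (f := g) (a := a) (b := b)
    (μ := volume) (by rwa [← intervalIntegrable_iff'])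
  rwa [uIcc_of_le hab] at h1

theorem continuousOn (h : IsPrimitiveOn x g a b) : ContinuousOn x (Icc a b) :=
  (continuousOn_const.add (continuousOn_integral h.le h.integrable)).congr fun t ht => h.eq t ht

theorem congr_left (h : IsPrimitiveOn x g a b) {x' : ℝ → E} (hx : EqOn x' x (Icc a b)) :
    IsPrimitiveOn x' g a b :=
  ⟨h.le, h.integrable, fun t ht => by rw [hx ht, hx (left_mem_Icc.2 h.le), h.eq t ht]⟩

theorem congr_right (h : IsPrimitiveOn x g a b) {g' : ℝ → E}
    (hg : ∀ᵐ t ∂(volume.restrict (Icc a b)), g t = g' t) : IsPrimitiveOn x g' a b := by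
  have hsub : ∀ t ∈ Icc a b, ∀ᵐ τ ∂(volume.restrict (uIoc a t)), g τ = g' τ := by
    intro t ht
    rw [uIoc_of_le ht.1]
    exact ae_restrict_of_ae_restrict_of_subset
      (Ioc_subset_Icc_self.trans (Icc_subset_Icc_right ht.2)) hg
  refine ⟨h.le, h.integrable.congr_ae (hsub b (right_mem_Icc.2 h.le)), fun t ht => ?_⟩
  rw [h.eq t ht]
  congr 1
  exact intervalIntegral.integral_congr_ae_restrict (hsub t ht)

theorem concat (h : IsPrimitiveOn x g a b) (h' : IsPrimitiveOn x g b c) :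
    IsPrimitiveOn x g a c := by
  refine ⟨h.le.trans h'.le, h.integrable.trans h'.integrable, fun t ht => ?_⟩
  rcases le_total t b with htb | htb
  · exact h.eq t ⟨ht.1, htb⟩
  · rw [h'.eq t ⟨htb, ht.2⟩, h.eq b (right_mem_Icc.2 h.le), add_assoc,
      intervalIntegral.integral_add_adjacent_intervals h.integrable
        (h'.intervalIntegrable (left_mem_Icc.2 h'.le) ⟨htb, ht.2⟩)]

theorem norm_sub_le (h : IsPrimitiveOn x g a b) {s t : ℝ} (hs : s ∈ Icc a b)
    (ht : t ∈ Icc a b) (hst : s ≤ t) : ‖x t - x s‖ ≤ ∫ τ in s..t, ‖g τ‖ := by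
  rw [h.sub_eq hs ht]
  exact intervalIntegral.norm_integral_le_integral_norm hst

theorem clm_apply [CompleteSpace E] [CompleteSpace F] (h : IsPrimitiveOn x g a b) (L : E →L[ℝ] F) :
    IsPrimitiveOn (fun t => L (x t)) (fun t => L (g t)) a b :=
  ⟨h.le, h.integrable.clm_comp L, fun t ht => by
    rw [h.eq t ht, map_add, ← L.intervalIntegral_comp_comm
      (h.intervalIntegrable (left_mem_Icc.2 h.le) ht)]⟩

theorem const (hab : a ≤ b) (z : E) : IsPrimitiveOn (fun _ => z) (fun _ => (0 : E)) a b :=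
  ⟨hab, by simp, fun t _ => by simp⟩

theorem add {y k : ℝ → E} (h : IsPrimitiveOn x g a b) (h' : IsPrimitiveOn y k a b) :
    IsPrimitiveOn (fun t => x t + y t) (fun t => g t + k t) a b :=
  ⟨h.le, h.integrable.add h'.integrable, fun t ht => by
    have ha := left_mem_Icc.2 h.le
    rw [intervalIntegral.integral_add (h.intervalIntegrable ha ht) (h'.intervalIntegrable ha ht),
      h.eq t ht, h'.eq t ht]
    abel⟩

theorem prodMk [CompleteSpace E] [CompleteSpace F] {y k : ℝ → F} (h : IsPrimitiveOn x g a b)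
    (h' : IsPrimitiveOn y k a b) :
    IsPrimitiveOn (fun t => (x t, y t)) (fun t => (g t, k t)) a b := by
  have hi : IntervalIntegrable (fun t => (g t, k t)) volume a b := by
    have h1 := h.integrable.clm_comp (.inl ℝ E F)
    have h2 := h'.integrable.clm_comp (.inr ℝ E F)
    simpa [Function.comp_def] using h1.add h2
  refine ⟨h.le, hi, fun t ht => ?_⟩
  have hit : IntervalIntegrable (fun t => (g t, k t)) volume a t :=
    hi.mono_set (by rw [uIcc_of_le ht.1, uIcc_of_le h.le]; exact Icc_subset_Icc_right ht.2)
  ext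
  · rw [← ContinuousLinearMap.coe_fst' (R := ℝ), map_add,
      ← ContinuousLinearMap.intervalIntegral_comp_comm _ hit]
    simpa using h.eq t ht
  · rw [← ContinuousLinearMap.coe_snd' (R := ℝ), map_add,
      ← ContinuousLinearMap.intervalIntegral_comp_comm _ hit]
    simpa using h'.eq t ht

theorem _root_.IntervalIntegrable.clm_apply_continuousOn {u : ℝ → F →L[ℝ] G} {y : ℝ → F}
    (hab : a ≤ b) (hu : IntervalIntegrable u volume a b) (hy : ContinuousOn y (Icc a b)) :
    IntervalIntegrable (fun t => u t (y t)) volume a b := by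
  rw [intervalIntegrable_iff_integrableOn_Icc_of_le hab] at hu ⊢
  obtain ⟨C, hC⟩ := isCompact_Icc.exists_bound_of_continuousOn hy
  have hym : AEStronglyMeasurable y (volume.restrict (Icc a b)) :=
    hy.aestronglyMeasurable measurableSet_Icc
  refine (hu.norm.mul_const C).mono' ((ContinuousLinearMap.id ℝ (F →L[ℝ] G)).aestronglyMeasurable_comp₂
    hu.aestronglyMeasurable hym) ?_
  filter_upwards [ae_restrict_mem measurableSet_Icc] with t ht
  exact ((u t).le_opNorm _).trans (by gcongr; exact hC t ht)

theorem _root_.ContinuousOn.intervalIntegrable_clm_apply {A : ℝ → F →L[ℝ] G} {k : ℝ → F}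
    (hab : a ≤ b) (hA : ContinuousOn A (Icc a b)) (hk : IntervalIntegrable k volume a b) :
    IntervalIntegrable (fun t => A t (k t)) volume a b :=
  IntervalIntegrable.clm_apply_continuousOn (y := A)
    (u := fun t => (ContinuousLinearMap.apply ℝ G : F →L[ℝ] (F →L[ℝ] G) →L[ℝ] G) (k t))
    hab (hk.clm_comp _) hA

/-- The chain rule for absolutely continuous curves. -/
theorem comp_hasFDerivAt [CompleteSpace E] [CompleteSpace F] (h : IsPrimitiveOn x g a b) {f : E → F}
    {f' : E → E →L[ℝ] F} (hf : ∀ t ∈ Icc a b, HasFDerivAt f (f' (x t)) (x t))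
    (hf' : ContinuousOn (fun t => f' (x t)) (Icc a b)) :
    IsPrimitiveOn (fun t => f (x t)) (fun t => f' (x t) (g t)) a b := by
  have hab := h.le
  have hint := ContinuousOn.intervalIntegrable_clm_apply hab hf' h.integrable
  have hfx : ContinuousOn (fun t => f (x t)) (Icc a b) := fun t ht =>
    (hf t ht).continuousAt.comp_continuousWithinAt (h.continuousOn t ht)
  refine ⟨hab, hint, fun c hc => ?_⟩
  have hcb : Icc a c ⊆ Icc a b := Icc_subset_Icc_right hc.2
  have hii : ∀ {s t}, s ∈ Icc a b → t ∈ Icc a b →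
      IntervalIntegrable (fun t => f' (x t) (g t)) volume s t := fun hs ht =>
    hint.mono_set (by rw [uIcc_of_le hab]; exact Set.ordConnected_Icc.uIcc_subset hs ht)
  have ha : a ∈ Icc a b := left_mem_Icc.2 hab
  -- Almost everywhere differentiation is avoided: the defect between f ∘ x and the integral has
  -- increments which are o(∫‖g‖), hence is constant.
  have key := eq_of_forall_eventually_norm_sub_le
    (f := fun t => f (x t) - ∫ s in a..t, f' (x s) (g s)) (m := fun t => ∫ s in a..t, ‖g s‖) hc.1
    ((hfx.sub (continuousOn_integral hab hint)).mono hcb)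
    ((continuousOn_integral hab h.integrable.norm).mono hcb) ?_
  · simp only [intervalIntegral.integral_same, sub_zero] at key
    rw [← key]; abel
  · intro ε hε s hs
    have hsb : s ∈ Icc a b := hcb ⟨hs.1, hs.2.le⟩
    have hle : 𝓝[>] s ≤ 𝓝[Icc a b] s :=
      nhdsWithin_le_of_mem (mem_of_superset (Ioc_mem_nhdsGT (hs.2.trans_le hc.2))
        fun t ht => ⟨hs.1.trans ht.1.le, ht.2⟩)
    have hx : Tendsto x (𝓝[>] s) (𝓝 (x s)) := (h.continuousOn s hsb).mono_left hle
    have h1 := hx.eventually ((hf s hsb).isLittleO.def (half_pos hε))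
    have h2 : ∃ δ > s, ∀ t ∈ Icc a b, t ∈ Icc s δ → ‖f' (x s) - f' (x t)‖ ≤ ε / 2 := by
      have h3 := (hf' s hsb).eventually (Metric.closedBall_mem_nhds _ (half_pos hε))
      rw [eventually_nhdsWithin_iff, Metric.eventually_nhds_iff] at h3
      obtain ⟨r, hr, h3⟩ := h3
      refine ⟨s + r / 2, by linarith, fun t ht ht' => ?_⟩
      have := h3 (y := t) (by rw [Real.dist_eq, abs_of_nonneg] <;> linarith [ht'.1, ht'.2]) ht
      rwa [dist_comm, dist_eq_norm] at this
    obtain ⟨δ, hδ, h2⟩ := h2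
    filter_upwards [h1, Ioc_mem_nhdsGT hδ, Ioc_mem_nhdsGT hs.2] with t ht1 ht2 ht3
    have htb : t ∈ Icc a b := ⟨hs.1.trans ht3.1.le, ht3.2.trans hc.2⟩
    have hst : s ≤ t := ht3.1.le
    have hgi := h.intervalIntegrable hsb htb
    rw [intervalIntegral.integral_interval_sub_left (h.intervalIntegrable ha htb).norm
      (h.intervalIntegrable ha hsb).norm]
    have e1 : ∫ τ in s..t, f' (x s) (g τ) = f' (x s) (x t - x s) := by
      rw [h.sub_eq hsb htb, ContinuousLinearMap.intervalIntegral_comp_comm _ hgi]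
    -- The increment splits into the Taylor remainder of f at x s and the oscillation of f' along
    -- the curve on [s,t]; each is at most ε/2 times ∫‖g‖.
    have e2 : (f (x t) - ∫ s in a..t, f' (x s) (g s)) - (f (x s) - ∫ s in a..s, f' (x s) (g s)) =
        (f (x t) - f (x s) - f' (x s) (x t - x s)) +
          ∫ τ in s..t, (f' (x s) - f' (x τ)) (g τ) := by
      simp only [sub_apply]
      rw [intervalIntegral.integral_sub (hgi.clm_comp _) (hii hsb htb), e1,
        ← intervalIntegral.integral_interval_sub_left (hii ha htb) (hii ha hsb)]
      abel
    rw [e2]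
    have b1 := ht1.trans (mul_le_mul_of_nonneg_left (h.norm_sub_le hsb htb hst) (half_pos hε).le)
    have b2 : ‖∫ τ in s..t, (f' (x s) - f' (x τ)) (g τ)‖ ≤ ε / 2 * ∫ τ in s..t, ‖g τ‖ := by
      rw [← intervalIntegral.integral_const_mul]
      refine intervalIntegral.norm_integral_le_of_norm_le hst ?_ (hgi.norm.const_mul _)
      refine ae_of_all _ fun τ hτ => ((f' (x s) - f' (x τ)).le_opNorm _).trans ?_
      gcongr
      exact h2 τ ⟨hs.1.trans hτ.1.le, hτ.2.trans htb.2⟩ ⟨hτ.1.le, hτ.2.trans ht2.2⟩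
    calc _ ≤ _ := norm_add_le _ _
      _ ≤ _ := add_le_add b1 b2
      _ = _ := by ring

/-- The product rule for absolutely continuous curves. -/
theorem bilinear [CompleteSpace E] [CompleteSpace F] [CompleteSpace G] {y k : ℝ → F}
    (h : IsPrimitiveOn x g a b) (h' : IsPrimitiveOn y k a b) (B : E →L[ℝ] F →L[ℝ] G) :
    IsPrimitiveOn (fun t => B (x t) (y t)) (fun t => B (g t) (y t) + B (x t) (k t)) a b := by
  have h1 := (h.prodMk h').comp_hasFDerivAt (f := fun p => B p.1 p.2)
    (f' := fun p => B.isBoundedBilinearMap.deriv p)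
    (fun t _ => B.isBoundedBilinearMap.hasFDerivAt _)
    (B.isBoundedBilinearMap.isBoundedLinearMap_deriv.continuous.comp_continuousOn
      (h.continuousOn.prodMk h'.continuousOn))
  refine h1.congr_right (ae_of_all _ fun t => ?_)
  simp [add_comm]

/-- A curve vanishing at a point vanishes identically on a short interval if its derivative is
dominated by its norm. -/
theorem eq_zero_of_norm_le (h : IsPrimitiveOn x g a b) {κ : ℝ → ℝ}
    (hκ : IntervalIntegrable κ volume a b) (hκ0 : ∀ t, 0 ≤ κ t)
    (hg : ∀ t ∈ Icc a b, ‖g t‖ ≤ κ t * ‖x t‖) (hκ1 : ∫ t in a..b, κ t < 1)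
    {s : ℝ} (hs : s ∈ Icc a b) (hxs : x s = 0) : ∀ t ∈ Icc a b, x t = 0 := by
  -- At a maximum point r of the norm, ‖x r‖ ≤ (∫κ)‖x r‖ with ∫κ < 1, so the maximum is zero. The
  -- zero s may lie on either side of r, so the conclusion runs forwards and backwards in time.
  obtain ⟨r, hr, hmax⟩ := isCompact_Icc.exists_isMaxOn (nonempty_Icc.2 h.le) h.continuousOn.norm
  suffices x r = 0 by
    intro t ht
    exact norm_le_zero_iff.1 (by simpa [‹x r = 0›] using hmax ht)
  have hsub : uIoc s r ⊆ Icc a b := uIoc_subset_uIcc.trans (Set.ordConnected_Icc.uIcc_subset hs hr)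
  have h1 : ‖x r‖ ≤ (∫ t in a..b, κ t) * ‖x r‖ := by
    have e : x r = ∫ τ in s..r, g τ := by rw [← h.sub_eq hs hr, hxs, sub_zero]
    have hκ' := (intervalIntegrable_iff_integrableOn_Icc_of_le h.le).1 (hκ.mul_const ‖x r‖)
    calc ‖x r‖ ≤ ∫ τ in uIoc s r, ‖g τ‖ := by
          conv_lhs => rw [e]
          exact intervalIntegral.norm_integral_le_integral_norm_uIoc
      _ ≤ ∫ τ in uIoc s r, κ τ * ‖x r‖ := by
          refine setIntegral_mono_on ?_ (hκ'.mono_set hsub) measurableSet_uIoc fun τ hτ => ?_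
          · exact (h.intervalIntegrable hs hr).norm.def'
          · exact (hg τ (hsub hτ)).trans (by gcongr; exacts [hκ0 τ, hmax (hsub hτ)])
      _ ≤ ∫ τ in Icc a b, κ τ * ‖x r‖ :=
          setIntegral_mono_set hκ' (ae_of_all _ fun τ => mul_nonneg (hκ0 τ) (norm_nonneg _))
            hsub.eventuallyLE
      _ = _ := by
          rw [integral_Icc_eq_integral_Ioc, ← intervalIntegral.integral_of_le h.le,
            intervalIntegral.integral_mul_const]
  by_contra hne
  nlinarith [norm_pos_iff.2 hne]

end IsPrimitiveOn
end Primitive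

/-! ### Differentiability of the superposition operator on C(K,E). -/

section Superposition

universe v
variable {K : Type*} [TopologicalSpace K]

/-- Pointwise application of a continuous family of operators. -/
def pointwiseApply (K : Type*) [TopologicalSpace K] [CompactSpace K]
    (E F : Type*) [NormedAddCommGroup E] [NormedSpace ℝ E]
    [NormedAddCommGroup F] [NormedSpace ℝ F] :
    C(K, E →L[ℝ] F) →L[ℝ] C(K, E) →L[ℝ] C(K, F) :=
  LinearMap.mkContinuous₂
    (LinearMap.mk₂ ℝ (fun (A : C(K, E →L[ℝ] F)) (x : C(K, E)) =>
        (⟨fun k => A k (x k), by fun_prop⟩ : C(K, F)))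
      (fun _ _ _ => by ext; simp) (fun _ _ _ => by ext; simp)
      (fun _ _ _ => by ext; simp) (fun _ _ _ => by ext; simp)) 1
    (fun A x => by
      rw [one_mul]
      refine (ContinuousMap.norm_le _ (by positivity)).2 fun k => ?_
      exact ((A k).le_opNorm _).trans
        (mul_le_mul (A.norm_coe_le_norm k) (x.norm_coe_le_norm k) (norm_nonneg _) (by positivity)))

/-- The superposition operator `x ↦ f ∘ x` on continuous functions. -/
def superpose {E F : Type*} [TopologicalSpace E] [TopologicalSpace F] (f : C(E, F)) (x : C(K, E)) :
    C(K, F) := f.comp x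

variable [CompactSpace K]

/-- The range of x is compact, so f' is uniformly continuous at its points even when E is not
locally compact. The mean value inequality then bounds the remainder by ε‖y - x‖ at all k
simultaneously. -/
theorem hasFDerivAt_superpose {E F : Type*} [NormedAddCommGroup E] [NormedSpace ℝ E]
    [NormedAddCommGroup F] [NormedSpace ℝ F] (f : C(E, F)) (f' : C(E, E →L[ℝ] F))
    (hf : ∀ z, HasFDerivAt f (f' z) z) (x : C(K, E)) :
    HasFDerivAt (superpose f) (pointwiseApply K E F (superpose f' x)) x := by
  refine .of_isLittleO ?_
  rw [Asymptotics.isLittleO_iff]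
  intro ε hε
  have huc := (isCompact_range x.continuous).uniformContinuousAt_of_continuousAt f'
    (fun z _ => f'.continuous.continuousAt) (Metric.dist_mem_uniformity hε)
  obtain ⟨δ, hδ, h⟩ := Metric.mem_uniformity_dist.1 huc
  filter_upwards [Metric.ball_mem_nhds x hδ] with y hy
  refine (ContinuousMap.norm_le _ (by positivity)).2 fun k => ?_
  have hk : ‖y k - x k‖ ≤ ‖y - x‖ := (y - x).norm_coe_le_norm k
  have hconv := Convex.norm_image_sub_le_of_norm_hasFDerivWithin_le' (f := f) (f' := f')
    (φ := f' (x k)) (C := ε) (s := Metric.ball (x k) δ) (x := x k) (y := y k)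
    (fun z _ => (hf z).hasFDerivWithinAt) (fun z hz => ?_) (convex_ball _ _)
    (Metric.mem_ball_self hδ)
    (by rw [mem_ball_iff_norm]; rw [mem_ball_iff_norm] at hy; exact hk.trans_lt hy)
  · exact hconv.trans (mul_le_mul_of_nonneg_left hk hε.le)
  · have := h (a := x k) (b := z) (by rwa [dist_comm]) (mem_range_self k)
    rw [← dist_eq_norm, dist_comm]
    exact this.le

/-- The derivative of the operator is a bounded linear map applied to the superposition operator of
f', so induction on n lowers the regularity of f by one. The target F changes to E →L F on the way,
which is why it is quantified inside and shares the universe of E. -/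
theorem contDiff_superpose {E : Type v} [NormedAddCommGroup E] [NormedSpace ℝ E] (n : ℕ) :
    ∀ {F : Type v} [NormedAddCommGroup F] [NormedSpace ℝ F] (f : C(E, F)) (_ : ContDiff ℝ n f),
      ContDiff ℝ n (superpose (K := K) f) := by
  induction n with
  | zero => exact fun f _ => contDiff_zero.2 (ContinuousMap.continuous_postcomp f)
  | succ n ih =>
    intro F _ _ f hf
    have hf' : ContDiff ℝ n (fderiv ℝ f) := hf.fderiv_right le_rfl
    have hd : Differentiable ℝ f := hf.differentiable (by simp)
    rw [show ((n + 1 : ℕ) : WithTop ℕ∞) = n + 1 by push_cast; rfl]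
    refine contDiff_succ_iff_hasFDerivAt.2 ⟨_, (pointwiseApply K E F).contDiff.comp
      (ih ⟨fderiv ℝ f, hf'.continuous⟩ hf'), fun x => ?_⟩
    exact hasFDerivAt_superpose f ⟨fderiv ℝ f, hf'.continuous⟩
      (fun z => (hd z).hasFDerivAt) x

end Superposition

/-! ### Integration against an integrable kernel as a bounded operator. -/

section Integral

variable {E W : Type*} [NormedAddCommGroup E] [NormedSpace ℝ E]
  [NormedAddCommGroup W] [NormedSpace ℝ W] {a b : ℝ}

/-- The indefinite integral of an integrable function as a continuous function. -/
def primitive (hab : a ≤ b) (g : ℝ → E) (hg : IntervalIntegrable g volume a b) : C(Icc a b, E) where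
  toFun t := ∫ τ in a..t, g τ
  continuous_toFun := (IsPrimitiveOn.continuousOn_integral hab hg).comp_continuous
    continuous_subtype_val fun t => t.2

theorem primitive_apply (hab : a ≤ b) (g : ℝ → E) (hg : IntervalIntegrable g volume a b)
    (t : Icc a b) : primitive hab g hg t = ∫ τ in a..t, g τ := rfl

theorem _root_.IntervalIntegrable.clm_apply_IccExtend (hab : a ≤ b) {u : ℝ → W →L[ℝ] E}
    (hu : IntervalIntegrable u volume a b) (y : C(Icc a b, W)) :
    IntervalIntegrable (fun τ => u τ (IccExtend hab y τ)) volume a b :=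
  hu.clm_apply_continuousOn hab y.continuous.Icc_extend'.continuousOn

theorem norm_primitive_apply_le (hab : a ≤ b) {u : ℝ → W →L[ℝ] E}
    (hu : IntervalIntegrable u volume a b) (y : C(Icc a b, W)) :
    ‖primitive hab _ (hu.clm_apply_IccExtend hab y)‖ ≤ (∫ τ in a..b, ‖u τ‖) * ‖y‖ := by
  refine (ContinuousMap.norm_le _ (mul_nonneg
    (intervalIntegral.integral_nonneg hab fun _ _ => norm_nonneg _) (norm_nonneg _))).2
    fun t => ?_
  have ht : uIcc a (t : ℝ) ⊆ uIcc a b := by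
    rw [uIcc_of_le t.2.1, uIcc_of_le hab]; exact Icc_subset_Icc_right t.2.2
  refine (intervalIntegral.norm_integral_le_of_norm_le (g := fun τ => ‖u τ‖ * ‖y‖) t.2.1
    (ae_of_all _ fun τ _ => ((u τ).le_opNorm _).trans ?_)
    ((hu.norm.mono_set ht).mul_const _)).trans ?_
  · gcongr
    exact y.norm_coe_le_norm _
  · rw [intervalIntegral.integral_mul_const]
    gcongr
    exact intervalIntegral.integral_mono_interval le_rfl t.2.1 t.2.2
      (ae_of_all _ fun _ => norm_nonneg _) hu.norm

/-- The operator `y ↦ ∫ₐᵗ u(τ) y(τ) dτ` on continuous functions. -/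
def integralOp (hab : a ≤ b) (u : ℝ → W →L[ℝ] E) (hu : IntervalIntegrable u volume a b) :
    C(Icc a b, W) →L[ℝ] C(Icc a b, E) :=
  have hi : ∀ (y : C(Icc a b, W)) (t : Icc a b),
      IntervalIntegrable (fun τ => u τ (IccExtend hab y τ)) volume a t := fun y t =>
    (hu.clm_apply_IccExtend hab y).mono_set
      (by rw [uIcc_of_le t.2.1, uIcc_of_le hab]; exact Icc_subset_Icc_right t.2.2)
  LinearMap.mkContinuous
    { toFun y := primitive hab _ (hu.clm_apply_IccExtend hab y)
      map_add' y z := by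
        ext t
        simp only [primitive_apply, ContinuousMap.add_apply]
        rw [← intervalIntegral.integral_add (hi y t) (hi z t)]
        simp [IccExtend]
      map_smul' c y := by
        ext t
        simp only [primitive_apply, ContinuousMap.smul_apply, RingHom.id_apply]
        rw [← intervalIntegral.integral_smul]
        simp [IccExtend] }
    (∫ τ in a..b, ‖u τ‖) (norm_primitive_apply_le hab hu)

theorem integralOp_apply (hab : a ≤ b) (u : ℝ → W →L[ℝ] E) (hu : IntervalIntegrable u volume a b)
    (y : C(Icc a b, W)) (t : Icc a b) :
    integralOp hab u hu y t = ∫ τ in a..t, u τ (IccExtend hab y τ) := rfl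

theorem norm_integralOp_le (hab : a ≤ b) (u : ℝ → W →L[ℝ] E)
    (hu : IntervalIntegrable u volume a b) :
    ‖integralOp hab u hu‖ ≤ ∫ τ in a..b, ‖u τ‖ :=
  LinearMap.mkContinuous_norm_le _
    (intervalIntegral.integral_nonneg hab fun _ _ => norm_nonneg _) (norm_primitive_apply_le hab hu)

theorem isPrimitiveOn_integralOp (hab : a ≤ b) (u : ℝ → W →L[ℝ] E)
    (hu : IntervalIntegrable u volume a b) (y : C(Icc a b, W)) :
    IsPrimitiveOn (IccExtend hab (integralOp hab u hu y)) (fun τ => u τ (IccExtend hab y τ))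
      a b := by
  refine ⟨hab, hu.clm_apply_continuousOn hab y.continuous.Icc_extend'.continuousOn, fun t ht => ?_⟩
  rw [IccExtend_of_mem _ _ ht, IccExtend_of_mem _ _ (left_mem_Icc.2 hab), integralOp_apply,
    integralOp_apply]
  simp

end Integral

/-! ### Integral equations: C² dependence on parameters and the variational equations. -/

section Family

universe v
variable {E W : Type v} [NormedAddCommGroup E] [NormedSpace ℝ E]
  [NormedAddCommGroup W] [NormedSpace ℝ W] {K : Type*} [TopologicalSpace K] [CompactSpace K]

/-- The differential of the superposition operator of `Y`. -/
def superposeDeriv (Y : E → W) (hY : ContDiff ℝ 2 Y) (x : C(K, E)) : C(K, E) →L[ℝ] C(K, W) :=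
  pointwiseApply K E W
    (superpose ⟨fderiv ℝ Y, (hY.continuous_fderiv (by norm_num))⟩ x)

/-- The second differential of the superposition operator of `Y`. -/
def superposeDeriv2 (Y : E → W) (hY : ContDiff ℝ 2 Y) (x : C(K, E)) :
    C(K, E) →L[ℝ] C(K, E) →L[ℝ] C(K, W) :=
  (pointwiseApply K E W).comp (pointwiseApply K E (E →L[ℝ] W)
    (superpose ⟨fderiv ℝ (fderiv ℝ Y),
      (hY.fderiv_right (m := 1) (by norm_num)).continuous_fderiv (by norm_num)⟩ x))

variable (Y : E → W) (hY : ContDiff ℝ 2 Y)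

theorem hasFDerivAt_superpose_contDiff (x : C(K, E)) :
    HasFDerivAt (superpose (K := K) ⟨Y, hY.continuous⟩) (superposeDeriv Y hY x) x :=
  hasFDerivAt_superpose _ ⟨fderiv ℝ Y, _⟩
    (fun z => (hY.differentiable (by norm_num) z).hasFDerivAt) x

theorem hasFDerivAt_superposeDeriv (x : C(K, E)) :
    HasFDerivAt (superposeDeriv (K := K) Y hY) (superposeDeriv2 Y hY x) x :=
  (pointwiseApply K E W).hasFDerivAt.comp x
    (hasFDerivAt_superpose ⟨fderiv ℝ Y, _⟩ ⟨fderiv ℝ (fderiv ℝ Y), _⟩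
    (fun z => ((hY.fderiv_right (m := 1) (by norm_num)).differentiable
      (by norm_num) z).hasFDerivAt) x)

/-- First and second variation of a family of solutions of an integral equation. -/
theorem deriv_of_integral_equation
    (A B : C(K, W) →L[ℝ] C(K, E)) (c d : C(K, E)) {γ : ℝ → C(K, E)} (hγ : ContDiffAt ℝ 2 γ 0)
    (h : ∀ᶠ s in 𝓝 (0 : ℝ), γ s = c + s • d + A (superpose ⟨Y, hY.continuous⟩ (γ s)) +
      s • B (superpose ⟨Y, hY.continuous⟩ (γ s))) :
    deriv γ 0 = d + A (superposeDeriv Y hY (γ 0) (deriv γ 0)) +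
        B (superpose ⟨Y, hY.continuous⟩ (γ 0)) ∧
      deriv (deriv γ) 0 = A (superposeDeriv2 Y hY (γ 0) (deriv γ 0) (deriv γ 0) +
          superposeDeriv Y hY (γ 0) (deriv (deriv γ) 0)) +
        (2 : ℝ) • B (superposeDeriv Y hY (γ 0) (deriv γ 0)) := by
  have hd : ∀ᶠ s in 𝓝 (0 : ℝ), HasDerivAt γ (deriv γ s) s := by
    filter_upwards [hγ.eventually (by norm_num)] with s hs
    exact (hs.differentiableAt (by norm_num)).hasDerivAt
  have hd2 : HasDerivAt (deriv γ) (deriv (deriv γ) 0) 0 := by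
    have h1 : ContDiffAt ℝ 1 (fderiv ℝ γ) 0 := hγ.fderiv_right (by norm_num)
    have h2 : DifferentiableAt ℝ (fun s => fderiv ℝ γ s 1) 0 :=
      (h1.differentiableAt (by norm_num)).clm_apply (differentiableAt_const _)
    exact h2.hasDerivAt
  have hN : ∀ s, HasDerivAt γ (deriv γ s) s →
      HasDerivAt (fun s => superpose ⟨Y, hY.continuous⟩ (γ s))
        (superposeDeriv Y hY (γ s) (deriv γ s)) s := fun s hs =>
    (hasFDerivAt_superpose_contDiff Y hY (γ s)).comp_hasDerivAt s hs
  -- The once differentiated equation is needed on a neighbourhood of 0, so that it can be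
  -- differentiated again at 0. The factor 2 of the B-term comes from the product rule for s • B
  -- applied in both rounds.
  have h1 : ∀ᶠ s in 𝓝 (0 : ℝ), deriv γ s = d + A (superposeDeriv Y hY (γ s) (deriv γ s)) +
      (s • B (superposeDeriv Y hY (γ s) (deriv γ s)) +
        B (superpose ⟨Y, hY.continuous⟩ (γ s))) := by
    filter_upwards [h.eventually_nhds, hd] with s hs hds
    have hr := ((((hasDerivAt_id s).smul_const d).const_add c).add
      (A.hasFDerivAt.comp_hasDerivAt s (hN s hds))).add
      ((hasDerivAt_id s).smul (B.hasFDerivAt.comp_hasDerivAt s (hN s hds)))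
    have := (hds.congr_of_eventuallyEq (f₁ := fun s => c + s • d + _ + _)
      (hs.mono fun r hr => hr.symm)).unique hr
    simpa using this
  refine ⟨by simpa using h1.self_of_nhds, ?_⟩
  have hD : HasDerivAt (fun s => superposeDeriv Y hY (γ s) (deriv γ s))
      (superposeDeriv2 Y hY (γ 0) (deriv γ 0) (deriv γ 0) +
          superposeDeriv Y hY (γ 0) (deriv (deriv γ) 0)) 0 :=
    ((hasFDerivAt_superposeDeriv Y hY (γ 0)).comp_hasDerivAt 0 hd.self_of_nhds).clm_apply hd2
  have hr := ((A.hasFDerivAt.comp_hasDerivAt (0 : ℝ) hD).const_add d).add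
    (((hasDerivAt_id (0 : ℝ)).smul (B.hasFDerivAt.comp_hasDerivAt (0 : ℝ) hD)).add
    (B.hasFDerivAt.comp_hasDerivAt (0 : ℝ) (hN 0 hd.self_of_nhds)))
  have := (hd2.congr_of_eventuallyEq (f₁ := fun s => d + _ + _)
      (h1.mono fun r hr => hr.symm)).unique hr
  refine this.trans ?_
  simp [two_smul]

/-- Smooth dependence on parameters of the solution of an integral equation. -/
theorem exists_contDiffAt_solution [CompleteSpace E]
    (A B : C(K, W) →L[ℝ] C(K, E)) (x : C(K, E)) (z : E)
    (hx : x = ContinuousMap.const K z + A (superpose ⟨Y, hY.continuous⟩ x))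
    (hA : ‖A ∘L superposeDeriv Y hY x‖ < 1) :
    ∃ S : E × ℝ → C(K, E), ContDiffAt ℝ 2 S (z, 0) ∧ S (z, 0) = x ∧
      ∀ᶠ p in 𝓝 (z, (0 : ℝ)), S p = ContinuousMap.const K p.1 +
        A (superpose ⟨Y, hY.continuous⟩ (S p)) + p.2 • B (superpose ⟨Y, hY.continuous⟩ (S p)) := by
  let N : C(K, E) → C(K, W) := superpose ⟨Y, hY.continuous⟩
  have hN : ContDiff ℝ 2 N := contDiff_superpose 2 _ hY
  let L : E →L[ℝ] C(K, E) := LinearMap.mkContinuous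
    { toFun := fun e => ContinuousMap.const K e
      map_add' := fun _ _ => rfl
      map_smul' := fun _ _ => rfl } 1
    fun e => by
      rw [one_mul]
      exact (ContinuousMap.norm_le _ (norm_nonneg e)).2 fun k => le_rfl
  let f : (E × ℝ) × C(K, E) → C(K, E) := fun q =>
    q.2 - L q.1.1 - A (N q.2) - q.1.2 • B (N q.2)
  have hf : ContDiff ℝ 2 f := by
    have : ContDiff ℝ 2 fun q : (E × ℝ) × C(K, E) => N q.2 := hN.comp contDiff_snd
    have h1 : ContDiff ℝ 2 fun q : (E × ℝ) × C(K, E) => A (N q.2) := A.contDiff.comp this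
    have h2 : ContDiff ℝ 2 fun q : (E × ℝ) × C(K, E) => B (N q.2) := B.contDiff.comp this
    have h3 : ContDiff ℝ 2 fun q : (E × ℝ) × C(K, E) => L q.1.1 :=
      L.contDiff.comp contDiff_fst.fst
    exact ((contDiff_snd.sub h3).sub h1).sub (contDiff_fst.snd.smul h2)
  have hfx : f ((z, 0), x) = 0 := by
    have : L z = ContinuousMap.const K z := rfl
    simp only [f, zero_smul, sub_zero, this]
    rw [sub_sub, sub_eq_zero]
    exact hx
  -- The partial derivative in the curve variable is Id - A ∘ DN, invertible by the Neumann series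
  -- because ‖A ∘ DN‖ < 1.
  have hpart : fderiv ℝ f ((z, 0), x) ∘L .inr ℝ (E × ℝ) C(K, E) =
      ContinuousLinearMap.id ℝ _ - A ∘L superposeDeriv Y hY x := by
    have h1 : HasFDerivAt (fun y => f ((z, 0), y))
        (fderiv ℝ f ((z, 0), x) ∘L .inr ℝ (E × ℝ) C(K, E)) x :=
      (hf.differentiable (by norm_num) ((z, 0), x)).hasFDerivAt.comp x
        (hasFDerivAt_prodMk_right (z, (0 : ℝ)) x)
    have h2 : HasFDerivAt (fun y => y - L z - A (N y))
        (ContinuousLinearMap.id ℝ _ - A ∘L superposeDeriv Y hY x) x :=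
      ((hasFDerivAt_id x).sub_const (L z)).sub
        (A.hasFDerivAt.comp x (hasFDerivAt_superpose_contDiff Y hY x))
    refine h1.unique (h2.congr_of_eventuallyEq (.of_forall fun y => ?_))
    simp [f]
  have hinv : (fderiv ℝ f ((z, 0), x) ∘L .inr ℝ (E × ℝ) C(K, E)).IsInvertible := by
    rw [hpart]
    exact ⟨ContinuousLinearEquiv.unitsEquiv ℝ _ (Units.oneSub _ hA), rfl⟩
  have hfc : ContDiffAt ℝ 2 f ((z, 0), x) := hf.contDiffAt
  refine ⟨hfc.implicitFunction (by norm_num) hinv, hfc.contDiffAt_implicitFunction _ hinv,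
    hfc.implicitFunction_apply_self _ hinv, ?_⟩
  filter_upwards [hfc.eventually_apply_implicitFunction (by norm_num) hinv] with p hp
  rw [hfx] at hp
  set y := hfc.implicitFunction (by norm_num) hinv p
  have hp' : y - (L p.1 + A (N y) + p.2 • B (N y)) = 0 := by
    rw [← hp]; simp only [f]; abel
  exact sub_eq_zero.1 hp'

end Family

/-! ### Changes of coordinates for points, fields, covectors and brackets. -/

section Charts

variable {n : ℕ} {M : Type*} [TopologicalSpace M]
  [ChartedSpace (EuclideanSpace ℝ (Fin n)) M]

local notation "𝔼" => EuclideanSpace ℝ (Fin n)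

/-- The differential at `p` of the chart at `x`. -/
def chartDeriv (x p : M) : 𝔼 →L[ℝ] 𝔼 := mfderiv (𝓡 n) 𝓘(ℝ, 𝔼) (extChartAt (𝓡 n) x) p

/-- The differential at `z` of the inverse of the chart at `x`. -/
def symmDeriv (x : M) (z : 𝔼) : 𝔼 →L[ℝ] 𝔼 :=
  mfderiv 𝓘(ℝ, 𝔼) (𝓡 n) (extChartAt (𝓡 n) x).symm z

/-- The change of coordinates from the chart at `x` to the chart at `y`. -/
def transition (x y : M) : 𝔼 → 𝔼 := extChartAt (𝓡 n) y ∘ (extChartAt (𝓡 n) x).symm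

variable {x y p : M}

theorem transition_apply (hp : p ∈ (extChartAt (𝓡 n) x).source) :
    transition x y (extChartAt (𝓡 n) x p) = extChartAt (𝓡 n) y p := by
  simp only [transition, Function.comp_apply, (extChartAt (𝓡 n) x).left_inv hp]

theorem coordCovector_eq (φ : TangentSpace (𝓡 n) p →L[ℝ] ℝ) :
    coordCovector x φ = (φ : 𝔼 →L[ℝ] ℝ) ∘L symmDeriv x (extChartAt (𝓡 n) x p) := rfl

section

variable [IsManifold (𝓡 n) ∞ M]

theorem symmDeriv_comp_chartDeriv (hp : p ∈ (extChartAt (𝓡 n) x).source) :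
    symmDeriv x (extChartAt (𝓡 n) x p) ∘L chartDeriv x p = ContinuousLinearMap.id ℝ 𝔼 := by
  have : IsManifold (𝓡 n) 1 M := IsManifold.of_le (n := ∞) (by norm_num)
  have h := mfderivWithin_extChartAt_symm_comp_mfderiv_extChartAt' (I := 𝓡 n) hp
  simp only [modelWithCornersSelf_coe, range_id, mfderivWithin_univ] at h
  exact h

theorem chartDeriv_comp_symmDeriv (hp : p ∈ (extChartAt (𝓡 n) x).source) :
    chartDeriv x p ∘L symmDeriv x (extChartAt (𝓡 n) x p) = ContinuousLinearMap.id ℝ 𝔼 := by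
  have : IsManifold (𝓡 n) 1 M := IsManifold.of_le (n := ∞) (by norm_num)
  have h := mfderiv_extChartAt_comp_mfderivWithin_extChartAt_symm' (I := 𝓡 n) hp
  simp only [modelWithCornersSelf_coe, range_id, mfderivWithin_univ] at h
  exact h

theorem symmDeriv_chartDeriv (hp : p ∈ (extChartAt (𝓡 n) x).source) (v : 𝔼) :
    symmDeriv x (extChartAt (𝓡 n) x p) (chartDeriv x p v) = v :=
  DFunLike.congr_fun (symmDeriv_comp_chartDeriv hp) v

theorem chartDeriv_symmDeriv (hp : p ∈ (extChartAt (𝓡 n) x).source) (v : 𝔼) :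
    chartDeriv x p (symmDeriv x (extChartAt (𝓡 n) x p) v) = v :=
  DFunLike.congr_fun (chartDeriv_comp_symmDeriv hp) v

theorem chartDeriv_self : chartDeriv p p = ContinuousLinearMap.id ℝ 𝔼 :=
  have : IsManifold (𝓡 n) 1 M := IsManifold.of_le (n := ∞) (by norm_num)
  mfderiv_extChartAt_self (I := 𝓡 n)

theorem symmDeriv_self : symmDeriv p (extChartAt (𝓡 n) p p) = ContinuousLinearMap.id ℝ 𝔼 := by
  have h := symmDeriv_comp_chartDeriv (mem_extChartAt_source (I := 𝓡 n) p)
  rwa [chartDeriv_self, ContinuousLinearMap.comp_id] at h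

theorem contMDiffAt_extChartAt_symm_of_mem {z : 𝔼} (hz : z ∈ (extChartAt (𝓡 n) x).target) :
    ContMDiffAt 𝓘(ℝ, 𝔼) (𝓡 n) ∞ (extChartAt (𝓡 n) x).symm z :=
  (contMDiffOn_extChartAt_symm x).contMDiffAt
    ((isOpen_extChartAt_target x).mem_nhds hz)

theorem contMDiffAt_extChartAt_of_mem (hp : p ∈ (extChartAt (𝓡 n) x).source) :
    ContMDiffAt (𝓡 n) 𝓘(ℝ, 𝔼) ∞ (extChartAt (𝓡 n) x) p :=
  contMDiffAt_extChartAt' (by rwa [← extChartAt_source (𝓡 n)])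

theorem contDiffAt_transition (hx : p ∈ (extChartAt (𝓡 n) x).source)
    (hy : p ∈ (extChartAt (𝓡 n) y).source) :
    ContDiffAt ℝ ∞ (transition x y) (extChartAt (𝓡 n) x p) := by
  rw [← contMDiffAt_iff_contDiffAt]
  refine ContMDiffAt.comp (I' := 𝓡 n) _ ?_
    (contMDiffAt_extChartAt_symm_of_mem ((extChartAt (𝓡 n) x).map_source hx))
  rw [(extChartAt (𝓡 n) x).left_inv hx]
  exact contMDiffAt_extChartAt_of_mem hy

theorem fderiv_transition (hx : p ∈ (extChartAt (𝓡 n) x).source)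
    (hy : p ∈ (extChartAt (𝓡 n) y).source) :
    fderiv ℝ (transition x y) (extChartAt (𝓡 n) x p) =
      chartDeriv y p ∘L symmDeriv x (extChartAt (𝓡 n) x p) := by
  have e := (extChartAt (𝓡 n) x).left_inv hx
  rw [← mfderiv_eq_fderiv]
  have := mfderiv_comp (I' := 𝓡 n) (I'' := 𝓘(ℝ, 𝔼)) (extChartAt (𝓡 n) x p)
    (g := extChartAt (𝓡 n) y) (f := (extChartAt (𝓡 n) x).symm)
    (by rw [e]; exact (contMDiffAt_extChartAt_of_mem hy).mdifferentiableAt (by simp))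
    ((contMDiffAt_extChartAt_symm_of_mem
      ((extChartAt (𝓡 n) x).map_source hx)).mdifferentiableAt (by simp))
  refine this.trans ?_
  rw [e]
  rfl

theorem coordField_apply (V : (p : M) → TangentSpace (𝓡 n) p)
    (hp : p ∈ (extChartAt (𝓡 n) x).source) :
    coordField x V (extChartAt (𝓡 n) x p) = chartDeriv x p (V p) := by
  have h1 : coordField x V (extChartAt (𝓡 n) x p) =
      (symmDeriv x (extChartAt (𝓡 n) x p)).inverse
        (V ((extChartAt (𝓡 n) x).symm (extChartAt (𝓡 n) x p)) : 𝔼) := rfl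
  -- The values of V at two equal points have different types; both tangent spaces unfold to ℝⁿ,
  -- where they can be compared.
  have h2 : ∀ p', p' = p → (V p' : 𝔼) = V p := by rintro _ rfl; rfl
  rw [h1, h2 _ ((extChartAt (𝓡 n) x).left_inv hp),
    ContinuousLinearMap.inverse_eq (symmDeriv_comp_chartDeriv hp) (chartDeriv_comp_symmDeriv hp)]

theorem coordField_transition (V : (p : M) → TangentSpace (𝓡 n) p)
    (hx : p ∈ (extChartAt (𝓡 n) x).source) (hy : p ∈ (extChartAt (𝓡 n) y).source) :
    coordField y V (extChartAt (𝓡 n) y p) =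
      fderiv ℝ (transition x y) (extChartAt (𝓡 n) x p)
        (coordField x V (extChartAt (𝓡 n) x p)) := by
  rw [fderiv_transition hx hy, coordField_apply V hx, coordField_apply V hy]
  exact congrArg (chartDeriv y p) (symmDeriv_chartDeriv hx (V p)).symm

theorem coordCovector_transition (φ : TangentSpace (𝓡 n) p →L[ℝ] ℝ)
    (hx : p ∈ (extChartAt (𝓡 n) x).source) (hy : p ∈ (extChartAt (𝓡 n) y).source) :
    coordCovector y φ =
      coordCovector x φ ∘L fderiv ℝ (transition y x) (extChartAt (𝓡 n) y p) := by
  rw [fderiv_transition hy hx]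
  refine ContinuousLinearMap.ext fun v => ?_
  exact congrArg φ (symmDeriv_chartDeriv hx (symmDeriv y (extChartAt (𝓡 n) y p) v)).symm

theorem coordCovector_coordField (φ : TangentSpace (𝓡 n) p →L[ℝ] ℝ)
    (V : (p : M) → TangentSpace (𝓡 n) p) (hx : p ∈ (extChartAt (𝓡 n) x).source) :
    coordCovector x φ (coordField x V (extChartAt (𝓡 n) x p)) = φ (V p) := by
  rw [coordField_apply V hx]
  exact congrArg φ (symmDeriv_chartDeriv hx (V p))

theorem coordCovector_self (φ : TangentSpace (𝓡 n) p →L[ℝ] ℝ) : coordCovector p φ = φ := by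
  rw [coordCovector_eq, symmDeriv_self]
  rfl

theorem coordCovector_comp_chartDeriv (φ : TangentSpace (𝓡 n) p →L[ℝ] ℝ)
    (hx : p ∈ (extChartAt (𝓡 n) x).source) : coordCovector x φ ∘L chartDeriv x p = φ :=
  ContinuousLinearMap.ext fun v => congrArg φ (symmDeriv_chartDeriv hx v)

theorem contDiffAt_coordField {V : (p : M) → TangentSpace (𝓡 n) p}
    (hV : ContMDiff (𝓡 n) (𝓡 n).tangent ∞ (fun p => (⟨p, V p⟩ : TangentBundle (𝓡 n) M)))
    (hx : p ∈ (extChartAt (𝓡 n) x).source) :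
    ContDiffAt ℝ ∞ (coordField x V) (extChartAt (𝓡 n) x p) := by
  have hz := (extChartAt (𝓡 n) x).map_source hx
  have h1 := ContMDiffAt.mpullback_vectorField_preimage (I := 𝓘(ℝ, 𝔼)) (I' := 𝓡 n)
    (f := (extChartAt (𝓡 n) x).symm) (V := V) (x₀ := extChartAt (𝓡 n) x p) (m := ∞) (n := ∞)
    (hV _) (contMDiffAt_extChartAt_symm_of_mem hz)
    (ContinuousLinearMap.IsInvertible.of_inverse
      (symmDeriv_comp_chartDeriv hx) (chartDeriv_comp_symmDeriv hx)) (by norm_num)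
  rw [← contMDiffAt_iff_contDiffAt]
  exact (contMDiff_snd_tangentBundle_modelSpace 𝔼 𝓘(ℝ, 𝔼)).contMDiffAt.comp _ h1

theorem mlieBracket_eq_lieBracket (V W : (p : M) → TangentSpace (𝓡 n) p) (p : M) :
    VectorField.mlieBracket (𝓡 n) V W p =
      VectorField.lieBracket ℝ (coordField p V) (coordField p W) (extChartAt (𝓡 n) p p) := by
  rw [← VectorField.mlieBracketWithin_univ, VectorField.mlieBracketWithin_apply]
  have h : mfderiv (𝓡 n) 𝓘(ℝ, 𝔼) (extChartAt (𝓡 n) p) p = ContinuousLinearMap.id ℝ 𝔼 :=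
    chartDeriv_self
  rw [h]
  simp only [modelWithCornersSelf_coe, range_id, preimage_univ, inter_univ,
    VectorField.mpullbackWithin_univ]
  erw [ContinuousLinearMap.inverse_id]
  exact congrFun (VectorField.lieBracketWithin_univ (V := coordField p V) (W := coordField p W)) _

end

end Charts

/-! ### Trajectories and Pontryagin covectors on subintervals, and their independence of the chart.
-/

section Trajectories

variable {n l : ℕ} {M : Type*} [TopologicalSpace M]
  [ChartedSpace (EuclideanSpace ℝ (Fin n)) M]

local notation "𝔼" => EuclideanSpace ℝ (Fin n)

/-- The pairing `(u, w) ↦ ∑ uᵢ wᵢ` of a control with a family of vectors. -/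
def controlAction (l : ℕ) (F : Type*) [NormedAddCommGroup F] [NormedSpace ℝ F] :
    EuclideanSpace ℝ (Fin l) →L[ℝ] (Fin l → F) →L[ℝ] F :=
  ∑ i, (ContinuousLinearMap.lsmul ℝ ℝ : ℝ →L[ℝ] F →L[ℝ] F).bilinearComp
    (EuclideanSpace.proj i) (ContinuousLinearMap.proj i)

@[simp]
theorem controlAction_apply {F : Type*} [NormedAddCommGroup F] [NormedSpace ℝ F]
    (u : EuclideanSpace ℝ (Fin l)) (w : Fin l → F) : controlAction l F u w = ∑ i, u i • w i := by
  simp [controlAction]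

/-- The velocity `∑ uᵢ Xᵢ` in the chart at `x`. -/
def velocity (X : Fin l → (p : M) → TangentSpace (𝓡 n) p) (x : M)
    (u : EuclideanSpace ℝ (Fin l)) (z : 𝔼) : 𝔼 :=
  ∑ i, u i • coordField x (X i) z

/-- The differential of the velocity `∑ uᵢ Xᵢ` in the chart at `x`. -/
def velocityDeriv (X : Fin l → (p : M) → TangentSpace (𝓡 n) p) (x : M)
    (u : EuclideanSpace ℝ (Fin l)) (z : 𝔼) : 𝔼 →L[ℝ] 𝔼 :=
  ∑ i, u i • fderiv ℝ (coordField x (X i)) z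

/-- `q` is a trajectory of the control `u` on `[a,b]`. -/
structure TrajOn (X : Fin l → (p : M) → TangentSpace (𝓡 n) p)
    (u : ℝ → EuclideanSpace ℝ (Fin l)) (q : ℝ → M)
    (a b : ℝ) : Prop where
  le : a ≤ b
  continuousOn : ContinuousOn q (Icc a b)
  ode : ∀ (x : M) (a' b' : ℝ), a ≤ a' → a' ≤ b' → b' ≤ b →
    (∀ t ∈ Icc a' b', q t ∈ (extChartAt (𝓡 n) x).source) →
    IsPrimitiveOn (fun t => extChartAt (𝓡 n) x (q t))
      (fun t => velocity X x (u t) (extChartAt (𝓡 n) x (q t))) a' b'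

/-- `φ` is a Pontryagin covector along `q` on `[a,b]`. -/
structure PontrOn (X : Fin l → (p : M) → TangentSpace (𝓡 n) p)
    (u : ℝ → EuclideanSpace ℝ (Fin l)) (q : ℝ → M)
    (φ : (t : ℝ) → TangentSpace (𝓡 n) (q t) →L[ℝ] ℝ) (a b : ℝ) : Prop where
  le : a ≤ b
  ode : ∀ (x : M) (a' b' : ℝ), a ≤ a' → a' ≤ b' → b' ≤ b →
    (∀ t ∈ Icc a' b', q t ∈ (extChartAt (𝓡 n) x).source) →
    IsPrimitiveOn (fun t => coordCovector x (φ t))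
      (fun t => -(coordCovector x (φ t) ∘L velocityDeriv X x (u t) (extChartAt (𝓡 n) x (q t)))) a' b'

variable {X : Fin l → (p : M) → TangentSpace (𝓡 n) p}
  {u u' : ℝ → EuclideanSpace ℝ (Fin l)} {q q' : ℝ → M}
  {φ : (t : ℝ) → TangentSpace (𝓡 n) (q t) →L[ℝ] ℝ} {a b c : ℝ}

theorem velocity_eq (x : M) (u : EuclideanSpace ℝ (Fin l)) (z : 𝔼) :
    velocity X x u z = controlAction l 𝔼 u (fun i => coordField x (X i) z) := by
  simp [velocity]

theorem velocityDeriv_eq (x : M) (u : EuclideanSpace ℝ (Fin l)) (z : 𝔼) :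
    velocityDeriv X x u z =
      controlAction l (𝔼 →L[ℝ] 𝔼) u (fun i => fderiv ℝ (coordField x (X i)) z) := by
  simp [velocityDeriv]

namespace TrajOn

theorem mono (h : TrajOn X u q a b) {a' b' : ℝ} (ha : a ≤ a') (hab : a' ≤ b') (hb : b' ≤ b) :
    TrajOn X u q a' b' :=
  ⟨hab, h.continuousOn.mono (Icc_subset_Icc ha hb), fun x a'' b'' h1 h2 h3 h4 =>
    h.ode x a'' b'' (ha.trans h1) h2 (h3.trans hb) h4⟩

theorem concat (h : TrajOn X u q a b) (h' : TrajOn X u q b c) : TrajOn X u q a c := by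
  refine ⟨h.le.trans h'.le, ?_, fun x a' c' h1 h2 h3 h4 => ?_⟩
  · rw [← Icc_union_Icc_eq_Icc h.le h'.le]
    exact h.continuousOn.union_of_isClosed h'.continuousOn isClosed_Icc isClosed_Icc
  · rcases le_total c' b with hc | hc
    · exact h.ode x a' c' h1 h2 hc h4
    rcases le_total b a' with ha | ha
    · exact h'.ode x a' c' ha h2 h3 h4
    · exact (h.ode x a' b h1 ha le_rfl fun t ht => h4 t ⟨ht.1, ht.2.trans hc⟩).concat
        (h'.ode x b c' le_rfl hc h3 fun t ht => h4 t ⟨ha.trans ht.1, ht.2⟩)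

theorem congr (h : TrajOn X u q a b) (hu : ∀ᵐ t ∂(volume.restrict (Icc a b)), u t = u' t)
    (hq : EqOn q' q (Icc a b)) : TrajOn X u' q' a b := by
  refine ⟨h.le, h.continuousOn.congr hq, fun x a' b' h1 h2 h3 h4 => ?_⟩
  have hsub : Icc a' b' ⊆ Icc a b := Icc_subset_Icc h1 h3
  refine ((h.ode x a' b' h1 h2 h3 fun t ht => ?_).congr_right ?_).congr_left fun t ht => ?_
  · rw [← hq (hsub ht)]; exact h4 t ht
  · filter_upwards [ae_restrict_of_ae_restrict_of_subset hsub hu,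
      ae_restrict_mem measurableSet_Icc] with t ht ht'
    rw [ht, hq (hsub ht')]
  · simp only [hq (hsub ht)]

end TrajOn

namespace PontrOn

theorem mono (h : PontrOn X u q φ a b) {a' b' : ℝ} (ha : a ≤ a') (hab : a' ≤ b') (hb : b' ≤ b) :
    PontrOn X u q φ a' b' :=
  ⟨hab, fun x a'' b'' h1 h2 h3 h4 => h.ode x a'' b'' (ha.trans h1) h2 (h3.trans hb) h4⟩

theorem concat (h : PontrOn X u q φ a b) (h' : PontrOn X u q φ b c) : PontrOn X u q φ a c := by
  refine ⟨h.le.trans h'.le, fun x a' c' h1 h2 h3 h4 => ?_⟩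
  · rcases le_total c' b with hc | hc
    · exact h.ode x a' c' h1 h2 hc h4
    rcases le_total b a' with ha | ha
    · exact h'.ode x a' c' ha h2 h3 h4
    · exact (h.ode x a' b h1 ha le_rfl fun t ht => h4 t ⟨ht.1, ht.2.trans hc⟩).concat
        (h'.ode x b c' le_rfl hc h3 fun t ht => h4 t ⟨ha.trans ht.1, ht.2⟩)

theorem congr (h : PontrOn X u q φ a b) {φ' : (t : ℝ) → TangentSpace (𝓡 n) (q t) →L[ℝ] ℝ}
    (hφ : ∀ t ∈ Icc a b, φ' t = φ t) : PontrOn X u q φ' a b := by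
  refine ⟨h.le, fun x a' b' h1 h2 h3 h4 => ?_⟩
  have hsub : Icc a' b' ⊆ Icc a b := Icc_subset_Icc h1 h3
  refine ((h.ode x a' b' h1 h2 h3 h4).congr_right ?_).congr_left fun t ht => ?_
  · filter_upwards [ae_restrict_mem measurableSet_Icc] with t ht
    rw [hφ t (hsub ht)]
  · simp only [hφ t (hsub ht)]

end PontrOn

section Manifold

variable [IsManifold (𝓡 n) ∞ M]

omit [IsManifold (𝓡 n) ∞ M] in
theorem continuousOn_coord {x : M} (hq : ContinuousOn q (Icc a b))
    (hx : ∀ t ∈ Icc a b, q t ∈ (extChartAt (𝓡 n) x).source) :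
    ContinuousOn (fun t => extChartAt (𝓡 n) x (q t)) (Icc a b) :=
  (continuousOn_extChartAt x).comp hq hx

/-- The chain rule applied to the transition map: fields transform by its differential, so the
equation in one chart yields it in every other chart. -/
theorem TrajOn.of_chart {x : M} (hq : ContinuousOn q (Icc a b))
    (hx : ∀ t ∈ Icc a b, q t ∈ (extChartAt (𝓡 n) x).source)
    (h : IsPrimitiveOn (fun t => extChartAt (𝓡 n) x (q t))
      (fun t => velocity X x (u t) (extChartAt (𝓡 n) x (q t))) a b) : TrajOn X u q a b := by
  refine ⟨h.le, hq, fun y a' b' h1 h2 h3 hy => ?_⟩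
  have hsub : Icc a' b' ⊆ Icc a b := Icc_subset_Icc h1 h3
  have hc : ∀ t ∈ Icc a' b', ContDiffAt ℝ ∞ (transition x y) (extChartAt (𝓡 n) x (q t)) :=
    fun t ht => contDiffAt_transition (hx t (hsub ht)) (hy t ht)
  refine (((h.mono h1 h2 h3).comp_hasFDerivAt (f := transition x y)
    (f' := fderiv ℝ (transition x y))
    (fun t ht => ((hc t ht).differentiableAt (by simp)).hasFDerivAt) fun t ht => ?_).congr_right
    ?_).congr_left fun t ht => ?_
  · exact (((hc t ht).fderiv_right (m := ∞) (by norm_num)).continuousAt).comp_continuousWithinAt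
      (f := fun t => extChartAt (𝓡 n) x (q t)) ((continuousOn_coord hq hx).mono hsub t ht)
  · filter_upwards [ae_restrict_mem measurableSet_Icc] with t ht
    simp only [velocity, map_sum, map_smul]
    refine Finset.sum_congr rfl fun i _ => ?_
    rw [coordField_transition (X i) (hx t (hsub ht)) (hy t ht)]
  · exact (transition_apply (hx t (hsub ht))).symm

theorem continuousOn_coordField (hX : ∀ i, ContMDiff (𝓡 n) (𝓡 n).tangent ∞
      (fun p => (⟨p, X i p⟩ : TangentBundle (𝓡 n) M))) {x : M} (hq : ContinuousOn q (Icc a b))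
    (hx : ∀ t ∈ Icc a b, q t ∈ (extChartAt (𝓡 n) x).source) :
    ContinuousOn (fun t i => coordField x (X i) (extChartAt (𝓡 n) x (q t))) (Icc a b) :=
  continuousOn_pi.2 fun i t ht =>
    (contDiffAt_coordField (hX i) (hx t ht)).continuousAt.comp_continuousWithinAt
      (f := fun t => extChartAt (𝓡 n) x (q t)) (continuousOn_coord hq hx t ht)

theorem continuousOn_fderiv_coordField (hX : ∀ i, ContMDiff (𝓡 n) (𝓡 n).tangent ∞
      (fun p => (⟨p, X i p⟩ : TangentBundle (𝓡 n) M))) {x : M} (hq : ContinuousOn q (Icc a b))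
    (hx : ∀ t ∈ Icc a b, q t ∈ (extChartAt (𝓡 n) x).source) :
    ContinuousOn (fun t i => fderiv ℝ (coordField x (X i)) (extChartAt (𝓡 n) x (q t)))
      (Icc a b) :=
  continuousOn_pi.2 fun i t ht =>
    ((contDiffAt_coordField (hX i) (hx t ht)).fderiv_right (m := ∞)
      (by norm_num)).continuousAt.comp_continuousWithinAt
      (f := fun t => extChartAt (𝓡 n) x (q t)) (continuousOn_coord hq hx t ht)

theorem intervalIntegrable_velocity (hX : ∀ i, ContMDiff (𝓡 n) (𝓡 n).tangent ∞
      (fun p => (⟨p, X i p⟩ : TangentBundle (𝓡 n) M))) {x : M} (hab : a ≤ b)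
    (hu : IntervalIntegrable u volume a b) (hq : ContinuousOn q (Icc a b))
    (hx : ∀ t ∈ Icc a b, q t ∈ (extChartAt (𝓡 n) x).source) :
    IntervalIntegrable (fun t => velocity X x (u t) (extChartAt (𝓡 n) x (q t))) volume a b := by
  simp only [velocity_eq]
  exact (hu.clm_comp (controlAction l 𝔼)).clm_apply_continuousOn hab
    (continuousOn_coordField hX hq hx)

theorem intervalIntegrable_velocityDeriv (hX : ∀ i, ContMDiff (𝓡 n) (𝓡 n).tangent ∞
      (fun p => (⟨p, X i p⟩ : TangentBundle (𝓡 n) M))) {x : M} (hab : a ≤ b)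
    (hu : IntervalIntegrable u volume a b) (hq : ContinuousOn q (Icc a b))
    (hx : ∀ t ∈ Icc a b, q t ∈ (extChartAt (𝓡 n) x).source) :
    IntervalIntegrable (fun t => velocityDeriv X x (u t) (extChartAt (𝓡 n) x (q t)))
      volume a b := by
  simp only [velocityDeriv_eq]
  have h := hu.clm_comp (F := (Fin l → 𝔼 →L[ℝ] 𝔼) →L[ℝ] 𝔼 →L[ℝ] 𝔼) (controlAction l (𝔼 →L[ℝ] 𝔼))
  exact h.clm_apply_continuousOn hab (continuousOn_fderiv_coordField hX hq hx)

/-- Obtained by differentiating the transformation law of V near the point. Symmetry of the second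
derivative moves V into the first slot, where it matches the derivative of Dψ along a trajectory. -/
theorem fderiv_coordField_transition {V : (p : M) → TangentSpace (𝓡 n) p}
    (hV : ContMDiff (𝓡 n) (𝓡 n).tangent ∞ (fun p => (⟨p, V p⟩ : TangentBundle (𝓡 n) M)))
    {x y p : M} (hx : p ∈ (extChartAt (𝓡 n) x).source) (hy : p ∈ (extChartAt (𝓡 n) y).source)
    (v : 𝔼) :
    fderiv ℝ (coordField x V) (extChartAt (𝓡 n) x p)
        (fderiv ℝ (transition y x) (extChartAt (𝓡 n) y p) v) =
      fderiv ℝ (fderiv ℝ (transition y x)) (extChartAt (𝓡 n) y p)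
        (coordField y V (extChartAt (𝓡 n) y p)) v +
      fderiv ℝ (transition y x) (extChartAt (𝓡 n) y p)
        (fderiv ℝ (coordField y V) (extChartAt (𝓡 n) y p) v) := by
  set z := extChartAt (𝓡 n) y p with hz
  have hψ : ContDiffAt ℝ ∞ (transition y x) z := contDiffAt_transition hy hx
  have hψz : transition y x z = extChartAt (𝓡 n) x p := transition_apply hy
  have hev : (fun w => coordField x V (transition y x w)) =ᶠ[𝓝 z]
      fun w => fderiv ℝ (transition y x) w (coordField y V w) := by
    have h1 : ∀ᶠ w in 𝓝 z, w ∈ (extChartAt (𝓡 n) y).target :=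
      (isOpen_extChartAt_target y).mem_nhds ((extChartAt (𝓡 n) y).map_source hy)
    have h2 : ∀ᶠ w in 𝓝 z, (extChartAt (𝓡 n) y).symm w ∈ (extChartAt (𝓡 n) x).source := by
      refine (contMDiffAt_extChartAt_symm_of_mem
        ((extChartAt (𝓡 n) y).map_source hy)).continuousAt.eventually_mem ?_
      rw [(extChartAt (𝓡 n) y).left_inv hy]
      exact (isOpen_extChartAt_source x).mem_nhds hx
    filter_upwards [h1, h2] with w hw1 hw2
    have := coordField_transition V ((extChartAt (𝓡 n) y).map_target hw1) hw2
    rwa [(extChartAt (𝓡 n) y).right_inv hw1] at this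
  have d1 : HasFDerivAt (fun w => coordField x V (transition y x w))
      (fderiv ℝ (coordField x V) (extChartAt (𝓡 n) x p) ∘L fderiv ℝ (transition y x) z) z := by
    refine HasFDerivAt.comp z ?_ (hψ.differentiableAt (by simp)).hasFDerivAt
    rw [hψz]
    exact ((contDiffAt_coordField hV hx).differentiableAt (by simp)).hasFDerivAt
  have d2 := (((hψ.fderiv_right (m := ∞) (by norm_num)).differentiableAt
    (by simp)).hasFDerivAt).clm_apply
    ((contDiffAt_coordField hV hy).differentiableAt (by simp)).hasFDerivAt
  have := DFunLike.congr_fun (d1.unique (d2.congr_of_eventuallyEq hev)) v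
  have hsymm : IsSymmSndFDerivAt ℝ (transition y x) z :=
    hψ.isSymmSndFDerivAt (by simp; exact WithTop.coe_le_coe.2 le_top)
  simp only [ContinuousLinearMap.comp_apply, add_apply, ContinuousLinearMap.flip_apply] at this
  rw [this, hsymm.eq]
  abel

/-- Covectors transform by φ_y = φ_x ∘ Dψ. The product rule produces a D²ψ term along the
trajectory, and it cancels against the one in `fderiv_coordField_transition`. -/
theorem PontrOn.of_chart (hX : ∀ i, ContMDiff (𝓡 n) (𝓡 n).tangent ∞
      (fun p => (⟨p, X i p⟩ : TangentBundle (𝓡 n) M))) {x : M}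
    (hq : TrajOn X u q a b) (hx : ∀ t ∈ Icc a b, q t ∈ (extChartAt (𝓡 n) x).source)
    (h : IsPrimitiveOn (fun t => coordCovector x (φ t))
      (fun t => -(coordCovector x (φ t) ∘L
        velocityDeriv X x (u t) (extChartAt (𝓡 n) x (q t)))) a b) :
    PontrOn X u q φ a b := by
  refine ⟨h.le, fun y a' b' h1 h2 h3 hy => ?_⟩
  have hsub : Icc a' b' ⊆ Icc a b := Icc_subset_Icc h1 h3
  have hc : ∀ t ∈ Icc a' b', ContDiffAt ℝ ∞ (fderiv ℝ (transition y x))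
      (extChartAt (𝓡 n) y (q t)) := fun t ht =>
    (contDiffAt_transition (hy t ht) (hx t (hsub ht))).fderiv_right (m := ∞) (by norm_num)
  have hD := (hq.ode y a' b' h1 h2 h3 hy).comp_hasFDerivAt (f := fderiv ℝ (transition y x))
    (f' := fderiv ℝ (fderiv ℝ (transition y x)))
    (fun t ht => ((hc t ht).differentiableAt (by simp)).hasFDerivAt) fun t ht =>
      (((hc t ht).fderiv_right (m := ∞) (by norm_num)).continuousAt).comp_continuousWithinAt
      (f := fun t => extChartAt (𝓡 n) y (q t))
      (continuousOn_coord (hq.continuousOn.mono hsub) hy t ht)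
  refine (((h.mono h1 h2 h3).bilinear hD (ContinuousLinearMap.compL ℝ 𝔼 𝔼 ℝ)).congr_right
    ?_).congr_left fun t ht => coordCovector_transition _ (hx t (hsub ht)) (hy t ht)
  filter_upwards [ae_restrict_mem measurableSet_Icc] with t ht
  rw [coordCovector_transition (φ t) (hx t (hsub ht)) (hy t ht)]
  ext1 v
  simp only [ContinuousLinearMap.compL_apply, add_apply, ContinuousLinearMap.comp_apply,
    neg_apply, velocity, velocityDeriv, sum_apply, map_sum, map_smul,
    smul_apply]
  rw [← Finset.sum_neg_distrib, ← Finset.sum_add_distrib, ← Finset.sum_neg_distrib]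
  refine Finset.sum_congr rfl fun i _ => ?_
  rw [fderiv_coordField_transition (hX i) (hx t (hsub ht)) (hy t ht) v, map_add, smul_add]
  abel

/-- Continuity of q makes the velocity integrable, and the integrated equation on [a,t] for each t
shows that the coordinate curve is a primitive. -/
theorem isTrajectory_iff (hX : ∀ i, ContMDiff (𝓡 n) (𝓡 n).tangent ∞
      (fun p => (⟨p, X i p⟩ : TangentBundle (𝓡 n) M))) {q₀ : M} {T : ℝ} (hT : 0 ≤ T)
    {u : Control T l} (hu : IntervalIntegrable u volume 0 T) :
    IsTrajectory X q₀ T u q ↔ TrajOn X u q 0 T ∧ q 0 = q₀ := by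
  constructor
  · refine fun h => ⟨⟨hT, h.continuousOn, fun x a b h1 h2 h3 h4 => ⟨h2, ?_, fun t ht => ?_⟩⟩,
      h.init⟩
    · refine intervalIntegrable_velocity hX h2 (hu.mono_set ?_)
        (h.continuousOn.mono (Icc_subset_Icc h1 h3)) h4
      rw [uIcc_of_le h2, uIcc_of_le hT]
      exact Icc_subset_Icc h1 h3
    · exact h.ode x a t h1 ht.1 (ht.2.trans h3) fun s hs => h4 s ⟨hs.1, hs.2.trans ht.2⟩
  · rintro ⟨h, h0⟩
    exact ⟨h.continuousOn, h0, fun x a b h1 h2 h3 h4 =>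
      (h.ode x a b h1 h2 h3 h4).eq b (right_mem_Icc.2 h2)⟩

/-- The defining equation is tested on each vector v separately; since evaluation at v commutes with
the integral, this amounts to one equation in the dual space. -/
theorem isPontryagin_iff (hX : ∀ i, ContMDiff (𝓡 n) (𝓡 n).tangent ∞
      (fun p => (⟨p, X i p⟩ : TangentBundle (𝓡 n) M))) {T : ℝ} (hT : 0 ≤ T)
    {u : Control T l} (hu : IntervalIntegrable u volume 0 T) (hq : ContinuousOn q (Icc 0 T)) :
    IsPontryagin X T u q φ ↔ PontrOn X u q φ 0 T := by
  have hint : ∀ (x : M) (a b : ℝ), 0 ≤ a → a ≤ b → b ≤ T →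
      (∀ t ∈ Icc a b, q t ∈ (extChartAt (𝓡 n) x).source) →
      ContinuousOn (fun t => coordCovector x (φ t)) (Icc a b) →
      IntervalIntegrable (fun t => -(coordCovector x (φ t) ∘L
        velocityDeriv X x (u t) (extChartAt (𝓡 n) x (q t)))) volume a b := by
    intro x a b h1 h2 h3 h4 h5
    have hv := intervalIntegrable_velocityDeriv (x := x) hX h2 (hu.mono_set (by
      rw [uIcc_of_le h2, uIcc_of_le hT]
      exact Icc_subset_Icc h1 h3)) (hq.mono (Icc_subset_Icc h1 h3)) h4
    exact (ContinuousOn.intervalIntegrable_clm_apply h2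
      ((ContinuousLinearMap.compL ℝ 𝔼 𝔼 ℝ).continuous.comp_continuousOn h5) hv).neg
  have happ : ∀ (x : M) (a b : ℝ) (v : 𝔼), IntervalIntegrable (fun t => -(coordCovector x (φ t) ∘L
        velocityDeriv X x (u t) (extChartAt (𝓡 n) x (q t)))) volume a b →
      (∫ t in a..b, -(coordCovector x (φ t) ∘L
        velocityDeriv X x (u t) (extChartAt (𝓡 n) x (q t)))) v =
      -∫ t in a..b, coordCovector x (φ t)
          (∑ i, u t i • fderiv ℝ (coordField x (X i)) (extChartAt (𝓡 n) x (q t)) v) := by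
    intro x a b v hi
    rw [ContinuousLinearMap.intervalIntegral_apply hi, ← intervalIntegral.integral_neg]
    simp [velocityDeriv, sum_apply]
  constructor
  · refine fun h => ⟨hT, fun x a b h1 h2 h3 h4 => ⟨h2, hint x a b h1 h2 h3 h4
      (h.continuousOn x a b h1 h2 h3 h4), fun t ht => ?_⟩⟩
    ext1 v
    have h5 : ∀ s ∈ Icc a t, q s ∈ (extChartAt (𝓡 n) x).source :=
      fun s hs => h4 s ⟨hs.1, hs.2.trans ht.2⟩
    rw [add_apply, happ x a t v (hint x a t h1 ht.1 (ht.2.trans h3) h5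
      (h.continuousOn x a t h1 ht.1 (ht.2.trans h3) h5)), ← sub_eq_add_neg]
    exact h.ode x a t h1 ht.1 (ht.2.trans h3) h5 v
  · refine fun h => ⟨fun x a b h1 h2 h3 h4 => (h.ode x a b h1 h2 h3 h4).continuousOn,
      fun x a b h1 h2 h3 h4 v => ?_⟩
    have hp := h.ode x a b h1 h2 h3 h4
    have h6 : coordCovector x (φ b) = _ := hp.eq b (right_mem_Icc.2 h2)
    rw [h6, add_apply, happ x a b v hp.integrable, sub_eq_add_neg]

end Manifold
end Trajectories

/-! ### Localisation: passage from short to long intervals and smooth cut-off. -/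

/-- A relation between the points of an interval which is transitive and holds for all pairs of
sufficiently close points holds for all pairs. -/
theorem rel_of_short {R : ℝ → ℝ → Prop} {A B δ : ℝ} (hδ : 0 < δ)
    (hshort : ∀ a b, A ≤ a → a ≤ b → b ≤ B → b - a < δ → R a b)
    (htrans : ∀ a b c, A ≤ a → a ≤ b → b ≤ c → c ≤ B → R a b → R b c → R a c) :
    ∀ a b, A ≤ a → a ≤ b → b ≤ B → R a b := by
  -- The induction peels off a last piece of length δ/2, strictly below the threshold δ.
  have key : ∀ (N : ℕ) (a b : ℝ), A ≤ a → a ≤ b → b ≤ B → b - a < (N + 1) * (δ / 2) → R a b := by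
    intro N
    induction N with
    | zero => exact fun a b h1 h2 h3 h4 => hshort a b h1 h2 h3 (by norm_num at h4; linarith)
    | succ N ih =>
      intro a b h1 h2 h3 h4
      push_cast at h4
      rcases lt_or_ge (b - a) δ with h | h
      · exact hshort a b h1 h2 h3 h
      · exact htrans a (b - δ / 2) b h1 (by linarith) (by linarith) h3
          (ih a (b - δ / 2) h1 (by linarith) (by linarith) (by linarith))
          (hshort _ _ (by linarith) (by linarith) h3 (by linarith))
  intro a b h1 h2 h3
  obtain ⟨N, hN⟩ := exists_nat_gt ((b - a) / (δ / 2))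
  refine key N a b h1 h2 h3 ?_
  rw [div_lt_iff₀ (half_pos hδ)] at hN
  linarith [half_pos hδ]

/-- Multiplication by a bump function. The coordinate fields are meaningful only on the target of a
chart, whereas the superposition operator should act on all continuous curves. -/
theorem exists_contDiff_extension {E F : Type*} [NormedAddCommGroup E] [NormedSpace ℝ E]
    [FiniteDimensional ℝ E] [NormedAddCommGroup F] [NormedSpace ℝ F] {f : E → F} {z : E}
    (hf : ContDiffAt ℝ 2 f z) :
    ∃ g : E → F, ContDiff ℝ 2 g ∧ g =ᶠ[𝓝 z] f := by
  obtain ⟨s, hs, hfs⟩ := hf.contDiffOn (m := 2) le_rfl (by simp)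
  obtain ⟨r, hr, hrs⟩ := Metric.mem_nhds_iff.1 hs
  let χ : ContDiffBump z := ⟨r / 3, r / 2, by linarith, by linarith⟩
  refine ⟨fun w => χ w • f w, contDiff_iff_contDiffAt.2 fun w => ?_, ?_⟩
  · rcases lt_or_ge (dist w z) r with hw | hw
    · exact χ.contDiffAt.smul (hfs.contDiffAt
      (mem_of_superset (Metric.isOpen_ball.mem_nhds hw) hrs))
    · refine contDiffAt_const (c := (0 : F)).congr_of_eventuallyEq ?_
      have : ∀ᶠ w' in 𝓝 w, w' ∈ (Metric.closedBall z (r / 2))ᶜ :=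
        Metric.isClosed_closedBall.isOpen_compl.mem_nhds (by
          simp only [mem_compl_iff, Metric.mem_closedBall, not_le]; linarith)
      filter_upwards [this] with w' hw'
      rw [χ.zero_of_le_dist, zero_smul]
      simp only [mem_compl_iff, Metric.mem_closedBall, not_le] at hw'
      exact hw'.le
  · filter_upwards [χ.eventuallyEq_one] with w hw
    simp [hw]

/-! ### Short intervals on which the equation lives in one chart; uniqueness of trajectories. -/

section Adapted

variable {n l : ℕ} {M : Type*} [TopologicalSpace M]
  [ChartedSpace (EuclideanSpace ℝ (Fin n)) M]

local notation "𝔼" => EuclideanSpace ℝ (Fin n)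

/-- A system of globally defined fields `Y` representing the fields `X` in the chart at `x` on the
set `V` containing the curve `q` on the interval `[a,b]`, this interval being so short that the
linearised equation is governed by a contraction. -/
structure IsAdapted (X : Fin l → (p : M) → TangentSpace (𝓡 n) p)
    (u : ℝ → EuclideanSpace ℝ (Fin l)) (x : M) (Y : 𝔼 → Fin l → 𝔼) (V : Set 𝔼) (K : ℝ) (q : ℝ → M)
    (a b : ℝ) : Prop where
  le : a ≤ b
  contDiff : ContDiff ℝ 2 Y
  isOpen : IsOpen V
  convex : Convex ℝ V
  subset : V ⊆ (extChartAt (𝓡 n) x).target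
  eq : ∀ z ∈ V, Y z = fun i => coordField x (X i) z
  bound : ∀ z ∈ V, ‖fderiv ℝ Y z‖ ≤ K
  mem_source : ∀ t ∈ Icc a b, q t ∈ (extChartAt (𝓡 n) x).source
  mem : ∀ t ∈ Icc a b, extChartAt (𝓡 n) x (q t) ∈ V
  continuousOn : ContinuousOn q (Icc a b)
  integrable : IntervalIntegrable u volume a b
  small : ∫ t in a..b, ‖controlAction l 𝔼 (u t)‖ * K < 1

variable {X : Fin l → (p : M) → TangentSpace (𝓡 n) p} {u : ℝ → EuclideanSpace ℝ (Fin l)}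
  {x : M}
  {Y : EuclideanSpace ℝ (Fin n) → Fin l → EuclideanSpace ℝ (Fin n)}
  {V : Set (EuclideanSpace ℝ (Fin n))} {K : ℝ} {q q' : ℝ → M} {a b c : ℝ}

namespace IsAdapted

theorem velocity_eq (h : IsAdapted X u x Y V K q a b) (w : EuclideanSpace ℝ (Fin l)) {z : 𝔼}
    (hz : z ∈ V) : velocity X x w z = controlAction l 𝔼 w (Y z) := by
  rw [h.eq z hz, Goh.velocity_eq]

theorem velocityDeriv_eq (h : IsAdapted X u x Y V K q a b) (w : EuclideanSpace ℝ (Fin l)) {z : 𝔼}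
    (hz : z ∈ V) : velocityDeriv X x w z = controlAction l 𝔼 w ∘L fderiv ℝ Y z := by
  have hi : ∀ i, fderiv ℝ (coordField x (X i)) z = ContinuousLinearMap.proj i ∘L fderiv ℝ Y z := by
    intro i
    have h1 : coordField x (X i) =ᶠ[𝓝 z] fun z => Y z i := by
      filter_upwards [h.isOpen.mem_nhds hz] with w hw
      rw [h.eq w hw]
    rw [h1.fderiv_eq]
    exact ((ContinuousLinearMap.proj (R := ℝ) (φ := fun _ : Fin l => 𝔼) i).hasFDerivAt.comp z
      (h.contDiff.differentiable (by norm_num) z).hasFDerivAt).fderiv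
  ext1 v
  simp [velocityDeriv, hi]

theorem nonneg (h : IsAdapted X u x Y V K q a b) : 0 ≤ K :=
  (norm_nonneg _).trans (h.bound _ (h.mem a (left_mem_Icc.2 h.le)))

theorem mono (h : IsAdapted X u x Y V K q a b) {a' b' : ℝ} (ha : a ≤ a') (hab : a' ≤ b')
    (hb : b' ≤ b) : IsAdapted X u x Y V K q a' b' := by
  have hsub : Icc a' b' ⊆ Icc a b := Icc_subset_Icc ha hb
  refine ⟨hab, h.contDiff, h.isOpen, h.convex, h.subset, h.eq, h.bound,
    fun t ht => h.mem_source t (hsub ht), fun t ht => h.mem t (hsub ht), h.continuousOn.mono hsub,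
    h.integrable.mono_set (by rwa [uIcc_of_le h.le, uIcc_of_le hab]), lt_of_le_of_lt ?_ h.small⟩
  exact intervalIntegral.integral_mono_interval ha hab hb
    (ae_of_all _ fun _ => mul_nonneg (norm_nonneg _) h.nonneg)
    ((h.integrable.clm_comp _).norm.mul_const _)

end IsAdapted

variable [IsManifold (𝓡 n) ∞ M]

/-- Everything is forced by continuity at τ: of the fields and their derivative (whence the ball V
and the bound K), of q, and of the primitive of ‖u‖K. -/
theorem exists_isAdapted (hX : ∀ i, ContMDiff (𝓡 n) (𝓡 n).tangent ∞
      (fun p => (⟨p, X i p⟩ : TangentBundle (𝓡 n) M))) {A B : ℝ}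
    (hu : IntervalIntegrable u volume A B) (hq : ContinuousOn q (Icc A B)) {τ : ℝ}
    (hτ : τ ∈ Icc A B) (x : M) (hx : q τ ∈ (extChartAt (𝓡 n) x).source) :
    ∃ Y V K, extChartAt (𝓡 n) x (q τ) ∈ V ∧ ∃ δ > 0, ∀ a b, A ≤ a → a ≤ b → b ≤ B →
      τ - δ < a → b < τ + δ → IsAdapted X u x Y V K q a b := by
  have hAB : A ≤ B := hτ.1.trans hτ.2
  set z := extChartAt (𝓡 n) x (q τ) with hz
  have hc : ContDiffAt ℝ 2 (fun z i => coordField x (X i) z) z :=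
    contDiffAt_pi.2 fun i => (contDiffAt_coordField (hX i) hx).of_le (WithTop.coe_le_coe.2 le_top)
  obtain ⟨Y, hY, hYe⟩ := exists_contDiff_extension hc
  set K := ‖fderiv ℝ Y z‖ + 1 with hK
  have h1 : ∀ᶠ w in 𝓝 z, ‖fderiv ℝ Y w‖ < K :=
    (hY.continuous_fderiv (by norm_num)).norm.continuousAt.eventually_lt continuousAt_const
      (by simp [hK])
  have h2 : ∀ᶠ w in 𝓝 z, w ∈ (extChartAt (𝓡 n) x).target :=
    (isOpen_extChartAt_target x).mem_nhds ((extChartAt (𝓡 n) x).map_source hx)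
  obtain ⟨r, hr, hball⟩ := Metric.eventually_nhds_iff_ball.1 (hYe.and (h1.and h2))
  refine ⟨Y, Metric.ball z r, K, Metric.mem_ball_self hr, ?_⟩
  have h3 : ∀ᶠ t in 𝓝[Icc A B] τ, q t ∈ (extChartAt (𝓡 n) x).source :=
    (hq τ hτ).eventually ((isOpen_extChartAt_source x).mem_nhds hx)
  have h4 : ∀ᶠ t in 𝓝[Icc A B] τ, extChartAt (𝓡 n) x (q t) ∈ Metric.ball z r :=
    ((continuousAt_extChartAt' hx).comp_continuousWithinAt (hq τ hτ)).eventually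
      (Metric.ball_mem_nhds _ hr)
  have hg := ((hu.clm_comp (controlAction l 𝔼)).norm.mul_const K)
  set g := fun t => ∫ s in A..t, ‖controlAction l 𝔼 (u s)‖ * K with hgdef
  have hgc : ContinuousOn g (Icc A B) := IsPrimitiveOn.continuousOn_integral hAB hg
  -- Radius 1/2 at each end point gives g b - g a < 1, the smallness required.
  have h5 : ∀ᶠ t in 𝓝[Icc A B] τ, g t ∈ Metric.ball (g τ) (1 / 2) :=
    (hgc τ hτ).eventually (Metric.ball_mem_nhds _ (by norm_num))
  have h6 := h3.and (h4.and h5)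
  rw [eventually_nhdsWithin_iff, Metric.eventually_nhds_iff_ball] at h6
  obtain ⟨δ, hδ, h7⟩ := h6
  refine ⟨δ, hδ, fun a b ha hab hb ha' hb' => ?_⟩
  have hmem : ∀ t ∈ Icc a b, t ∈ Metric.ball τ δ := fun t ht => by
    rw [Real.ball_eq_Ioo]; exact ⟨ha'.trans_le ht.1, ht.2.trans_lt hb'⟩
  have hsub : Icc a b ⊆ Icc A B := Icc_subset_Icc ha hb
  have h8 := fun t (ht : t ∈ Icc a b) => h7 t (hmem t ht) (hsub ht)
  refine ⟨hab, hY, Metric.isOpen_ball, convex_ball _ _, fun w hw => (hball w hw).2.2,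
    fun w hw => (hball w hw).1, fun w hw => (hball w hw).2.1.le, fun t ht => (h8 t ht).1,
    fun t ht => (h8 t ht).2.1, hq.mono hsub,
    hu.mono_set (by rwa [uIcc_of_le hAB, uIcc_of_le hab]), ?_⟩
  have e : ∫ t in a..b, ‖controlAction l 𝔼 (u t)‖ * K = g b - g a := by
    rw [hgdef]
    refine (intervalIntegral.integral_interval_sub_left (hg.mono_set ?_) (hg.mono_set ?_)).symm <;>
    rw [uIcc_of_le hAB, uIcc_of_le (by linarith)]
    · exact Icc_subset_Icc_right hb
    · exact Icc_subset_Icc_right (hab.trans hb)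
  rw [e]
  have ea := (h8 a (left_mem_Icc.2 hab)).2.2
  have eb := (h8 b (right_mem_Icc.2 hab)).2.2
  rw [Real.ball_eq_Ioo] at ea eb
  linarith [ea.1, eb.2]

/-- The Lebesgue number lemma makes the length of the intervals uniform. -/
theorem exists_forall_isAdapted (hX : ∀ i, ContMDiff (𝓡 n) (𝓡 n).tangent ∞
      (fun p => (⟨p, X i p⟩ : TangentBundle (𝓡 n) M))) {A B : ℝ}
    (hu : IntervalIntegrable u volume A B) (hq : ContinuousOn q (Icc A B)) :
    ∃ δ > 0, ∀ a b, A ≤ a → a ≤ b → b ≤ B → b - a < δ →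
      ∃ x Y V K, IsAdapted X u x Y V K q a b := by
  choose! Y V K _ δ hδ h using fun τ (hτ : τ ∈ Icc A B) =>
    exists_isAdapted hX hu hq hτ (q τ) (mem_extChartAt_source _)
  obtain ⟨r, hr, hball⟩ := lebesgue_number_lemma_of_metric (isCompact_Icc (a := A) (b := B))
    (c := fun τ : Icc A B => Metric.ball (τ : ℝ) (δ τ)) (fun _ => Metric.isOpen_ball)
    fun τ hτ => mem_iUnion.2 ⟨⟨τ, hτ⟩, Metric.mem_ball_self (hδ τ hτ)⟩
  refine ⟨r, hr, fun a b ha hab hb hr' => ?_⟩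
  obtain ⟨τ, hτ⟩ := hball a ⟨ha, hab.trans hb⟩
  have ea := hτ (Metric.mem_ball_self hr)
  have eb : b ∈ _ := hτ (show b ∈ Metric.ball a r by
    rw [Real.ball_eq_Ioo]; exact ⟨by linarith, by linarith⟩)
  rw [Real.ball_eq_Ioo] at ea eb
  exact ⟨_, _, _, _, h τ τ.2 a b ha hab hb ea.1 eb.2⟩

-- By the mean value inequality on the convex set V, the velocity of the difference of the two
-- coordinate curves is at most ‖u‖K times that difference, so `eq_zero_of_norm_le` applies.
omit [IsManifold (𝓡 n) ∞ M] in
theorem IsAdapted.eqOn (h : IsAdapted X u x Y V K q a b) (hq : TrajOn X u q a b)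
    (hq' : TrajOn X u q' a b) (hs' : ∀ t ∈ Icc a b, q' t ∈ (extChartAt (𝓡 n) x).source)
    (hV' : ∀ t ∈ Icc a b, extChartAt (𝓡 n) x (q' t) ∈ V) (h0 : q a = q' a) :
    EqOn q q' (Icc a b) := by
  have h1 := hq.ode x a b le_rfl h.le le_rfl h.mem_source
  have h2 := hq'.ode x a b le_rfl h.le le_rfl hs'
  have h3 : IsPrimitiveOn (fun t => extChartAt (𝓡 n) x (q t) - extChartAt (𝓡 n) x (q' t))
      (fun t => velocity X x (u t) (extChartAt (𝓡 n) x (q t)) -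
        velocity X x (u t) (extChartAt (𝓡 n) x (q' t))) a b :=
    (h1.prodMk h2).clm_apply (ContinuousLinearMap.fst ℝ 𝔼 𝔼 - ContinuousLinearMap.snd ℝ 𝔼 𝔼)
  have h4 := h3.eq_zero_of_norm_le (κ := fun t => ‖controlAction l 𝔼 (u t)‖ * K)
    ((h.integrable.clm_comp _).norm.mul_const K) (fun t => mul_nonneg (norm_nonneg _) h.nonneg)
    (fun t ht => ?_) h.small (left_mem_Icc.2 h.le) (by simp [h0])
  · exact fun t ht => (extChartAt (𝓡 n) x).injOn (h.mem_source t ht) (hs' t ht)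
      (sub_eq_zero.1 (h4 t ht))
  · rw [h.velocity_eq _ (h.mem t ht), h.velocity_eq _ (hV' t ht), ← map_sub, mul_assoc]
    refine (ContinuousLinearMap.le_opNorm _ _).trans ?_
    gcongr
    exact h.convex.norm_image_sub_le_of_norm_fderiv_le
      (fun z _ => h.contDiff.differentiable (by norm_num) z) h.bound (hV' t ht) (h.mem t ht)

/-- Continuous induction on the coincidence set, closed because M is Hausdorff. From a coincidence
time both curves remain in one adapted domain for a while, where the local uniqueness applies. -/
theorem TrajOn.eqOn [T2Space M] (hX : ∀ i, ContMDiff (𝓡 n) (𝓡 n).tangent ∞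
      (fun p => (⟨p, X i p⟩ : TangentBundle (𝓡 n) M)))
    (hu : IntervalIntegrable u volume a b) (hq : TrajOn X u q a b)
    (hq' : TrajOn X u q' a b) (h0 : q a = q' a) : EqOn q q' (Icc a b) := by
  have hcl : IsClosed ({t | q t = q' t} ∩ Icc a b) := by
    rw [inter_comm]
    exact (hq.continuousOn.prodMk hq'.continuousOn).preimage_isClosed_of_isClosed isClosed_Icc
      isClosed_diagonal
  refine hcl.Icc_subset_of_forall_exists_gt h0 ?_
  rintro t ⟨ht, htab⟩ y hy
  have ht' : t ∈ Icc a b := ⟨htab.1, htab.2.le⟩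
  obtain ⟨Y, V, K, htV, δ, hδ, had⟩ := exists_isAdapted hX hu hq.continuousOn ht' (q t)
    (mem_extChartAt_source _)
  have hsrc : q' t ∈ (extChartAt (𝓡 n) (q t)).source := ht ▸ mem_extChartAt_source (q t)
  have hVo := (had t t htab.1 le_rfl htab.2.le (by linarith) (by linarith)).isOpen
  have h1 : ∀ᶠ s in 𝓝[Icc a b] t, q' s ∈ (extChartAt (𝓡 n) (q t)).source :=
    (hq'.continuousOn t ht').eventually ((isOpen_extChartAt_source _).mem_nhds hsrc)
  have h2 : ∀ᶠ s in 𝓝[Icc a b] t, extChartAt (𝓡 n) (q t) (q' s) ∈ V :=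
    ((continuousAt_extChartAt' hsrc).comp_continuousWithinAt (hq'.continuousOn t ht')).eventually
      (hVo.mem_nhds (by rw [Function.comp_apply, ← (show q t = q' t from ht)]; exact htV))
  have h3 := h1.and h2
  rw [eventually_nhdsWithin_iff, Metric.eventually_nhds_iff_ball] at h3
  obtain ⟨r, hr, h3⟩ := h3
  obtain ⟨c, hc1, hc2⟩ : ∃ c, t < c ∧ c < min (min b y) (min (t + δ) (t + r)) :=
    exists_between (by simp [htab.2, hδ, hr, mem_Ioi.1 hy])
  simp only [lt_min_iff] at hc2
  have h4 : ∀ s ∈ Icc t c, q' s ∈ (extChartAt (𝓡 n) (q t)).source ∧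
      extChartAt (𝓡 n) (q t) (q' s) ∈ V := fun s hs =>
    h3 s (by rw [Real.ball_eq_Ioo]; exact ⟨by linarith [hs.1], by linarith [hs.2]⟩)
      ⟨htab.1.trans hs.1, hs.2.trans hc2.1.1.le⟩
  have h5 := (had t c htab.1 hc1.le hc2.1.1.le (by linarith) hc2.2.1).eqOn
    (hq.mono htab.1 hc1.le hc2.1.1.le) (hq'.mono htab.1 hc1.le hc2.1.1.le)
    (fun s hs => (h4 s hs).1) (fun s hs => (h4 s hs).2) ht
  exact ⟨c, h5 (right_mem_Icc.2 hc1.le), hc1, hc2.1.2.le⟩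

end Adapted

/-! ### Trajectories as solutions of a fixed point equation in coordinates. -/

section Family

variable {n l : ℕ} {M : Type*} [TopologicalSpace M]
  [ChartedSpace (EuclideanSpace ℝ (Fin n)) M]

local notation "𝔼" => EuclideanSpace ℝ (Fin n)

variable {X : Fin l → (p : M) → TangentSpace (𝓡 n) p} {u v : ℝ → EuclideanSpace ℝ (Fin l)}
  {x : M} {Y : EuclideanSpace ℝ (Fin n) → Fin l → EuclideanSpace ℝ (Fin n)}
  {V : Set (EuclideanSpace ℝ (Fin n))} {K : ℝ} {q : ℝ → M} {a b : ℝ}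
  {φ : (t : ℝ) → TangentSpace (𝓡 n) (q t) →L[ℝ] ℝ}

/-- The operator `y ↦ ∫ₐᵗ ∑ uᵢ(τ) yᵢ(τ) dτ`. -/
def controlOp (n : ℕ) (hab : a ≤ b) (hu : IntervalIntegrable u volume a b) :
    C(Icc a b, Fin l → EuclideanSpace ℝ (Fin n)) →L[ℝ] C(Icc a b, EuclideanSpace ℝ (Fin n)) :=
  integralOp hab (fun t => controlAction l (EuclideanSpace ℝ (Fin n)) (u t)) (hu.clm_comp _)

theorem isPrimitiveOn_controlOp (hab : a ≤ b) (hu : IntervalIntegrable u volume a b)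
    (y : C(Icc a b, Fin l → 𝔼)) :
    IsPrimitiveOn (IccExtend hab (controlOp n hab hu y))
      (fun t => controlAction l 𝔼 (u t) (IccExtend hab y t)) a b :=
  isPrimitiveOn_integralOp hab _ _ y

theorem controlOp_left (hab : a ≤ b) (hu : IntervalIntegrable u volume a b)
    (y : C(Icc a b, Fin l → 𝔼)) : controlOp n hab hu y ⟨a, left_mem_Icc.2 hab⟩ = 0 := by
  rw [controlOp, integralOp_apply]
  simp

namespace IsAdapted

variable (h : IsAdapted X u x Y V K q a b)

/-- The curve `q` in coordinates. -/
def path (h : IsAdapted X u x Y V K q a b) : C(Icc a b, EuclideanSpace ℝ (Fin n)) where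
  toFun t := extChartAt (𝓡 n) x (q t)
  continuous_toFun := ContinuousOn.comp_continuous
    (g := fun t => extChartAt (𝓡 n) x (q t)) (continuousOn_coord h.continuousOn h.mem_source)
    continuous_subtype_val fun t => t.2

include h

theorem path_apply (t : Icc a b) : h.path t = extChartAt (𝓡 n) x (q t) := rfl

theorem path_eq (hq : TrajOn X u q a b) :
    h.path = ContinuousMap.const _ (extChartAt (𝓡 n) x (q a)) +
      controlOp n h.le h.integrable (superpose ⟨Y, h.contDiff.continuous⟩ h.path) := by
  ext1 t
  have h1 := (hq.ode x a b le_rfl h.le le_rfl h.mem_source).eq t t.2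
  rw [path_apply, h1]
  simp only [ContinuousMap.add_apply, ContinuousMap.const_apply, controlOp, integralOp_apply]
  congr 1
  refine intervalIntegral.integral_congr fun s hs => ?_
  rw [uIcc_of_le t.2.1] at hs
  have hs' : s ∈ Icc a b := ⟨hs.1, hs.2.trans t.2.2⟩
  simp only [IccExtend_of_mem _ _ hs']
  rw [h.velocity_eq _ (h.mem s hs')]
  rfl

/-- This is what the smallness condition in `IsAdapted` is for: it supplies the contraction
hypothesis of the implicit function theorem and of the linearised equation. -/
theorem norm_comp_superposeDeriv_lt :
    ‖controlOp n h.le h.integrable ∘L superposeDeriv Y h.contDiff h.path‖ < 1 := by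
  have h1 : ‖superposeDeriv Y h.contDiff h.path‖ ≤ K := by
    refine ContinuousLinearMap.opNorm_le_bound _ h.nonneg fun ξ => ?_
    refine (ContinuousMap.norm_le _ (mul_nonneg h.nonneg (norm_nonneg _))).2 fun t => ?_
    refine ((fderiv ℝ Y (h.path t)).le_opNorm _).trans ?_
    gcongr
    · exact h.nonneg
    · exact h.bound _ (h.mem t t.2)
    · exact ξ.norm_coe_le_norm t
  refine lt_of_le_of_lt ((ContinuousLinearMap.opNorm_comp_le _ _).trans ?_) h.small
  rw [intervalIntegral.integral_mul_const]
  exact mul_le_mul (norm_integralOp_le _ _ _) h1 (norm_nonneg _)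
    (intervalIntegral.integral_nonneg h.le fun _ _ => norm_nonneg _)

/-- A coordinate curve solving the integral equation is a trajectory. -/
theorem trajOn_of_eq [IsManifold (𝓡 n) ∞ M] (hv : IntervalIntegrable v volume a b) {s : ℝ} {z : 𝔼}
    {y : C(Icc a b, 𝔼)} (hy : ∀ t, y t ∈ V)
    (he : y = ContinuousMap.const _ z +
      controlOp n h.le h.integrable (superpose ⟨Y, h.contDiff.continuous⟩ y) +
      s • controlOp n h.le hv (superpose ⟨Y, h.contDiff.continuous⟩ y)) :
    TrajOn X (fun t => u t + s • v t)
      (fun t => (extChartAt (𝓡 n) x).symm (IccExtend h.le y t)) a b := by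
  have hyV : ∀ t, IccExtend h.le y t ∈ V := fun t => hy _
  have hr : ∀ t, extChartAt (𝓡 n) x ((extChartAt (𝓡 n) x).symm (IccExtend h.le y t)) =
      IccExtend h.le y t := fun t => (extChartAt (𝓡 n) x).right_inv (h.subset (hyV t))
  refine TrajOn.of_chart (x := x) ?_
    (fun t _ => (extChartAt (𝓡 n) x).map_target (h.subset (hyV t))) ?_
  · exact (continuousOn_extChartAt_symm x).comp y.continuous.Icc_extend'.continuousOn
      fun t _ => h.subset (hyV t)
  · simp only [hr]
    have h1 := ((IsPrimitiveOn.const h.le z).add (isPrimitiveOn_controlOp h.le h.integrable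
      (superpose ⟨Y, h.contDiff.continuous⟩ y))).add
      ((isPrimitiveOn_controlOp h.le hv (superpose ⟨Y, h.contDiff.continuous⟩ y)).clm_apply
        (s • ContinuousLinearMap.id ℝ 𝔼))
    refine (h1.congr_right (ae_of_all _ fun t => ?_)).congr_left fun t ht => ?_
    · rw [h.velocity_eq _ (hyV t), map_add, map_smul]
      simp only [zero_add]
      rfl
    · conv_lhs => rw [he]
      rfl

/-- With s frozen at 0 this is the local flow; with the initial point frozen it is the variation of
the control. Maps into the open set V form an open set of curves, so nearby solutions stay where Y
agrees with the fields and are genuine trajectories. -/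
theorem exists_family [IsManifold (𝓡 n) ∞ M] (hq : TrajOn X u q a b)
    (hv : IntervalIntegrable v volume a b) :
    ∃ S : 𝔼 × ℝ → C(Icc a b, 𝔼), ContDiffAt ℝ 2 S (extChartAt (𝓡 n) x (q a), 0) ∧
      S (extChartAt (𝓡 n) x (q a), 0) = h.path ∧
      ∀ᶠ p in 𝓝 (extChartAt (𝓡 n) x (q a), (0 : ℝ)),
        S p = ContinuousMap.const _ p.1 +
          controlOp n h.le h.integrable (superpose ⟨Y, h.contDiff.continuous⟩ (S p)) +
          p.2 • controlOp n h.le hv (superpose ⟨Y, h.contDiff.continuous⟩ (S p)) ∧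
        (∀ t, S p t ∈ V) ∧
        TrajOn X (fun t => u t + p.2 • v t)
          (fun t => (extChartAt (𝓡 n) x).symm (IccExtend h.le (S p) t)) a b := by
  obtain ⟨S, hS, hS0, hS1⟩ := exists_contDiffAt_solution Y h.contDiff
    (controlOp n h.le h.integrable) (controlOp n h.le hv) h.path _ (h.path_eq hq)
    h.norm_comp_superposeDeriv_lt
  refine ⟨S, hS, hS0, ?_⟩
  have h1 : ∀ᶠ p in 𝓝 (extChartAt (𝓡 n) x (q a), (0 : ℝ)), ∀ t, S p t ∈ V := by
    have ho : IsOpen {y : C(Icc a b, 𝔼) | MapsTo y univ V} :=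
      ContinuousMap.isOpen_setOfPred_mapsTo isCompact_univ h.isOpen
    have := hS.continuousAt.eventually_mem (ho.mem_nhds (by
      rw [hS0]; exact fun t _ => h.mem t t.2))
    exact this.mono fun p hp t => hp (mem_univ t)
  filter_upwards [hS1, h1] with p hp1 hp2
  exact ⟨hp1, hp2, h.trajOn_of_eq hv hp2 hp1⟩

/-- The pairing of a Pontryagin covector with a solution of the inhomogeneous linearised
equation. -/
theorem pairing (hφ : PontrOn X u q φ a b) (hv : IntervalIntegrable v volume a b) {w : 𝔼}
    {ξ : C(Icc a b, 𝔼)} {y y' : C(Icc a b, Fin l → 𝔼)}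
    (hξ : ξ = ContinuousMap.const _ w +
      controlOp n h.le h.integrable (superposeDeriv Y h.contDiff h.path ξ + y) +
      controlOp n h.le hv y') :
    coordCovector x (φ b) (IccExtend h.le ξ b) = coordCovector x (φ a) w +
      ∫ t in a..b, coordCovector x (φ t) (controlAction l 𝔼 (u t) (IccExtend h.le y t) +
        controlAction l 𝔼 (v t) (IccExtend h.le y' t)) := by
  have h1 := ((IsPrimitiveOn.const h.le w).add (isPrimitiveOn_controlOp h.le h.integrable
      (superposeDeriv Y h.contDiff h.path ξ + y))).add (isPrimitiveOn_controlOp h.le hv y')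
  have h2 := h1.congr_left (x' := IccExtend h.le ξ) fun t ht => by
    conv_lhs => rw [hξ]
    rfl
  -- In the derivative of ⟨φ, ξ⟩ the DY term of the linearised equation cancels against the
  -- Pontryagin equation; only the inhomogeneity is left.
  have h3 := (hφ.ode x a b le_rfl h.le le_rfl h.mem_source).bilinear h2
    (ContinuousLinearMap.id ℝ (𝔼 →L[ℝ] ℝ))
  have h4 := h3.congr_right (g' := fun t => coordCovector x (φ t)
    (controlAction l 𝔼 (u t) (IccExtend h.le y t) +
        controlAction l 𝔼 (v t) (IccExtend h.le y' t))) (by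
    filter_upwards [ae_restrict_mem measurableSet_Icc] with t ht
    have e1 : IccExtend h.le (superposeDeriv Y h.contDiff h.path ξ + y) t =
        fderiv ℝ Y (extChartAt (𝓡 n) x (q t)) (IccExtend h.le ξ t) + IccExtend h.le y t := by
      simp only [IccExtend_of_mem _ _ ht]
      rfl
    rw [h.velocityDeriv_eq _ (h.mem t ht), e1]
    simp only [ContinuousLinearMap.coe_id', id_eq, neg_apply, ContinuousLinearMap.comp_apply,
      map_add, zero_add]
    abel)
  have h5 := h4.eq b (right_mem_Icc.2 h.le)
  have e2 : IccExtend h.le ξ a = w := by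
    rw [IccExtend_of_mem _ _ (left_mem_Icc.2 h.le), hξ]
    simp [controlOp_left]
  rw [e2] at h5
  exact h5

end IsAdapted
end Family

/-! ### Linear equations with integrable coefficients on short intervals. -/

theorem exists_eq_affine {G : Type*} [NormedAddCommGroup G] [NormedSpace ℝ G] [CompleteSpace G]
    {J : G →L[ℝ] G} (hJ : ‖J‖ < 1) (c : G) : ∃ g : G, g = J g + c := by
  let e := Units.oneSub J hJ
  refine ⟨(e⁻¹ : Units _).1 c, ?_⟩
  have h1 : (e.1 * (e⁻¹ : Units _).1) c = c := by rw [Units.mul_inv]; rfl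
  have h2 : e.1 = 1 - J := rfl
  have h3 : (1 - J) ((e⁻¹ : Units _).1 c) = c := h2 ▸ h1
  rw [sub_apply] at h3
  rw [add_comm]
  exact sub_eq_iff_eq_add.1 h3

/-- Solvability of linear equations on short intervals. -/
theorem exists_isPrimitiveOn_linear {G : Type*} [NormedAddCommGroup G] [NormedSpace ℝ G]
    [CompleteSpace G] {a b : ℝ} (hab : a ≤ b) {w : ℝ → G →L[ℝ] G}
    (hw : IntervalIntegrable w volume a b) (hw1 : ∫ t in a..b, ‖w t‖ < 1) (z : G) :
    ∃ g : ℝ → G, IsPrimitiveOn g (fun t => w t (g t)) a b ∧ g a = z := by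
  have hJ : ‖integralOp hab w hw‖ < 1 := (norm_integralOp_le _ _ _).trans_lt hw1
  obtain ⟨g, hg⟩ := exists_eq_affine hJ (ContinuousMap.const _ z)
  rw [add_comm] at hg
  refine ⟨IccExtend hab g, (((IsPrimitiveOn.const hab z).add
      (isPrimitiveOn_integralOp hab w hw g)).congr_right
      (ae_of_all _ fun t => zero_add _)).congr_left fun t ht => ?_, ?_⟩
  · conv_lhs => rw [hg]
    rfl
  · rw [IccExtend_of_mem _ _ (left_mem_Icc.2 hab), hg]
    simp [integralOp_apply]

/-- The bound on Λ has constant 1 so that ∫‖A‖ < 1 passes unchanged to the operators Λ (A t). -/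
theorem exists_isPrimitiveOn_bilinear {G H : Type*} [NormedAddCommGroup G] [NormedSpace ℝ G]
    [CompleteSpace G] [NormedAddCommGroup H] [NormedSpace ℝ H] {a b : ℝ} (hab : a ≤ b)
    {A : ℝ → H} (hA : IntervalIntegrable A volume a b) (hA1 : ∫ t in a..b, ‖A t‖ < 1)
    (Λ : H →L[ℝ] G →L[ℝ] G) (hΛ : ∀ B C, ‖Λ B C‖ ≤ ‖B‖ * ‖C‖) (z : G) :
    ∃ g : ℝ → G, IsPrimitiveOn g (fun t => Λ (A t) (g t)) a b ∧ g a = z :=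
  exists_isPrimitiveOn_linear hab (hA.clm_comp Λ)
    ((intervalIntegral.integral_mono_on hab (hA.clm_comp Λ).norm hA.norm fun _ _ =>
      ContinuousLinearMap.opNorm_le_bound _ (norm_nonneg _) fun _ => hΛ _ _).trans_lt hA1) z

theorem exists_isPrimitiveOn_dual {E : Type*} [NormedAddCommGroup E] [NormedSpace ℝ E]
    {a b : ℝ} (hab : a ≤ b) {A : ℝ → E →L[ℝ] E} (hA : IntervalIntegrable A volume a b)
    (hA1 : ∫ t in a..b, ‖A t‖ < 1) (μ : E →L[ℝ] ℝ) :
    ∃ g : ℝ → E →L[ℝ] ℝ, IsPrimitiveOn g (fun t => -(g t ∘L A t)) a b ∧ g a = μ :=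
  exists_isPrimitiveOn_bilinear hab hA hA1 (-(ContinuousLinearMap.compL ℝ E E ℝ).flip)
    (fun B C => by
      rw [mul_comm, neg_apply, neg_apply, norm_neg]
      exact ContinuousLinearMap.opNorm_comp_le C B) μ

/-! ### Pontryagin covectors: linearity, uniqueness, existence. -/

section Pontryagin

variable {n l : ℕ} {M : Type*} [TopologicalSpace M]
  [ChartedSpace (EuclideanSpace ℝ (Fin n)) M]

local notation "𝔼" => EuclideanSpace ℝ (Fin n)

variable {X : Fin l → (p : M) → TangentSpace (𝓡 n) p} {u v : ℝ → EuclideanSpace ℝ (Fin l)}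
  {x : M} {Y : EuclideanSpace ℝ (Fin n) → Fin l → EuclideanSpace ℝ (Fin n)}
  {V : Set (EuclideanSpace ℝ (Fin n))} {K : ℝ} {q : ℝ → M} {a b : ℝ}
  {φ ψ : (t : ℝ) → TangentSpace (𝓡 n) (q t) →L[ℝ] ℝ}

namespace PontrOn

theorem zero (hab : a ≤ b) : PontrOn X u q (fun _ => 0) a b :=
  ⟨hab, fun x a' b' _ h _ _ => by
    have e : ∀ t, coordCovector x (0 : TangentSpace (𝓡 n) (q t) →L[ℝ] ℝ) = 0 := fun t => rfl
    simp only [e, ContinuousLinearMap.zero_comp, neg_zero]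
    exact IsPrimitiveOn.const h 0⟩

theorem add (h : PontrOn X u q φ a b) (h' : PontrOn X u q ψ a b) :
    PontrOn X u q (fun t => φ t + ψ t) a b :=
  ⟨h.le, fun x a' b' h1 h2 h3 h4 => by
    have e : ∀ t, coordCovector x (φ t + ψ t) = coordCovector x (φ t) + coordCovector x (ψ t) :=
      fun t => rfl
    simp only [e, ContinuousLinearMap.add_comp, neg_add]
    exact (h.ode x a' b' h1 h2 h3 h4).add (h'.ode x a' b' h1 h2 h3 h4)⟩

theorem smul (h : PontrOn X u q φ a b) (c : ℝ) : PontrOn X u q (fun t => c • φ t) a b :=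
  ⟨h.le, fun x a' b' h1 h2 h3 h4 => by
    have e : ∀ t, coordCovector x (c • φ t) = c • coordCovector x (φ t) := fun t => rfl
    simp only [e, ContinuousLinearMap.smul_comp]
    exact ((h.ode x a' b' h1 h2 h3 h4).clm_apply
      (c • ContinuousLinearMap.id ℝ (𝔼 →L[ℝ] ℝ))).congr_right (ae_of_all _ fun t => by simp)⟩

theorem sum {ι : Type*} (s : Finset ι) (hab : a ≤ b)
    {Φ : ι → (t : ℝ) → TangentSpace (𝓡 n) (q t) →L[ℝ] ℝ} (c : ι → ℝ)
    (h : ∀ i ∈ s, PontrOn X u q (Φ i) a b) :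
    PontrOn X u q (fun t => ∑ i ∈ s, c i • Φ i t) a b := by
  classical
  induction s using Finset.induction_on with
  | empty => simpa using zero hab
  | insert i s hi ih =>
    simp only [Finset.sum_insert hi]
    exact ((h i (Finset.mem_insert_self i s)).smul (c i)).add
      (ih fun j hj => h j (Finset.mem_insert_of_mem hj))

end PontrOn

variable [IsManifold (𝓡 n) ∞ M]

theorem coordCovector_eq_zero_iff {p : M} {φ : TangentSpace (𝓡 n) p →L[ℝ] ℝ}
    (hp : p ∈ (extChartAt (𝓡 n) x).source) : coordCovector x φ = 0 ↔ φ = 0 := by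
  refine ⟨fun h => ?_, fun h => by rw [h]; rfl⟩
  rw [← coordCovector_comp_chartDeriv φ hp, h]
  rfl

namespace IsAdapted

omit [IsManifold (𝓡 n) ∞ M] in
theorem norm_velocityDeriv_le (h : IsAdapted X u x Y V K q a b) (w : EuclideanSpace ℝ (Fin l))
    {z : 𝔼} (hz : z ∈ V) : ‖velocityDeriv X x w z‖ ≤ ‖controlAction l 𝔼 w‖ * K := by
  rw [h.velocityDeriv_eq _ hz]
  refine (ContinuousLinearMap.opNorm_comp_le _ _).trans ?_
  gcongr
  exact h.bound z hz

theorem pontrOn_eq_zero (h : IsAdapted X u x Y V K q a b) (hφ : PontrOn X u q φ a b) {s : ℝ}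
    (hs : s ∈ Icc a b) (h0 : φ s = 0) : ∀ t ∈ Icc a b, φ t = 0 := by
  have h1 := (hφ.ode x a b le_rfl h.le le_rfl h.mem_source).eq_zero_of_norm_le
    (κ := fun t => ‖controlAction l 𝔼 (u t)‖ * K)
    ((h.integrable.clm_comp _).norm.mul_const K) (fun t => mul_nonneg (norm_nonneg _) h.nonneg)
    (fun t ht => ?_) h.small hs ((coordCovector_eq_zero_iff (h.mem_source s hs)).2 h0)
  · exact fun t ht => (coordCovector_eq_zero_iff (h.mem_source t ht)).1 (h1 t ht)
  · rw [norm_neg, mul_comm (_ * K)]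
    refine (ContinuousLinearMap.opNorm_comp_le _ _).trans ?_
    gcongr
    exact h.norm_velocityDeriv_le _ (h.mem t ht)

/-- The dual linear equation is solved in coordinates and its solution is pulled back by the
differential of the chart; values outside [a,b] play no role. -/
theorem exists_pontrOn (h : IsAdapted X u x Y V K q a b)
    (hX : ∀ i, ContMDiff (𝓡 n) (𝓡 n).tangent ∞
      (fun p => (⟨p, X i p⟩ : TangentBundle (𝓡 n) M))) (hq : TrajOn X u q a b)
    (μ : TangentSpace (𝓡 n) (q a) →L[ℝ] ℝ) :
    ∃ φ : (t : ℝ) → TangentSpace (𝓡 n) (q t) →L[ℝ] ℝ, PontrOn X u q φ a b ∧ φ a = μ := by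
  have hint := intervalIntegrable_velocityDeriv hX h.le h.integrable h.continuousOn h.mem_source
  have hlt : ∫ t in a..b, ‖velocityDeriv X x (u t) (extChartAt (𝓡 n) x (q t))‖ < 1 :=
    (intervalIntegral.integral_mono_on h.le hint.norm
      ((h.integrable.clm_comp _).norm.mul_const K)
      fun t ht => h.norm_velocityDeriv_le _ (h.mem t ht)).trans_lt h.small
  obtain ⟨g, hgp, e1⟩ := exists_isPrimitiveOn_dual h.le hint hlt (coordCovector x μ)
  let φ : (t : ℝ) → TangentSpace (𝓡 n) (q t) →L[ℝ] ℝ := fun t =>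
    (g t ∘L chartDeriv x (q t) : 𝔼 →L[ℝ] ℝ)
  have hφ : ∀ t ∈ Icc a b, coordCovector x (φ t) = g t := fun t ht =>
    ContinuousLinearMap.ext fun z => congrArg (g t)
      (chartDeriv_symmDeriv (h.mem_source t ht) z)
  refine ⟨φ, PontrOn.of_chart hX hq h.mem_source ((hgp.congr_right ?_).congr_left hφ), ?_⟩
  · filter_upwards [ae_restrict_mem measurableSet_Icc] with t ht
    rw [hφ t ht]
  · have ha := left_mem_Icc.2 h.le
    have e2 := coordCovector_comp_chartDeriv (φ a) (h.mem_source a ha)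
    rw [hφ a ha, e1, coordCovector_comp_chartDeriv _ (h.mem_source a ha)] at e2
    exact e2.symm

end IsAdapted

variable (hX : ∀ i, ContMDiff (𝓡 n) (𝓡 n).tangent ∞
      (fun p => (⟨p, X i p⟩ : TangentBundle (𝓡 n) M)))
include hX

/-- On short intervals a zero at any time spreads to the whole interval, in both directions, and an
equivalence is transitive. -/
theorem PontrOn.eq_zero_iff (hu : IntervalIntegrable u volume a b) (hq : TrajOn X u q a b)
    (hφ : PontrOn X u q φ a b) {s t : ℝ} (hs : a ≤ s) (hst : s ≤ t) (ht : t ≤ b) :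
    φ s = 0 ↔ φ t = 0 := by
  obtain ⟨δ, hδ, had⟩ := exists_forall_isAdapted hX hu hq.continuousOn
  refine rel_of_short (R := fun s t => φ s = 0 ↔ φ t = 0) hδ (fun a' b' h1 h2 h3 h4 => ?_)
    (fun a b c _ _ _ _ h h' => h.trans h') s t hs hst ht
  obtain ⟨x, Y, V, K, h⟩ := had a' b' h1 h2 h3 h4
  have hp := hφ.mono h1 h2 h3
  exact ⟨fun h0 => h.pontrOn_eq_zero hp (left_mem_Icc.2 h2) h0 _ (right_mem_Icc.2 h2),
    fun h0 => h.pontrOn_eq_zero hp (right_mem_Icc.2 h2) h0 _ (left_mem_Icc.2 h2)⟩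

/-- The local statement, quantified over all initial covectors, is a transitive relation between
times: a second solution is started at the end value of the first. -/
theorem exists_pontrOn (hu : IntervalIntegrable u volume a b) (hq : TrajOn X u q a b)
    (μ : TangentSpace (𝓡 n) (q a) →L[ℝ] ℝ) :
    ∃ φ : (t : ℝ) → TangentSpace (𝓡 n) (q t) →L[ℝ] ℝ, PontrOn X u q φ a b ∧ φ a = μ := by
  obtain ⟨δ, hδ, had⟩ := exists_forall_isAdapted hX hu hq.continuousOn
  refine rel_of_short (R := fun a b => ∀ μ : TangentSpace (𝓡 n) (q a) →L[ℝ] ℝ,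
    ∃ φ : (t : ℝ) → TangentSpace (𝓡 n) (q t) →L[ℝ] ℝ, PontrOn X u q φ a b ∧ φ a = μ) hδ
    (fun a' b' h1 h2 h3 h4 => ?_) (fun a b c _ hab hbc _ h h' μ => ?_) a b le_rfl hq.le le_rfl μ
  · obtain ⟨x, Y, V, K, h⟩ := had a' b' h1 h2 h3 h4
    exact h.exists_pontrOn hX (hq.mono h1 h2 h3)
  · obtain ⟨φ, hφ, hφa⟩ := h μ
    obtain ⟨ψ, hψ, hψb⟩ := h' (φ b)
    classical
    refine ⟨fun t => if t ≤ b then φ t else ψ t,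
      (hφ.congr fun t ht => if_pos ht.2).concat (hψ.congr fun t ht => ?_), by simp [hab, hφa]⟩
    rcases ht.1.eq_or_lt with rfl | hlt
    · simp [hψb]
    · rw [if_neg (not_le.2 hlt)]

end Pontryagin

/-! ### Flows and the transport of covectors. -/

section Transport

variable {n l : ℕ} {M : Type*} [TopologicalSpace M]
  [ChartedSpace (EuclideanSpace ℝ (Fin n)) M]

local notation "𝔼" => EuclideanSpace ℝ (Fin n)

variable {X : Fin l → (p : M) → TangentSpace (𝓡 n) p} {u v : ℝ → EuclideanSpace ℝ (Fin l)}
  {x : M} {Y : EuclideanSpace ℝ (Fin n) → Fin l → EuclideanSpace ℝ (Fin n)}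
  {V : Set (EuclideanSpace ℝ (Fin n))} {K : ℝ} {q : ℝ → M} {a b : ℝ}

/-- The differential of a map of `M` into itself, with all tangent spaces identified with `ℝⁿ`. -/
def mapDeriv (F : M → M) (p : M) : 𝔼 →L[ℝ] 𝔼 := mfderiv (𝓡 n) (𝓡 n) F p

/-- The flow of the control `u` from time `a` to time `b` is defined and twice continuously
differentiable near `q a`, and transports Pontryagin covectors along `q`. -/
def HasFlow (X : Fin l → (p : M) → TangentSpace (𝓡 n) p) (u : ℝ → EuclideanSpace ℝ (Fin l))
    (q : ℝ → M) (a b : ℝ) : Prop :=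
  ∃ F : M → M, ContMDiffAt (𝓡 n) (𝓡 n) 2 F (q a) ∧ F (q a) = q b ∧
    (∀ᶠ p in 𝓝 (q a), ∃ γ : ℝ → M, TrajOn X u γ a b ∧ γ a = p ∧ γ b = F p) ∧
    ∀ φ : (t : ℝ) → TangentSpace (𝓡 n) (q t) →L[ℝ] ℝ, PontrOn X u q φ a b →
      ∀ w : 𝔼, (φ b : 𝔼 →L[ℝ] ℝ) (mapDeriv F (q a) w) = (φ a : 𝔼 →L[ℝ] ℝ) w

theorem TrajOn.concat_of_eq {γ₁ γ₂ : ℝ → M} {c : ℝ} (h₁ : TrajOn X u γ₁ a b)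
    (h₂ : TrajOn X u γ₂ b c) (h : γ₁ b = γ₂ b) :
    TrajOn X u (fun t => if t ≤ b then γ₁ t else γ₂ t) a c := by
  refine (h₁.congr (ae_of_all _ fun _ => rfl) fun t ht => if_pos ht.2).concat
    (h₂.congr (ae_of_all _ fun _ => rfl) fun t ht => ?_)
  rcases ht.1.eq_or_lt with rfl | hlt
  · simp [h]
  · simp [not_le.2 hlt]

/-- Flows compose, trajectories concatenate, and by the chain rule the transport of covectors
composes as well. The flow is described only near the curve, so a plain map M → M suffices. -/
theorem HasFlow.trans {c : ℝ} (hab : a ≤ b) (hbc : b ≤ c) (h : HasFlow X u q a b)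
    (h' : HasFlow X u q b c) : HasFlow X u q a c := by
  obtain ⟨F, hF, hFq, hFt, hFφ⟩ := h
  obtain ⟨G, hG, hGq, hGt, hGφ⟩ := h'
  have hG' : ContMDiffAt (𝓡 n) (𝓡 n) 2 G (F (q a)) := by rwa [hFq]
  refine ⟨G ∘ F, hG'.comp _ hF, by simp [hFq, hGq], ?_, fun φ hφ w => ?_⟩
  · have : ∀ᶠ p in 𝓝 (q a), ∃ γ : ℝ → M, TrajOn X u γ b c ∧ γ b = F p ∧ γ c = G (F p) :=
      hF.continuousAt.eventually (by rwa [hFq])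
    filter_upwards [hFt, this] with p ⟨γ₁, h1, h1a, h1b⟩ ⟨γ₂, h2, h2b, h2c⟩
    refine ⟨_, h1.concat_of_eq h2 (h1b.trans h2b.symm), by simp [hab, h1a], ?_⟩
    rcases hbc.eq_or_lt with rfl | hlt
    · simp [h1b, ← h2c, h2b]
    · simp [not_le.2 hlt, h2c]
  · have e : mapDeriv (G ∘ F) (q a) = mapDeriv G (F (q a)) ∘L mapDeriv F (q a) :=
      mfderiv_comp (I' := 𝓡 n) (q a) (hG'.mdifferentiableAt (by norm_num))
        (hF.mdifferentiableAt (by norm_num))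
    rw [e, ContinuousLinearMap.comp_apply, hFq]
    rw [hGφ φ (hφ.mono hab hbc le_rfl), hFφ φ (hφ.mono le_rfl hab hbc)]

variable [IsManifold (𝓡 n) ∞ M]

theorem IsAdapted.hasFlow (h : IsAdapted X u x Y V K q a b) (hq : TrajOn X u q a b) :
    HasFlow X u q a b := by
  have ha := left_mem_Icc.2 h.le
  have hb := right_mem_Icc.2 h.le
  obtain ⟨S, hS, hS0, hSe⟩ := h.exists_family hq (v := 0) IntervalIntegrable.zero
  set z := extChartAt (𝓡 n) x (q a) with hz
  let f : 𝔼 → 𝔼 := fun w => S (w, 0) ⟨b, hb⟩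
  let ev : C(Icc a b, 𝔼) →L[ℝ] 𝔼 := ContinuousMap.evalCLM ℝ ⟨b, hb⟩
  have hSz : ContDiffAt ℝ 2 (fun w : 𝔼 => S (w, 0)) z :=
    hS.comp z (contDiffAt_id.prodMk contDiffAt_const)
  have hf : ContDiffAt ℝ 2 f z := ev.contDiff.contDiffAt.comp z hSz
  have hfz : f z = extChartAt (𝓡 n) x (q b) := by simp only [f, hS0]; rfl
  have hfz' : extChartAt (𝓡 n) x (q b) ∈ (extChartAt (𝓡 n) x).target :=
    (extChartAt (𝓡 n) x).map_source (h.mem_source b hb)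
  have hle : (2 : WithTop ℕ∞) ≤ ∞ := WithTop.coe_le_coe.2 le_top
  have hκ : ContMDiffAt (𝓡 n) 𝓘(ℝ, 𝔼) 2 (extChartAt (𝓡 n) x) (q a) :=
    (contMDiffAt_extChartAt_of_mem (h.mem_source a ha)).of_le hle
  have hσ : ContMDiffAt 𝓘(ℝ, 𝔼) (𝓡 n) 2 (extChartAt (𝓡 n) x).symm (f z) := by
    rw [hfz]
    exact (contMDiffAt_extChartAt_symm_of_mem hfz').of_le hle
  have hfκ : ContMDiffAt (𝓡 n) 𝓘(ℝ, 𝔼) 2 (f ∘ extChartAt (𝓡 n) x) (q a) :=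
    (contMDiffAt_iff_contDiffAt.2 hf).comp _ hκ
  have hF : ContMDiffAt (𝓡 n) (𝓡 n) 2
      ((extChartAt (𝓡 n) x).symm ∘ (f ∘ extChartAt (𝓡 n) x)) (q a) := hσ.comp (q a) hfκ
  refine ⟨_, hF, ?_, ?_, fun φ hφ w => ?_⟩
  · simp only [Function.comp_apply, ← hz, hfz]
    exact (extChartAt (𝓡 n) x).left_inv (h.mem_source b hb)
  · have h1 : Tendsto (fun p => (extChartAt (𝓡 n) x p, (0 : ℝ))) (𝓝 (q a)) (𝓝 (z, 0)) :=
      hκ.continuousAt.prodMk_nhds tendsto_const_nhds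
    filter_upwards [h1.eventually hSe,
      (isOpen_extChartAt_source (I := 𝓡 n) x).mem_nhds (h.mem_source a ha)] with p hp hps
    refine ⟨_, hp.2.2.congr (ae_of_all _ fun t => by simp) fun t _ => rfl, ?_, ?_⟩
    · simp only [IccExtend_of_mem _ _ ha]
      rw [hp.1]
      simp only [ContinuousMap.add_apply, ContinuousMap.smul_apply, controlOp_left,
        ContinuousMap.const_apply, smul_zero, add_zero]
      exact (extChartAt (𝓡 n) x).left_inv hps
    · simp only [IccExtend_of_mem _ _ hb]
      rfl
  · have e1 : mapDeriv ((extChartAt (𝓡 n) x).symm ∘ (f ∘ extChartAt (𝓡 n) x)) (q a) =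
        symmDeriv x (f z) ∘L (fderiv ℝ f z ∘L chartDeriv x (q a)) := by
      have h1 := mfderiv_comp (I' := 𝓘(ℝ, 𝔼)) (q a) (hσ.mdifferentiableAt (by norm_num))
        (hfκ.mdifferentiableAt (by norm_num))
      have h2 := mfderiv_comp (I' := 𝓘(ℝ, 𝔼)) (q a) (g := f) (f := extChartAt (𝓡 n) x)
        ((contMDiffAt_iff_contDiffAt.2 hf).mdifferentiableAt (by norm_num))
        (hκ.mdifferentiableAt (by norm_num))
      rw [h2, mfderiv_eq_fderiv] at h1
      exact h1
    rw [e1, hfz]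
    set w' := chartDeriv x (q a) w with hw'
    -- Moving the initial point along a line yields a solution of the homogeneous linearised
    -- equation starting at w', whose pairing with φ is constant in time.
    let γ : ℝ → C(Icc a b, 𝔼) := fun s => S (z + s • w', 0)
    have hγ0 : γ 0 = h.path := by simp [γ, hS0]
    have hline : ContDiffAt ℝ 2 (fun s : ℝ => z + s • w') 0 := by fun_prop
    have hγ : ContDiffAt ℝ 2 γ 0 := by
      refine ContDiffAt.comp (g := fun w : 𝔼 => S (w, 0)) 0 ?_ hline
      simpa using hSz
    have hγe := deriv_of_integral_equation Y h.contDiff (controlOp n h.le h.integrable)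
      (0 : C(Icc a b, Fin l → 𝔼) →L[ℝ] C(Icc a b, 𝔼))
      (ContinuousMap.const _ z) (ContinuousMap.const _ w') hγ (by
        have h1 : Tendsto (fun s : ℝ => (z + s • w', (0 : ℝ))) (𝓝 0) (𝓝 (z, 0)) := by
          have : ContinuousAt (fun s : ℝ => (z + s • w', (0 : ℝ))) 0 := by fun_prop
          simpa [ContinuousAt] using this
        filter_upwards [h1.eventually hSe] with s hs
        refine hs.1.trans ?_
        simp only [γ]
        ext1 t
        simp)
    have hd := hγe.1
    rw [hγ0, zero_apply, add_zero] at hd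
    have hp := h.pairing hφ (v := 0) IntervalIntegrable.zero (w := w') (ξ := deriv γ 0) (y := 0) (y' := 0)
      (by simpa using hd)
    have e2 : fderiv ℝ f z w' = ev (deriv γ 0) := by
      have h1 : HasDerivAt (fun s : ℝ => z + s • w') w' 0 := by
        simpa using ((hasDerivAt_id (0 : ℝ)).smul_const w').const_add z
      have hfd : HasFDerivAt f (fderiv ℝ f z) (z + (0 : ℝ) • w') := by
        simpa using (hf.differentiableAt (by norm_num)).hasFDerivAt
      have h2 : HasDerivAt (fun s : ℝ => f (z + s • w')) (fderiv ℝ f z w') 0 :=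
        HasFDerivAt.comp_hasDerivAt (0 : ℝ) (f := fun s : ℝ => z + s • w') hfd h1
      have h3 : HasDerivAt (fun s => ev (γ s)) (ev (deriv γ 0)) 0 :=
        ev.hasFDerivAt.comp_hasDerivAt 0 (hγ.differentiableAt (by norm_num)).hasDerivAt
      exact h2.unique h3
    rw [IccExtend_of_mem _ _ hb] at hp
    have hint : (∫ t in a..b, coordCovector x (φ t)
        (controlAction l 𝔼 (u t) (IccExtend h.le (0 : C(Icc a b, Fin l → 𝔼)) t) +
        controlAction l 𝔼 ((0 : ℝ → EuclideanSpace ℝ (Fin l)) t)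
          (IccExtend h.le (0 : C(Icc a b, Fin l → 𝔼)) t))) = 0 := by
      refine (intervalIntegral.integral_congr fun t _ => ?_).trans intervalIntegral.integral_zero
      have e0 : IccExtend h.le (0 : C(Icc a b, Fin l → 𝔼)) t = 0 := rfl
      simp only [e0, map_zero, add_zero]
    rw [hint, add_zero] at hp
    refine Eq.trans ?_ (hp.trans ?_)
    · exact congrArg (fun z => φ b (symmDeriv x (extChartAt (𝓡 n) x (q b)) z)) e2
    · exact congrArg (φ a) (symmDeriv_chartDeriv (h.mem_source a ha) w)

theorem hasFlow (hX : ∀ i, ContMDiff (𝓡 n) (𝓡 n).tangent ∞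
      (fun p => (⟨p, X i p⟩ : TangentBundle (𝓡 n) M)))
    (hu : IntervalIntegrable u volume a b) (hq : TrajOn X u q a b) : HasFlow X u q a b := by
  obtain ⟨δ, hδ, had⟩ := exists_forall_isAdapted hX hu hq.continuousOn
  refine rel_of_short (R := HasFlow X u q) hδ (fun a' b' h1 h2 h3 h4 => ?_)
    (fun a b c _ hab hbc _ h h' => h.trans hab hbc h') a b le_rfl hq.le le_rfl
  obtain ⟨x, Y, V, K, h⟩ := had a' b' h1 h2 h3 h4
  exact h.hasFlow (hq.mono h1 h2 h3)

end Transport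

/-- In the second derivative of P ∘ g the Hessian of P is evaluated at g'(0) and drops out when this
vanishes. Thus on the kernel only the differential of the flow after time b matters. -/
theorem deriv_comp_curve {E F : Type*} [NormedAddCommGroup E] [NormedSpace ℝ E]
    [NormedAddCommGroup F] [NormedSpace ℝ F] {P : E → F} {g : ℝ → E}
    (hP : ContDiffAt ℝ 2 P (g 0)) (hg : ContDiffAt ℝ 2 g 0) :
    deriv (fun s => P (g s)) 0 = fderiv ℝ P (g 0) (deriv g 0) ∧
      (deriv g 0 = 0 → deriv (deriv fun s => P (g s)) 0 =
        fderiv ℝ P (g 0) (deriv (deriv g) 0)) := by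
  have h1 : ∀ᶠ s in 𝓝 (0 : ℝ), deriv (fun s => P (g s)) s = fderiv ℝ P (g s) (deriv g s) := by
    filter_upwards [hg.eventually (by norm_num),
      hg.continuousAt.eventually (hP.eventually (by norm_num))] with s hs hs'
    exact ((hs'.differentiableAt (by norm_num)).hasFDerivAt.comp_hasDerivAt s
      (hs.differentiableAt (by norm_num)).hasDerivAt).deriv
  refine ⟨h1.self_of_nhds, fun h0 => ?_⟩
  have hd : HasDerivAt (deriv g) (deriv (deriv g) 0) 0 := by
    have h2 : ContDiffAt ℝ 1 (fderiv ℝ g) 0 := hg.fderiv_right (by norm_num)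
    have h3 : DifferentiableAt ℝ (fun s => fderiv ℝ g s 1) 0 :=
      (h2.differentiableAt (by norm_num)).clm_apply (differentiableAt_const _)
    exact h3.hasDerivAt
  have hD : HasFDerivAt (fderiv ℝ P) (fderiv ℝ (fderiv ℝ P) (g 0)) (g 0) :=
    ((hP.fderiv_right (m := 1) (by norm_num)).differentiableAt (by norm_num)).hasFDerivAt
  have h4 := (hD.comp_hasDerivAt (0 : ℝ)
    (hg.differentiableAt (by norm_num)).hasDerivAt).clm_apply hd
  rw [Filter.EventuallyEq.deriv_eq h1]
  refine h4.deriv.trans ?_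
  simp [h0]

/-! ### Controls supported in an interval. -/

section Control

variable {l : ℕ} {T : ℝ}

theorem intervalIntegrable_control (hT : 0 ≤ T) (u : Control T l) :
    IntervalIntegrable u volume 0 T := by
  rw [intervalIntegrable_iff_integrableOn_Icc_of_le hT]
  exact (Lp.memLp u).integrable one_le_two

theorem memLp_indicator_of_continuous {v : ℝ → EuclideanSpace ℝ (Fin l)} (hv : Continuous v)
    (a b : ℝ) : MemLp (indicator (Icc a b) v) 2 (volume.restrict (Icc (0 : ℝ) T)) := by
  obtain ⟨C, hC⟩ := isCompact_Icc.exists_bound_of_continuousOn (hv.continuousOn (s := Icc 0 T))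
  refine (MemLp.of_bound hv.aestronglyMeasurable C ?_).indicator measurableSet_Icc
  filter_upwards [ae_restrict_mem measurableSet_Icc] with t ht using hC t ht

/-- The control equal to `v` on `[a,b]` and to zero elsewhere. -/
def localControl (T : ℝ) {v : ℝ → EuclideanSpace ℝ (Fin l)} (hv : Continuous v) (a b : ℝ) :
    Control T l :=
  (memLp_indicator_of_continuous hv a b).toLp _

theorem add_smul_localControl_ae (u : Control T l) {v : ℝ → EuclideanSpace ℝ (Fin l)}
    (hv : Continuous v) (a b s : ℝ) : ∀ᵐ t ∂(volume.restrict (Icc (0 : ℝ) T)),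
      (u + s • localControl T hv a b : Control T l) t = u t + s • indicator (Icc a b) v t := by
  filter_upwards [Lp.coeFn_add u (s • localControl T hv a b),
    Lp.coeFn_smul s (localControl T hv a b),
    (memLp_indicator_of_continuous (T := T) hv a b).coeFn_toLp] with t h1 h2 h3
  rw [h1, Pi.add_apply, h2, Pi.smul_apply]
  exact congrArg (fun w => u t + s • w) h3

end Control

/-! ### Variations of the end point. -/

section Endpoint

variable {n l : ℕ} {M : Type*} [TopologicalSpace M]
  [ChartedSpace (EuclideanSpace ℝ (Fin n)) M]

local notation "𝔼" => EuclideanSpace ℝ (Fin n)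

variable {X : Fin l → (p : M) → TangentSpace (𝓡 n) p} {x : M}
  {Y : EuclideanSpace ℝ (Fin n) → Fin l → EuclideanSpace ℝ (Fin n)}
  {V : Set (EuclideanSpace ℝ (Fin n))} {K : ℝ} {q : ℝ → M} {a b T : ℝ} {u : Control T l}
  {φ : (t : ℝ) → TangentSpace (𝓡 n) (q t) →L[ℝ] ℝ}
  [IsManifold (𝓡 n) ∞ M] [T2Space M]
  (hX : ∀ i, ContMDiff (𝓡 n) (𝓡 n).tangent ∞
      (fun p => (⟨p, X i p⟩ : TangentBundle (𝓡 n) M)))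
include hX

/-- The end-point map is defined by choosing a trajectory; uniqueness identifies the choice with the
given one. -/
theorem endPoint_eq (hT : 0 ≤ T) {w : Control T l} {γ : ℝ → M} (hγ : TrajOn X w γ 0 T) :
    endPoint X (γ 0) T w = γ T := by
  have hw := intervalIntegrable_control hT w
  have h : ∃ q : ℝ → M, IsTrajectory X (γ 0) T w q :=
    ⟨γ, (isTrajectory_iff hX hT hw).2 ⟨hγ, rfl⟩⟩
  rw [endPoint, dif_pos h]
  have h1 := (isTrajectory_iff hX hT hw).1 h.choose_spec
  exact h1.1.eqOn hX hw hγ h1.2 (right_mem_Icc.2 hT)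

/-- The new trajectory is glued from q on [0,a], γ₁ on [a,b] and γ₂ on [b,T]. The control is
perturbed on a closed interval, and its disagreement with the pieces at the times a and b is
negligible. -/
theorem endPoint_add_localControl (hq : TrajOn X u q 0 T) (ha : 0 ≤ a) (hab : a ≤ b) (hb : b ≤ T)
    {v : ℝ → EuclideanSpace ℝ (Fin l)} (hv : Continuous v) {s : ℝ} {γ₁ γ₂ : ℝ → M}
    (h₁ : TrajOn X (fun t => u t + s • v t) γ₁ a b) (h₁a : γ₁ a = q a)
    (h₂ : TrajOn X u γ₂ b T) (h₂b : γ₂ b = γ₁ b) :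
    endPoint X (q 0) T (u + s • localControl T hv a b) = γ₂ T := by
  have hT : 0 ≤ T := hq.le
  have hw := add_smul_localControl_ae u hv a b s
  set w := u + s • localControl T hv a b
  have hne : ∀ c : ℝ, ∀ᵐ t : ℝ, t ≠ c := fun c => by
    simp [ae_iff, measure_singleton]
  have g0 : TrajOn X w q 0 a := (hq.mono le_rfl ha (hab.trans hb)).congr (by
    filter_upwards [ae_restrict_of_ae_restrict_of_subset
      (Icc_subset_Icc_right (hab.trans hb)) hw, ae_restrict_mem measurableSet_Icc,
      ae_restrict_of_ae (hne a)] with t ht ht' hta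
    rw [ht, indicator_of_notMem fun h => hta (le_antisymm ht'.2 h.1), smul_zero, add_zero])
    fun _ _ => rfl
  have g1 : TrajOn X w γ₁ a b := h₁.congr (by
    filter_upwards [ae_restrict_of_ae_restrict_of_subset
      (Icc_subset_Icc ha hb) hw, ae_restrict_mem measurableSet_Icc] with t ht ht'
    rw [ht, indicator_of_mem ht']) fun _ _ => rfl
  have g2 : TrajOn X w γ₂ b T := h₂.congr (by
    filter_upwards [ae_restrict_of_ae_restrict_of_subset
      (Icc_subset_Icc_left (ha.trans hab)) hw, ae_restrict_mem measurableSet_Icc,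
      ae_restrict_of_ae (hne b)] with t ht ht' htb
    rw [ht, indicator_of_notMem fun h => htb (le_antisymm h.2 ht'.1), smul_zero, add_zero])
    fun _ _ => rfl
  have hend : ∀ {δ₁ δ₂ : ℝ → M} {c d : ℝ}, c ≤ d → δ₁ c = δ₂ c →
      (if d ≤ c then δ₁ d else δ₂ d) = δ₂ d := by
    intro δ₁ δ₂ c d hcd he
    rcases hcd.eq_or_lt with rfl | hlt
    · simp [he]
    · simp [not_le.2 hlt]
  have g01 := g0.concat_of_eq g1 h₁a.symm
  have e1 := hend hab h₁a.symm
  have g := g01.concat_of_eq g2 (e1.trans h₂b.symm)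
  have e2 := hend hb (δ₁ := fun t => if t ≤ a then q t else γ₁ t) (e1.trans h₂b.symm)
  have e3 := endPoint_eq hX hT g
  simp only [if_pos (ha.trans hab), if_pos ha] at e3
  exact e3.trans e2

/-- First and second variation of the end-point map with respect to a control supported in a
short interval. -/
theorem IsAdapted.exists_variation (hq : TrajOn X u q 0 T) (ha : 0 ≤ a) (hb : b ≤ T)
    (h : IsAdapted X u x Y V K q a b) {v : ℝ → EuclideanSpace ℝ (Fin l)} (hv : Continuous v)
    (hφ : PontrOn X u q φ 0 T) (φ₀ : TangentSpace (𝓡 n) (endPoint X (q 0) T u) →L[ℝ] ℝ)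
    (hφ₀ : (φ T : 𝔼 →L[ℝ] ℝ) = (φ₀ : 𝔼 →L[ℝ] ℝ)) :
    ∃ ξ η : C(Icc a b, 𝔼),
      ξ = controlOp n h.le h.integrable (superposeDeriv Y h.contDiff h.path ξ) +
        controlOp n h.le (hv.intervalIntegrable a b)
          (superpose ⟨Y, h.contDiff.continuous⟩ h.path) ∧
      η = controlOp n h.le h.integrable (superposeDeriv2 Y h.contDiff h.path ξ ξ +
          superposeDeriv Y h.contDiff h.path η) +
        (2 : ℝ) • controlOp n h.le (hv.intervalIntegrable a b)
          (superposeDeriv Y h.contDiff h.path ξ) ∧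
      φ₀ (dEnd X (q 0) T u (localControl T hv a b)) =
        coordCovector x (φ b) (ξ ⟨b, right_mem_Icc.2 h.le⟩) ∧
      (ξ ⟨b, right_mem_Icc.2 h.le⟩ = 0 →
        dEnd X (q 0) T u (localControl T hv a b) = 0 ∧
        φ₀ (d2End X (q 0) T u (localControl T hv a b)) =
          coordCovector x (φ b) (η ⟨b, right_mem_Icc.2 h.le⟩)) := by
  have hT : 0 ≤ T := hq.le
  have hab := h.le
  have hu := intervalIntegrable_control hT u
  have hab' := right_mem_Icc.2 hab
  have haa' := left_mem_Icc.2 hab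
  have h0b : 0 ≤ b := ha.trans hab
  have hqb := h.mem_source b hab'
  have hQ : endPoint X (q 0) T u = q T := endPoint_eq hX hT hq
  obtain ⟨S, hS, hS0, hSe⟩ :=
    h.exists_family (hq.mono ha hab hb) (hv.intervalIntegrable a b)
  obtain ⟨F, hF, hFq, hFt, hFφ⟩ := Goh.hasFlow hX (hu.mono_set (by
    rw [uIcc_of_le hb, uIcc_of_le hT]
    exact Icc_subset_Icc_left h0b)) (hq.mono h0b hb le_rfl)
  set z := extChartAt (𝓡 n) x (q a) with hz
  set zb := extChartAt (𝓡 n) x (q b) with hzb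
  let ev : C(Icc a b, 𝔼) →L[ℝ] 𝔼 := ContinuousMap.evalCLM ℝ ⟨b, hab'⟩
  let γ : ℝ → C(Icc a b, 𝔼) := fun s => S (z, s)
  have hγ0 : γ 0 = h.path := hS0
  have hγ : ContDiffAt ℝ 2 γ 0 := hS.comp (0 : ℝ) (contDiffAt_const.prodMk contDiffAt_id)
  have htend : Tendsto (fun s : ℝ => (z, s)) (𝓝 0) (𝓝 (z, 0)) :=
    tendsto_const_nhds.prodMk_nhds tendsto_id
  have hγe := htend.eventually hSe
  obtain ⟨hd1, hd2⟩ := deriv_of_integral_equation Y h.contDiff (controlOp n hab h.integrable)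
    (controlOp n hab (hv.intervalIntegrable a b)) (ContinuousMap.const _ z) 0 hγ (by
      filter_upwards [hγe] with s hs
      refine hs.1.trans ?_
      rw [smul_zero, add_zero])
  rw [hγ0] at hd1 hd2
  rw [zero_add] at hd1
  let σ := (extChartAt (𝓡 n) x).symm
  let Q := endPoint X (q 0) T u
  -- P reads the flow from time b to T from the chart at x into the preferred chart at the end
  -- point, in which `dEnd` and `d2End` are computed; its differential pulls φ₀ back to φ(b).
  let P : 𝔼 → 𝔼 := fun w => extChartAt (𝓡 n) Q (F (σ w))
  have hle : (2 : WithTop ℕ∞) ≤ ∞ := WithTop.coe_le_coe.2 le_top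
  have hσ : ContMDiffAt 𝓘(ℝ, 𝔼) (𝓡 n) 2 σ zb :=
    (contMDiffAt_extChartAt_symm_of_mem ((extChartAt (𝓡 n) x).map_source hqb)).of_le hle
  have hσb : σ zb = q b := (extChartAt (𝓡 n) x).left_inv hqb
  have hF' : ContMDiffAt (𝓡 n) (𝓡 n) 2 F (σ zb) := by rwa [hσb]
  have hFσ : ContMDiffAt 𝓘(ℝ, 𝔼) (𝓡 n) 2 (F ∘ σ) zb := hF'.comp zb hσ
  have hFσb : (F ∘ σ) zb = Q := by
    rw [Function.comp_apply, hσb, hFq]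
    exact hQ.symm
  have hκ : ContMDiffAt (𝓡 n) 𝓘(ℝ, 𝔼) 2 (extChartAt (𝓡 n) Q) ((F ∘ σ) zb) := by
    rw [hFσb]
    exact (contMDiffAt_extChartAt_of_mem (mem_extChartAt_source Q)).of_le hle
  have hP : ContDiffAt ℝ 2 P zb := contMDiffAt_iff_contDiffAt.1 (hκ.comp zb hFσ)
  have hPd : fderiv ℝ P zb = mapDeriv F (q b) ∘L symmDeriv x zb := by
    have h1 := mfderiv_comp (I' := 𝓡 n) zb (hκ.mdifferentiableAt (by norm_num))
      (hFσ.mdifferentiableAt (by norm_num))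
    have h2 := mfderiv_comp (I' := 𝓡 n) zb (hF'.mdifferentiableAt (by norm_num))
      (hσ.mdifferentiableAt (by norm_num))
    rw [h2, hFσb] at h1
    rw [← mfderiv_eq_fderiv]
    have h3 : fderiv ℝ P zb = chartDeriv Q Q ∘L (mapDeriv F (σ zb) ∘L symmDeriv x zb) := by
      rw [← mfderiv_eq_fderiv]
      exact h1
    rw [chartDeriv_self, hσb, ContinuousLinearMap.id_comp] at h3
    rw [mfderiv_eq_fderiv]
    exact h3
  have hφP : ∀ w : 𝔼, (φ₀ : 𝔼 →L[ℝ] ℝ) (fderiv ℝ P zb w) = coordCovector x (φ b) w := by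
    intro w
    rw [hPd, ← hφ₀]
    exact hFφ φ (hφ.mono h0b hb le_rfl) (symmDeriv x zb w)
  let g : ℝ → 𝔼 := fun s => ev (γ s)
  have hg0 : g 0 = zb := by simp only [g, hγ0]; rfl
  have hg : ContDiffAt ℝ 2 g 0 := ev.contDiff.contDiffAt.comp (0 : ℝ) hγ
  -- Near s = 0 the end-point curve is P applied to the position at time b, so both derivatives
  -- reduce to those of g.
  have hend : endCurve X (q 0) T u (localControl T hv a b) =ᶠ[𝓝 0] fun s => P (g s) := by
    have hc : ContinuousAt (fun s => σ (g s)) 0 := by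
      refine ContinuousAt.comp ?_ hg.continuousAt
      rw [hg0]
      exact hσ.continuousAt
    have hFt' : ∀ᶠ s in 𝓝 (0 : ℝ), ∃ γ : ℝ → M, TrajOn X u γ b T ∧ γ b = σ (g s) ∧
        γ T = F (σ (g s)) := hc.eventually (by
      simp only [hg0]
      rwa [hσb])
    filter_upwards [hγe, hFt'] with s hs ⟨γ₂, h2, h2b, h2T⟩
    have e := endPoint_add_localControl hX hq ha hab hb hv hs.2.2 ?_ h2 ?_
    · simp only [endCurve, P]
      rw [e, h2T]
    · simp only [IccExtend_of_mem _ _ haa']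
      rw [hs.1]
      simp only [ContinuousMap.add_apply, ContinuousMap.smul_apply, controlOp_left,
        ContinuousMap.const_apply, smul_zero, add_zero]
      exact (extChartAt (𝓡 n) x).left_inv (h.mem_source a haa')
    · simp only [IccExtend_of_mem _ _ hab']
      exact h2b
  have hev1 : ∀ᶠ s in 𝓝 (0 : ℝ), deriv g s = ev (deriv γ s) := by
    filter_upwards [hγ.eventually (by norm_num)] with s hs
    exact (ev.hasFDerivAt.comp_hasDerivAt s
      (hs.differentiableAt (by norm_num)).hasDerivAt).deriv
  have hev2 : deriv (deriv g) 0 = ev (deriv (deriv γ) 0) := by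
    have h2 : ContDiffAt ℝ 1 (fderiv ℝ γ) 0 := hγ.fderiv_right (by norm_num)
    have h3 : DifferentiableAt ℝ (fun s => fderiv ℝ γ s 1) 0 :=
      (h2.differentiableAt (by norm_num)).clm_apply (differentiableAt_const _)
    have h4 : HasDerivAt (deriv γ) (deriv (deriv γ) 0) 0 := h3.hasDerivAt
    rw [Filter.EventuallyEq.deriv_eq hev1]
    exact (ev.hasFDerivAt.comp_hasDerivAt 0 h4).deriv
  obtain ⟨hc1, hc2⟩ := deriv_comp_curve (P := P) (g := g) (by rwa [hg0]) hg
  rw [hg0, hev1.self_of_nhds] at hc1 hc2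
  have hdE : dEnd X (q 0) T u (localControl T hv a b) = fderiv ℝ P zb (ev (deriv γ 0)) :=
    hend.deriv_eq.trans hc1
  refine ⟨deriv γ 0, deriv (deriv γ) 0, hd1, hd2, ?_, fun hξ => ?_⟩
  · exact (congrArg φ₀ hdE).trans (hφP _)
  · have hξ' : ev (deriv γ 0) = 0 := hξ
    refine ⟨hdE.trans (by rw [hξ', map_zero]; rfl), ?_⟩
    have hd2E : d2End X (q 0) T u (localControl T hv a b) =
        fderiv ℝ P zb (ev (deriv (deriv γ) 0)) := by
      rw [← hev2, ← hc2 hξ']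
      have : iteratedDeriv 2 (endCurve X (q 0) T u (localControl T hv a b)) 0 =
          deriv (deriv (endCurve X (q 0) T u (localControl T hv a b))) 0 := by
        rw [iteratedDeriv_succ, iteratedDeriv_one]
      exact this.trans hend.deriv.deriv_eq
    exact (congrArg φ₀ hd2E).trans (hφP _)

end Endpoint

/-- A vector with Q < 0 would span a negative definite line. Only homogeneity along lines enters;
additivity of the first derivative is not needed. -/
theorem nonneg_of_negIndex_eq_zero {V : Type*} [AddCommGroup V] [Module ℝ V] {K : Set V}
    {Q : V → ℝ} (h : negIndex K Q = 0) (hK : ∀ (c : ℝ), ∀ w ∈ K, c • w ∈ K)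
    (hQ : ∀ (c : ℝ) (w : V), Q (c • w) = c ^ 2 * Q w) {w : V} (hw : w ∈ K) : 0 ≤ Q w := by
  by_contra! hlt
  have hw0 : w ≠ 0 := by
    rintro rfl
    have := hQ 0 0
    simp at this
    linarith
  have h1 : ((Module.finrank ℝ (Submodule.span ℝ {w}) : ℕ) : ℕ∞) ≤ negIndex K Q := by
    refine le_iSup₂_of_le (Submodule.span ℝ {w}) ⟨inferInstance, ?_, ?_⟩ le_rfl
    · intro y hy
      obtain ⟨c, rfl⟩ := Submodule.mem_span_singleton.1 hy
      exact hK c w hw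
    · intro y hy hy0
      obtain ⟨c, rfl⟩ := Submodule.mem_span_singleton.1 hy
      have hc : c ≠ 0 := fun hc => hy0 (by simp [hc])
      rw [hQ]
      exact mul_neg_of_pos_of_neg (by positivity) hlt
  rw [h, finrank_span_singleton hw0] at h1
  simp at h1

/-! ### Homogeneity of the derivatives of the end-point map. -/

section Homogeneity

variable {n l : ℕ} {M : Type*} [TopologicalSpace M]
  [ChartedSpace (EuclideanSpace ℝ (Fin n)) M]
  (X : Fin l → (p : M) → TangentSpace (𝓡 n) p) (q₀ : M) {T : ℝ} (u Δu : Control T l)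

/-- Scaling the variation reparametrises the curve. The scaling rules for `deriv` hold even where it
takes its default value, so the homogeneity below needs no differentiability. -/
theorem endCurve_smul (c : ℝ) :
    endCurve X q₀ T u (c • Δu) = fun s => endCurve X q₀ T u Δu (c * s) := by
  ext1 s
  rw [endCurve, endCurve, smul_smul, mul_comm s c]

theorem dEnd_smul (c : ℝ) : dEnd X q₀ T u (c • Δu) = c • dEnd X q₀ T u Δu := by
  have h : deriv (endCurve X q₀ T u (c • Δu)) 0 = c • deriv (endCurve X q₀ T u Δu) 0 := by
    rw [endCurve_smul, deriv_comp_mul_left, mul_zero]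
  exact h

theorem d2End_smul (c : ℝ) : d2End X q₀ T u (c • Δu) = c ^ 2 • d2End X q₀ T u Δu := by
  have h : iteratedDeriv 2 (endCurve X q₀ T u (c • Δu)) 0 =
      c ^ 2 • iteratedDeriv 2 (endCurve X q₀ T u Δu) 0 := by
    have h1 : deriv (endCurve X q₀ T u (c • Δu)) =
        fun s => c • deriv (endCurve X q₀ T u Δu) (c * s) := by
      ext1 s
      rw [endCurve_smul, deriv_comp_mul_left]
    rw [iteratedDeriv_succ, iteratedDeriv_one, iteratedDeriv_succ, iteratedDeriv_one, h1,
      deriv_fun_const_smul_field, deriv_comp_mul_left c (deriv (endCurve X q₀ T u Δu)),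
      mul_zero, smul_smul, sq]
  exact h

end Homogeneity

/-! ### Necessary conditions as integrals along the trajectory. -/

section Interface

variable {n l : ℕ} {M : Type*} [TopologicalSpace M]
  [ChartedSpace (EuclideanSpace ℝ (Fin n)) M]

local notation "𝔼" => EuclideanSpace ℝ (Fin n)

variable {X : Fin l → (p : M) → TangentSpace (𝓡 n) p} {x : M}
  {Y : EuclideanSpace ℝ (Fin n) → Fin l → EuclideanSpace ℝ (Fin n)}
  {V : Set (EuclideanSpace ℝ (Fin n))} {K : ℝ} {q : ℝ → M} {a b T : ℝ} {u : Control T l}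
  {φ : (t : ℝ) → TangentSpace (𝓡 n) (q t) →L[ℝ] ℝ}

/-- The solution of an affine fixed point equation is unique. -/
theorem eq_of_affine_equation {G : Type*} [NormedAddCommGroup G] [NormedSpace ℝ G]
    {J : G →L[ℝ] G} (hJ : ‖J‖ < 1) {c ξ ξ' : G} (h : ξ = J ξ + c) (h' : ξ' = J ξ' + c) :
    ξ = ξ' := by
  have h1 : ξ - ξ' = J (ξ - ξ') := by
    rw [map_sub]
    nth_rw 1 [h, h']
    abel
  by_contra hne
  have h2 : 0 < ‖ξ - ξ'‖ := norm_pos_iff.2 (sub_ne_zero.2 hne)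
  have h3 := J.le_opNorm (ξ - ξ')
  rw [← h1] at h3
  nlinarith

variable [IsManifold (𝓡 n) ∞ M] [T2Space M]
  (hX : ∀ i, ContMDiff (𝓡 n) (𝓡 n).tangent ∞
      (fun p => (⟨p, X i p⟩ : TangentBundle (𝓡 n) M)))
include hX

/-- The necessary conditions of first and second order for variations supported in a short
interval. -/
theorem IsAdapted.variation_conditions (hq : TrajOn X u q 0 T) (ha : 0 ≤ a) (hb : b ≤ T)
    (h : IsAdapted X u x Y V K q a b) {v : ℝ → EuclideanSpace ℝ (Fin l)} (hv : Continuous v)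
    (hφ : PontrOn X u q φ 0 T) (φ₀ : TangentSpace (𝓡 n) (endPoint X (q 0) T u) →L[ℝ] ℝ)
    (hφ₀ : (φ T : 𝔼 →L[ℝ] ℝ) = (φ₀ : 𝔼 →L[ℝ] ℝ))
    (hann : ∀ Δu : Control T l, φ₀ (dEnd X (q 0) T u Δu) = 0)
    (hindex : negIndex {Δu : Control T l | dEnd X (q 0) T u Δu = 0}
      (fun Δu => φ₀ (d2End X (q 0) T u Δu)) = 0)
    {ξ : C(Icc a b, 𝔼)}
    (hξ : ξ = controlOp n h.le h.integrable (superposeDeriv Y h.contDiff h.path ξ) +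
        controlOp n h.le (hv.intervalIntegrable a b)
          (superpose ⟨Y, h.contDiff.continuous⟩ h.path)) :
    (∫ t in a..b, coordCovector x (φ t)
      (controlAction l 𝔼 (v t) (Y (extChartAt (𝓡 n) x (q t)))) = 0) ∧
    (ξ ⟨b, right_mem_Icc.2 h.le⟩ = 0 → 0 ≤ ∫ t in a..b, coordCovector x (φ t)
      (controlAction l 𝔼 (u t) (fderiv ℝ (fderiv ℝ Y) (extChartAt (𝓡 n) x (q t))
          (IccExtend h.le ξ t) (IccExtend h.le ξ t)) +
        controlAction l 𝔼 (v t) ((2 : ℝ) • fderiv ℝ Y (extChartAt (𝓡 n) x (q t))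
          (IccExtend h.le ξ t)))) := by
  have hab' := right_mem_Icc.2 h.le
  have hφab := hφ.mono ha h.le hb
  obtain ⟨ξ', η, h1, h2, h3, h4⟩ := h.exists_variation hX hq ha hb hv hφ φ₀ hφ₀
  obtain rfl : ξ = ξ' := eq_of_affine_equation h.norm_comp_superposeDeriv_lt hξ h1
  constructor
  · have hp := h.pairing hφab (hv.intervalIntegrable a b) (w := 0) (ξ := ξ) (y := 0)
      (y' := superpose ⟨Y, h.contDiff.continuous⟩ h.path) (by
        conv_lhs => rw [h1]
        ext1 t
        simp)
    rw [IccExtend_of_mem _ _ hab', ← h3, hann, map_zero, zero_add] at hp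
    rw [hp]
    refine intervalIntegral.integral_congr fun t ht => ?_
    rw [uIcc_of_le h.le] at ht
    have e0 : IccExtend h.le (0 : C(Icc a b, Fin l → 𝔼)) t = 0 := rfl
    simp only [e0, map_zero, zero_add, IccExtend_of_mem _ _ ht]
    rfl
  · intro hξb
    obtain ⟨hd, hd2⟩ := h4 hξb
    have hnn : 0 ≤ φ₀ (d2End X (q 0) T u (localControl T hv a b)) := by
      refine nonneg_of_negIndex_eq_zero hindex (fun c w hw => ?_) (fun c w => ?_) hd
      · have hw' : dEnd X (q 0) T u w = 0 := hw
        refine (dEnd_smul X (q 0) u w c).trans ?_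
        rw [hw', smul_zero]
      · show φ₀ _ = _
        rw [d2End_smul, map_smul, smul_eq_mul]
    have hp := h.pairing hφab (hv.intervalIntegrable a b) (w := 0) (ξ := η)
      (y := superposeDeriv2 Y h.contDiff h.path ξ ξ)
      (y' := (2 : ℝ) • superposeDeriv Y h.contDiff h.path ξ) (by
        conv_lhs => rw [h2]
        rw [add_comm (superposeDeriv2 Y h.contDiff h.path ξ ξ), map_smul]
        ext1 t
        simp)
    rw [IccExtend_of_mem _ _ hab', ← hd2, map_zero, zero_add] at hp
    rw [hp] at hnn
    refine hnn.trans_eq (intervalIntegral.integral_congr fun t ht => ?_)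
    rw [uIcc_of_le h.le] at ht
    simp only [IccExtend_of_mem _ _ ht]
    rfl

end Interface

/-! ### Asymptotics of the second variation on shrinking intervals. -/

section Expansion

theorem eventually_norm_sub_le {F : Type*} [NormedAddCommGroup F] {f : ℝ → F} {s : Set ℝ} {τ θ : ℝ}
    (hf : ContinuousWithinAt f s τ) (hθ : 0 < θ) : ∀ᶠ t in 𝓝[s] τ, ‖f t - f τ‖ ≤ θ := by
  simpa only [mem_closedBall_iff_norm] using
    hf.eventually_mem (Metric.closedBall_mem_nhds (f τ) hθ)

variable {E W : Type*} [NormedAddCommGroup E] [NormedSpace ℝ E] [NormedAddCommGroup W]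
  [NormedSpace ℝ W] {G : Type*}

/-- The control u is merely integrable, so ∫‖u‖ over a short interval is small without any rate.
Terms carrying u are therefore charged to θ and bounded terms to the length. -/
theorem norm_integral_le_of_norm_le_affine [NormedAddCommGroup G] {f : ℝ → E} {u : ℝ → G} {a b A B θ : ℝ}
    (hu : IntervalIntegrable u volume a b) (hA : 0 ≤ A) (hB : 0 ≤ B)
    (hθ : ∫ t in a..b, ‖u t‖ ≤ θ) (hf : ∀ t ∈ Icc a b, ‖f t‖ ≤ A * ‖u t‖ + B) {t : ℝ}
    (ht : t ∈ Icc a b) : ‖∫ s in a..t, f s‖ ≤ A * θ + B * (b - a) := by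
  have hab : a ≤ b := ht.1.trans ht.2
  have hi : IntervalIntegrable (fun s => A * ‖u s‖ + B) volume a b :=
    (hu.norm.const_mul A).add intervalIntegrable_const
  have hsub : uIcc a t ⊆ uIcc a b := by
    rw [uIcc_of_le ht.1, uIcc_of_le hab]
    exact Icc_subset_Icc_right ht.2
  calc ‖∫ s in a..t, f s‖ ≤ ∫ s in a..t, (A * ‖u s‖ + B) :=
        intervalIntegral.norm_integral_le_of_norm_le ht.1
          (ae_of_all _ fun s hs => hf s ⟨hs.1.le, hs.2.trans ht.2⟩) (hi.mono_set hsub)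
    _ ≤ ∫ s in a..b, (A * ‖u s‖ + B) :=
        intervalIntegral.integral_mono_interval le_rfl ht.1 ht.2
          (ae_of_all _ fun s => by positivity) hi
    _ = A * (∫ s in a..b, ‖u s‖) + B * (b - a) := by
        rw [intervalIntegral.integral_add (hu.norm.const_mul A) intervalIntegrable_const,
          intervalIntegral.integral_const_mul, intervalIntegral.integral_const, smul_eq_mul,
          mul_comm B]
    _ ≤ _ := by gcongr

variable [NormedAddCommGroup G] [NormedSpace ℝ G] (α : G →L[ℝ] W →L[ℝ] E)

theorem norm_pairing_le (P : E →L[ℝ] ℝ) (g : G) (L : E →L[ℝ] W) (e : E) :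
    ‖P (α g (L e))‖ ≤ ‖P‖ * (‖α‖ * ‖g‖ * (‖L‖ * ‖e‖)) := by
  refine (P.le_opNorm _).trans ?_
  gcongr
  refine (α.le_opNorm₂ _ _).trans ?_
  gcongr
  exact L.le_opNorm e

/-- Telescoping: P, L and e are replaced one at a time, and each replacement gives one summand of
the bound. -/
theorem norm_pairing_sub_le {P P' : E →L[ℝ] ℝ} {g : G} {L L' : E →L[ℝ] W} {e e' : E}
    {D θ r s : ℝ} (hα : ‖α‖ ≤ D) (hP' : ‖P'‖ ≤ D) (hg : ‖g‖ ≤ D) (hL : ‖L‖ ≤ D) (hL' : ‖L'‖ ≤ D)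
    (hPP : ‖P - P'‖ ≤ θ) (hLL : ‖L - L'‖ ≤ θ) (he : ‖e‖ ≤ r) (hee : ‖e - e'‖ ≤ s) :
    ‖P (α g (L e)) - P' (α g (L' e'))‖ ≤
      θ * (D * D * (D * r)) + D * (D * D * (θ * r)) + D * (D * D * (D * s)) := by
  have hD : 0 ≤ D := (norm_nonneg _).trans hg
  have hθ : 0 ≤ θ := (norm_nonneg _).trans hPP
  have e1 : P (α g (L e)) - P' (α g (L' e')) = (P - P') (α g (L e)) + P' (α g ((L - L') e)) +
      P' (α g (L' (e - e'))) := by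
    simp only [sub_apply, map_sub]
    abel
  rw [e1]
  refine norm_add₃_le.trans ?_
  gcongr
  · refine (norm_pairing_le α _ _ _ _).trans ?_
    gcongr
  · refine (norm_pairing_le α _ _ _ _).trans ?_
    gcongr
  · refine (norm_pairing_le α _ _ _ _).trans ?_
    gcongr

/-- The leading term of the second variation on a short interval. -/
theorem exists_quadratic_expansion [CompleteSpace E] {Y : E → W} (hY : ContDiff ℝ 2 Y)
    {τ b₀ : ℝ} (hb₀ : τ < b₀) {y : ℝ → E} (hy : ContinuousOn y (Icc τ b₀))
    {p : ℝ → E →L[ℝ] ℝ} (hp : ContinuousOn p (Icc τ b₀)) {u : ℝ → G}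
    (hu : IntervalIntegrable u volume τ b₀) (C : ℝ) {ε : ℝ} (hε : 0 < ε) :
    ∃ δ > 0, ∀ b, τ < b → b ≤ b₀ → b < τ + δ → ∀ (v w : ℝ → G) (ξ : ℝ → E), Continuous v →
      (∀ t ∈ Icc τ b, ‖v t‖ ≤ C) → (∀ t, HasDerivAt w (v t) t) → w τ = 0 → ξ τ = 0 →
      IsPrimitiveOn ξ (fun t => α (u t) (fderiv ℝ Y (y t) (ξ t)) + α (v t) (Y (y t))) τ b →
      ‖(∫ t in τ..b, p t (α (u t) (fderiv ℝ (fderiv ℝ Y) (y t) (ξ t) (ξ t)) +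
          α (v t) ((2 : ℝ) • fderiv ℝ Y (y t) (ξ t)))) -
        ∫ t in τ..b, 2 * p τ (α (v t) (fderiv ℝ Y (y τ) (α (w t) (Y (y τ)))))‖ ≤
        ε * (b - τ) ^ 2 := by
  have hY1 : Continuous (fderiv ℝ Y) := hY.continuous_fderiv (by norm_num)
  have hY2 : Continuous (fderiv ℝ (fderiv ℝ Y)) :=
    (hY.fderiv_right (m := 1) (by norm_num)).continuous_fderiv (by norm_num)
  have hYy := hY.continuous.comp_continuousOn hy
  have hY1y := hY1.comp_continuousOn hy
  have hY2y := hY2.comp_continuousOn hy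
  obtain ⟨B₀, hB₀⟩ := isCompact_Icc.exists_bound_of_continuousOn hYy
  obtain ⟨B₁, hB₁⟩ := isCompact_Icc.exists_bound_of_continuousOn hY1y
  obtain ⟨B₂, hB₂⟩ := isCompact_Icc.exists_bound_of_continuousOn (E := E →L[ℝ] E →L[ℝ] W) hY2y
  obtain ⟨B₃, hB₃⟩ := isCompact_Icc.exists_bound_of_continuousOn hp
  -- One constant dominating all norms, and at least 1 so that lower powers of D can be absorbed
  -- into higher ones.
  set D : ℝ := 1 + ‖α‖ + |C| + |B₀| + |B₁| + |B₂| + |B₃| with hDdef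
  have n₀ := norm_nonneg α
  have n₁ := abs_nonneg C
  have n₂ := abs_nonneg B₀
  have n₃ := abs_nonneg B₁
  have n₄ := abs_nonneg B₂
  have n₅ := abs_nonneg B₃
  have hD1 : 1 ≤ D := by linarith
  have hαD : ‖α‖ ≤ D := by linarith
  have hCD : C ≤ D := by linarith [le_abs_self C]
  have hB₀D : B₀ ≤ D := by linarith [le_abs_self B₀]
  have hB₁D : B₁ ≤ D := by linarith [le_abs_self B₁]
  have hB₂D : B₂ ≤ D := by linarith [le_abs_self B₂]
  have hB₃D : B₃ ≤ D := by linarith [le_abs_self B₃]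
  clear_value D
  have hD0 : 0 < D := by linarith
  -- The first bound lets the u-term be absorbed in the estimate of ξ; the second is for the final
  -- error, with 18 = 4 + 14.
  set θ : ℝ := min (1 / (2 * D ^ 2)) (ε / (18 * D ^ 9)) with hθdef
  have hθ : 0 < θ := by positivity
  have hθ1 : D ^ 2 * θ ≤ 1 / 2 := by
    calc D ^ 2 * θ ≤ D ^ 2 * (1 / (2 * D ^ 2)) := by gcongr; exact min_le_left _ _
      _ = 1 / 2 := by field_simp
  have hθ2 : 18 * D ^ 9 * θ ≤ ε := by
    calc 18 * D ^ 9 * θ ≤ 18 * D ^ 9 * (ε / (18 * D ^ 9)) := by gcongr; exact min_le_right _ _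
      _ = ε := by field_simp
  have hτ : τ ∈ Icc τ b₀ := left_mem_Icc.2 hb₀.le
  have hUc := IsPrimitiveOn.continuousOn_integral hb₀.le hu.norm
  obtain ⟨δ, hδ, hball⟩ := Metric.mem_nhdsWithin_iff.1
    ((eventually_norm_sub_le (hYy τ hτ) hθ).and ((eventually_norm_sub_le (hY1y τ hτ) hθ).and
      ((eventually_norm_sub_le (hp τ hτ) hθ).and (eventually_norm_sub_le (hUc τ hτ) hθ))))
  refine ⟨δ, hδ, fun b hτb hbb hbδ v w ξ hv hvC hw hwτ hξτ hξ => ?_⟩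
  have hab := hτb.le
  have hsub : Icc τ b ⊆ Icc τ b₀ := Icc_subset_Icc_right hbb
  have hmem : ∀ t ∈ Icc τ b, _ := fun t ht => hball ⟨by
    rw [Metric.mem_ball, Real.dist_eq, abs_of_nonneg (by linarith [ht.1])]
    linarith [ht.2], hsub ht⟩
  have hub : IntervalIntegrable u volume τ b := hu.mono_set (by
    rwa [uIcc_of_le hab, uIcc_of_le hb₀.le])
  have hU : ∫ t in τ..b, ‖u t‖ ≤ θ := by
    have := (hmem b (right_mem_Icc.2 hab)).2.2.2
    simp only [intervalIntegral.integral_same, sub_zero] at this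
    exact (Real.le_norm_self _).trans this
  set h := b - τ with hh
  have hh0 : 0 < h := by linarith
  have nY : ∀ t ∈ Icc τ b, ‖Y (y t)‖ ≤ D := fun t ht => (hB₀ t (hsub ht)).trans hB₀D
  have nY1 : ∀ t ∈ Icc τ b, ‖fderiv ℝ Y (y t)‖ ≤ D := fun t ht => (hB₁ t (hsub ht)).trans hB₁D
  have nY2 : ∀ t ∈ Icc τ b, ‖fderiv ℝ (fderiv ℝ Y) (y t)‖ ≤ D :=
    fun t ht => (hB₂ t (hsub ht)).trans hB₂D
  have np : ∀ t ∈ Icc τ b, ‖p t‖ ≤ D := fun t ht => (hB₃ t (hsub ht)).trans hB₃D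
  have nv : ∀ t ∈ Icc τ b, ‖v t‖ ≤ D := fun t ht => (hvC t ht).trans hCD
  have hτ' : τ ∈ Icc τ b := left_mem_Icc.2 hab
  have nu : ∀ t ∈ Icc τ b, ∀ m, ‖ξ t‖ ≤ m → ‖α (u t) (fderiv ℝ Y (y t) (ξ t))‖ ≤
      D ^ 2 * m * ‖u t‖ := by
    intro t ht m hm
    calc _ ≤ ‖α‖ * ‖u t‖ * ‖fderiv ℝ Y (y t) (ξ t)‖ := α.le_opNorm₂ _ _
      _ ≤ D * ‖u t‖ * (D * m) := by
        gcongr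
        exact (ContinuousLinearMap.le_opNorm _ _).trans
          (mul_le_mul (nY1 t ht) hm (norm_nonneg _) hD0.le)
      _ = _ := by ring
  -- At a maximum of ‖ξ‖ the u-term contributes at most half of that maximum, hence ‖ξ‖ = O(h).
  have nξ : ∀ t ∈ Icc τ b, ‖ξ t‖ ≤ 2 * D ^ 3 * h := by
    obtain ⟨r, hr, hmax⟩ := isCompact_Icc.exists_isMaxOn (nonempty_Icc.2 hab)
      hξ.continuousOn.norm
    have h1 : ‖ξ r‖ ≤ D ^ 2 * ‖ξ r‖ * θ + D ^ 3 * h := by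
      have e1 := hξ.eq r hr
      rw [hξτ, zero_add] at e1
      have := norm_integral_le_of_norm_le_affine (f := fun t =>
        α (u t) (fderiv ℝ Y (y t) (ξ t)) + α (v t) (Y (y t))) hub
        (A := D ^ 2 * ‖ξ r‖) (B := D ^ 3) (by positivity) (by positivity) hU (fun t ht => ?_) hr
      · rwa [← e1] at this
      · refine (norm_add_le _ _).trans (add_le_add (nu t ht _ (hmax ht)) ?_)
        calc _ ≤ ‖α‖ * ‖v t‖ * ‖Y (y t)‖ := α.le_opNorm₂ _ _
          _ ≤ D * D * D := by gcongr; exacts [nv t ht, nY t ht]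
          _ = D ^ 3 := by ring
    have h2 : D ^ 2 * ‖ξ r‖ * θ ≤ ‖ξ r‖ * (1 / 2) := by
      calc D ^ 2 * ‖ξ r‖ * θ = ‖ξ r‖ * (D ^ 2 * θ) := by ring
        _ ≤ _ := by gcongr
    intro t ht
    have h3 : ‖ξ t‖ ≤ ‖ξ r‖ := hmax ht
    linarith
  have hwc : Continuous w := continuous_iff_continuousAt.2 fun t => (hw t).continuousAt
  -- To leading order ξ is the primitive of v contracted with the frozen fields: the u-term is O(θh)
  -- since ξ = O(h), and freezing Y costs another O(θh).
  have nζ : ∀ t ∈ Icc τ b, ‖ξ t - α (w t) (Y (y τ))‖ ≤ 3 * D ^ 5 * θ * h := by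
    intro t ht
    have hvi : IntervalIntegrable (fun s => α (v s) (Y (y τ))) volume τ t :=
      ((α.flip (Y (y τ))).continuous.comp hv).intervalIntegrable _ _
    have e1 : ∫ s in τ..t, α (v s) (Y (y τ)) = α (w t) (Y (y τ)) := by
      have := intervalIntegral.integral_eq_sub_of_hasDerivAt
        (f := fun s => α (w s) (Y (y τ))) (fun s _ =>
          (α.flip (Y (y τ))).hasFDerivAt.comp_hasDerivAt s (hw s)) hvi
      simpa [hwτ] using this
    have e2 := hξ.eq t ht
    rw [hξτ, zero_add] at e2
    rw [e2, ← e1, ← intervalIntegral.integral_sub (hξ.intervalIntegrable hτ' ht) hvi]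
    refine (norm_integral_le_of_norm_le_affine hub (A := 2 * D ^ 5 * h) (B := D ^ 2 * θ)
      (by positivity) (by positivity) hU (fun s hs => ?_) ht).trans ?_
    · have e3 : α (u s) (fderiv ℝ Y (y s) (ξ s)) + α (v s) (Y (y s)) - α (v s) (Y (y τ)) =
          α (u s) (fderiv ℝ Y (y s) (ξ s)) + α (v s) (Y (y s) - Y (y τ)) := by
        rw [map_sub]; abel
      rw [e3]
      refine (norm_add_le _ _).trans (add_le_add ((nu s hs _ (nξ s hs)).trans_eq (by ring)) ?_)
      calc _ ≤ ‖α‖ * ‖v s‖ * ‖Y (y s) - Y (y τ)‖ := α.le_opNorm₂ _ _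
        _ ≤ D * D * θ := by gcongr; exacts [nv s hs, (hmem s hs).1]
        _ = _ := by ring
    · have : D ^ 2 ≤ D ^ 5 := pow_le_pow_right₀ hD1 (by norm_num)
      calc 2 * D ^ 5 * h * θ + D ^ 2 * θ * (b - τ) ≤ 2 * D ^ 5 * h * θ + D ^ 5 * θ * h := by
            gcongr
        _ = _ := by ring
  have hyb := hy.mono hsub
  have hi1 : IntervalIntegrable (fun t => p t (α (u t) (fderiv ℝ (fderiv ℝ Y) (y t) (ξ t) (ξ t)) +
          α (v t) ((2 : ℝ) • fderiv ℝ Y (y t) (ξ t)))) volume τ b := by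
    refine ContinuousOn.intervalIntegrable_clm_apply hab (hp.mono hsub) (IntervalIntegrable.add ?_ ?_)
    · exact (hub.clm_comp α).clm_apply_continuousOn hab
        (((hY2y.mono hsub).clm_apply hξ.continuousOn).clm_apply hξ.continuousOn)
    · refine ContinuousOn.intervalIntegrable_of_Icc hab ?_
      exact ((α.continuous.comp hv).continuousOn).clm_apply
        (((hY1y.mono hsub).clm_apply hξ.continuousOn).const_smul _)
  have hi2 : IntervalIntegrable (fun t => 2 * p τ (α (v t)
      (fderiv ℝ Y (y τ) (α (w t) (Y (y τ)))))) volume τ b := by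
    refine Continuous.intervalIntegrable ?_ _ _
    have h1 : Continuous fun t => α (w t) (Y (y τ)) := (α.flip (Y (y τ))).continuous.comp hwc
    have h2 : Continuous fun t => α (v t) (fderiv ℝ Y (y τ) (α (w t) (Y (y τ)))) :=
      (α.continuous.comp hv).clm_apply ((fderiv ℝ Y (y τ)).continuous.comp h1)
    exact continuous_const.mul ((p τ).continuous.comp h2)
  rw [← intervalIntegral.integral_sub hi1 hi2]
  -- The quadratic u-term is at most 4D⁹h²‖u‖ since ‖ξ‖ ≤ 2D³h. The telescoped v-term is twice (2 +
  -- 2)D⁶θh + 3D⁹θh, hence at most 14D⁹θh.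
  refine (norm_integral_le_of_norm_le_affine hub (A := 4 * D ^ 9 * h ^ 2)
    (B := 14 * D ^ 9 * θ * h) (by positivity) (by positivity) hU (fun t ht => ?_)
    (right_mem_Icc.2 hab)).trans ?_
  · have e4 : p t (α (u t) (fderiv ℝ (fderiv ℝ Y) (y t) (ξ t) (ξ t)) +
          α (v t) ((2 : ℝ) • fderiv ℝ Y (y t) (ξ t))) -
        2 * p τ (α (v t) (fderiv ℝ Y (y τ) (α (w t) (Y (y τ))))) =
        p t (α (u t) (fderiv ℝ (fderiv ℝ Y) (y t) (ξ t) (ξ t))) +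
        2 * (p t (α (v t) (fderiv ℝ Y (y t) (ξ t))) -
          p τ (α (v t) (fderiv ℝ Y (y τ) (α (w t) (Y (y τ)))))) := by
      rw [map_add, map_smul, map_smul, smul_eq_mul]; ring
    rw [e4]
    refine (norm_add_le _ _).trans (add_le_add ?_ ?_)
    · refine (norm_pairing_le α _ _ _ _).trans ?_
      calc _ ≤ D * (D * ‖u t‖ * (D * (2 * D ^ 3 * h) * (2 * D ^ 3 * h))) := by
            gcongr
            · exact np t ht
            · exact (ContinuousLinearMap.le_opNorm _ _).trans
                (mul_le_mul (nY2 t ht) (nξ t ht) (norm_nonneg _) hD0.le)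
            · exact nξ t ht
        _ = _ := by ring
    · rw [norm_mul, Real.norm_ofNat]
      have h1 := norm_pairing_sub_le α hαD (np τ hτ') (nv t ht) (nY1 t ht) (nY1 τ hτ')
        (hmem t ht).2.2.1 (hmem t ht).2.1 (nξ t ht) (nζ t ht)
      have h2 : D ^ 6 ≤ D ^ 9 := pow_le_pow_right₀ hD1 (by norm_num)
      have h3 : D ^ 6 * (θ * h) ≤ D ^ 9 * (θ * h) := by gcongr
      nlinarith
  · calc _ = 18 * D ^ 9 * θ * h ^ 2 := by ring
      _ ≤ _ := by gcongr

end Expansion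

/-! ### Test polynomials with uniform bounds. -/

section TestPolynomials

open Polynomial

/-- Polynomials vanishing with their derivative at `0` and `1`. -/
def testPoly (N : ℕ) : (Fin N → ℝ) →ₗ[ℝ] ℝ[X] :=
  Fintype.linearCombination ℝ fun k : Fin N => X ^ 2 * (1 - X) ^ 2 * X ^ (k : ℕ)

variable {N : ℕ} (a : Fin N → ℝ)

theorem testPoly_eq_mul : testPoly N a = X ^ 2 * (1 - X) ^ 2 * ∑ k, a k • X ^ (k : ℕ) := by
  simp [testPoly, Fintype.linearCombination_apply, Finset.mul_sum]

theorem eval_zero_testPoly : eval 0 (testPoly N a) = 0 := by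
  simp [testPoly_eq_mul]

theorem eval_one_testPoly : eval 1 (testPoly N a) = 0 := by
  simp [testPoly_eq_mul]

theorem eval_zero_derivative_testPoly : eval 0 (derivative (testPoly N a)) = 0 := by
  rw [testPoly_eq_mul, derivative_mul, derivative_mul]
  simp

theorem eval_one_derivative_testPoly : eval 1 (derivative (testPoly N a)) = 0 := by
  rw [testPoly_eq_mul, derivative_mul, derivative_mul]
  simp [derivative_pow]

theorem testPoly_ne_zero (ha : a ≠ 0) : testPoly N a ≠ 0 := by
  rw [testPoly_eq_mul]
  have h1 : (1 - X : ℝ[X]) ≠ 0 := fun h => by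
    have := congrArg (eval 0) h
    simp at this
  refine mul_ne_zero (mul_ne_zero (pow_ne_zero _ X_ne_zero) (pow_ne_zero _ h1)) fun h => ha ?_
  ext1 k
  have := congrArg (fun p => coeff p (k : ℕ)) h
  simpa [finsetSum_coeff, coeff_X_pow, Fin.val_inj] using this

/-- Otherwise p' vanishes on [0,1], so p is constant, and p(0) = 0 makes it zero. -/
theorem integral_sq_derivative_testPoly_pos (ha : a ≠ 0) :
    0 < ∫ s in (0 : ℝ)..1, eval s (derivative (testPoly N a)) ^ 2 := by
  refine intervalIntegral.integral_pos one_pos ((Polynomial.continuous _).pow 2).continuousOn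
    (fun _ _ => sq_nonneg _) ?_
  by_contra! h
  have h1 : derivative (testPoly N a) = 0 :=
    eq_zero_of_infinite_isRoot _ ((Icc_infinite (zero_lt_one (α := ℝ))).mono fun s hs =>
      pow_eq_zero_iff two_ne_zero |>.1 (le_antisymm (h s hs) (sq_nonneg _)))
  have h2 := eq_C_of_derivative_eq_zero h1
  have h3 := eval_zero_testPoly a
  rw [h2, eval_C] at h3
  rw [h3, C_0] at h2
  exact testPoly_ne_zero a ha h2

theorem continuous_eval_linearMap (L : ℝ[X] →ₗ[ℝ] ℝ[X]) :
    Continuous fun z : (Fin N → ℝ) × ℝ => eval z.2 (L (testPoly N z.1)) := by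
  simp only [testPoly, Fintype.linearCombination_apply, map_sum, map_smul, eval_finsetSum,
    eval_smul, smul_eq_mul]
  exact continuous_finsetSum _ fun k _ => ((continuous_apply k).comp continuous_fst).mul
    ((Polynomial.continuous _).comp continuous_snd)

/-- Compactness of the unit sphere of coefficients, nonempty since there are N + 1 of them. The
constants are independent of the interval onto which the polynomials are later rescaled. -/
theorem exists_testPoly_bounds (N : ℕ) : ∃ m > 0, ∃ C, ∀ a : Fin (N + 1) → ℝ, ‖a‖ = 1 →
    m ≤ ∫ s in (0 : ℝ)..1, eval s (derivative (testPoly (N + 1) a)) ^ 2 ∧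
    ∀ s ∈ Icc (0 : ℝ) 1, |eval s (derivative (testPoly (N + 1) a))| ≤ C ∧
      |eval s (derivative (derivative (testPoly (N + 1) a)))| ≤ C := by
  have hS : IsCompact (Metric.sphere (0 : Fin (N + 1) → ℝ) 1) := isCompact_sphere _ _
  have hSne : (Metric.sphere (0 : Fin (N + 1) → ℝ) 1).Nonempty :=
    NormedSpace.sphere_nonempty.2 zero_le_one
  have h1 := continuous_eval_linearMap (N := N + 1) derivative
  have h2 := continuous_eval_linearMap (N := N + 1) (derivative ∘ₗ derivative)
  have h3 : Continuous fun a : Fin (N + 1) → ℝ =>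
      ∫ s in (0 : ℝ)..1, eval s (derivative (testPoly (N + 1) a)) ^ 2 :=
    intervalIntegral.continuous_parametric_intervalIntegral_of_continuous' (h1.pow 2) 0 1
  obtain ⟨a₀, ha₀, hmin⟩ := hS.exists_isMinOn hSne h3.continuousOn
  obtain ⟨C₁, hC₁⟩ := (hS.prod isCompact_Icc).exists_bound_of_continuousOn
    (h1.continuousOn (s := Metric.sphere 0 1 ×ˢ Icc 0 1))
  obtain ⟨C₂, hC₂⟩ := (hS.prod isCompact_Icc).exists_bound_of_continuousOn
    (h2.continuousOn (s := Metric.sphere 0 1 ×ˢ Icc 0 1))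
  refine ⟨_, integral_sq_derivative_testPoly_pos a₀ (ne_zero_of_mem_unit_sphere ⟨a₀, ha₀⟩),
    max C₁ C₂, fun a ha => ?_⟩
  have haS : a ∈ Metric.sphere (0 : Fin (N + 1) → ℝ) 1 := mem_sphere_zero_iff_norm.2 ha
  exact ⟨hmin haS, fun s hs => ⟨(hC₁ (a, s) ⟨haS, hs⟩).trans (le_max_left _ _),
    (hC₂ (a, s) ⟨haS, hs⟩).trans (le_max_right _ _)⟩⟩

end TestPolynomials

/-! ### Test controls that isolate the antisymmetric part of a bilinear form. -/

section BracketForm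

open Polynomial

variable {l : ℕ}

/-- The control with components `p'(t/h - d)` and `-σ p''(t/h - d)` in the directions `i`, `j`. -/
def testControl (i j : Fin l) (σ h d : ℝ) (p : ℝ[X]) (t : ℝ) : EuclideanSpace ℝ (Fin l) :=
  eval (t / h - d) (derivative p) • EuclideanSpace.single i 1 -
    (σ * eval (t / h - d) (derivative (derivative p))) • EuclideanSpace.single j 1

/-- The primitive of `testControl`. -/
def testPrimitive (i j : Fin l) (σ h d : ℝ) (p : ℝ[X]) (t : ℝ) : EuclideanSpace ℝ (Fin l) :=
  (h * eval (t / h - d) p) • EuclideanSpace.single i 1 -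
    (σ * (h * eval (t / h - d) (derivative p))) • EuclideanSpace.single j 1

variable (i j : Fin l) (σ : ℝ) {h : ℝ} (d : ℝ) (p : ℝ[X])

theorem continuous_testControl (h : ℝ) : Continuous (testControl i j σ h d p) := by
  have h1 : Continuous fun t : ℝ => t / h - d := by fun_prop
  exact (((Polynomial.continuous _).comp h1).smul continuous_const).sub
    ((continuous_const.mul ((Polynomial.continuous _).comp h1)).smul continuous_const)

theorem hasDerivAt_eval_div_sub (hh : h ≠ 0) (t : ℝ) :
    HasDerivAt (fun t => h * eval (t / h - d) p) (eval (t / h - d) (derivative p)) t := by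
  have h1 : HasDerivAt (fun t : ℝ => t / h - d) (1 / h) t :=
    ((hasDerivAt_id t).div_const h).sub_const d
  have h2 := ((p.hasDerivAt (t / h - d)).comp t h1).const_mul h
  refine h2.congr_deriv ?_
  field_simp

theorem hasDerivAt_testPrimitive (hh : h ≠ 0) (t : ℝ) :
    HasDerivAt (testPrimitive i j σ h d p) (testControl i j σ h d p t) t :=
  ((hasDerivAt_eval_div_sub d p hh t).smul_const _).sub
    (((hasDerivAt_eval_div_sub d (derivative p) hh t).const_mul σ).smul_const _)

theorem norm_testControl_le {C t : ℝ} (h1 : |eval (t / h - d) (derivative p)| ≤ C)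
    (h2 : |eval (t / h - d) (derivative (derivative p))| ≤ C) :
    ‖testControl i j σ h d p t‖ ≤ C + |σ| * C := by
  refine (norm_sub_le _ _).trans ?_
  simp only [norm_smul, PiLp.norm_single, norm_one, mul_one, norm_mul, Real.norm_eq_abs]
  gcongr

theorem testControl_sum {ι : Type*} (s : Finset ι) (c : ι → ℝ) (P : ι → ℝ[X]) (h t : ℝ) :
    testControl i j σ h d (∑ k ∈ s, c k • P k) t =
      ∑ k ∈ s, c k • testControl i j σ h d (P k) t := by
  simp only [testControl, derivative_sum, derivative_smul, eval_finsetSum, eval_smul, smul_sub,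
    Finset.sum_sub_distrib, Finset.sum_smul, Finset.mul_sum, smul_smul, smul_eq_mul]
  congr 1
  refine Finset.sum_congr rfl fun k _ => ?_
  congr 1
  ring

/-- The value of a bilinear form on `testControl` and its primitive, integrated over `[τ, τ+h]`. -/
theorem integral_bilin_testControl
    (β : EuclideanSpace ℝ (Fin l) →ₗ[ℝ] EuclideanSpace ℝ (Fin l) →ₗ[ℝ] ℝ) {τ : ℝ} (hh : h ≠ 0)
    (hp0 : eval 0 p = 0) (hp1 : eval 1 p = 0) (hp0' : eval 0 (derivative p) = 0)
    (hp1' : eval 1 (derivative p) = 0) :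
    ∫ t in τ..τ + h, β (testControl i j σ h (τ / h) p t) (testPrimitive i j σ h (τ / h) p t) =
      -(σ * (β (EuclideanSpace.single i 1) (EuclideanSpace.single j 1) -
        β (EuclideanSpace.single j 1) (EuclideanSpace.single i 1)) * h ^ 2 *
        ∫ s in (0 : ℝ)..1, eval s (derivative p) ^ 2) := by
  set ei : EuclideanSpace ℝ (Fin l) := EuclideanSpace.single i 1
  set ej : EuclideanSpace ℝ (Fin l) := EuclideanSpace.single j 1
  set lam := σ * (β ei ej - β ej ei) with hlam
  have e0 : τ / h - τ / h = 0 := sub_self _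
  have e1 : (τ + h) / h - τ / h = 1 := by field_simp; ring
  let w₁ : ℝ → ℝ := fun t => h * eval (t / h - τ / h) p
  let w₂ : ℝ → ℝ := fun t => h * eval (t / h - τ / h) (derivative p)
  let v₁ : ℝ → ℝ := fun t => eval (t / h - τ / h) (derivative p)
  let v₂ : ℝ → ℝ := fun t => eval (t / h - τ / h) (derivative (derivative p))
  have hw₁ : ∀ t, HasDerivAt w₁ (v₁ t) t := hasDerivAt_eval_div_sub (τ / h) p hh
  have hw₂ : ∀ t, HasDerivAt w₂ (v₂ t) t := hasDerivAt_eval_div_sub (τ / h) (derivative p) hh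
  have hw12 : ∀ t, w₂ t = h * v₁ t := fun t => rfl
  -- Replacing β ei ej by β ej ei in the mixed term makes the form symmetric, hence the derivative
  -- of a quadratic expression in w₁, w₂ that vanishes at both ends. The correction is -lam · v₁w₂ =
  -- -lam · h v₁².
  have hb : ∀ t, β (testControl i j σ h (τ / h) p t) (testPrimitive i j σ h (τ / h) p t) =
      (β ei ei * (v₁ t * w₁ t) + σ ^ 2 * β ej ej * (v₂ t * w₂ t) -
        σ * β ej ei * (v₂ t * w₁ t + v₁ t * w₂ t)) - lam * h * v₁ t ^ 2 := by
    intro t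
    have h1 : testControl i j σ h (τ / h) p t = v₁ t • ei - (σ * v₂ t) • ej := rfl
    have h2 : testPrimitive i j σ h (τ / h) p t = w₁ t • ei - (σ * w₂ t) • ej := rfl
    rw [h1, h2]
    simp only [map_sub, map_smul, LinearMap.sub_apply, LinearMap.smul_apply, smul_eq_mul, hlam,
      hw12]
    ring
  have hG : ∀ t, HasDerivAt (fun t => β ei ei * (w₁ t ^ 2 / 2) + σ ^ 2 * β ej ej * (w₂ t ^ 2 / 2) -
      σ * β ej ei * (w₁ t * w₂ t)) (β ei ei * (v₁ t * w₁ t) + σ ^ 2 * β ej ej * (v₂ t * w₂ t) -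
        σ * β ej ei * (v₂ t * w₁ t + v₁ t * w₂ t)) t := by
    intro t
    have h1 := ((((hw₁ t).pow 2).div_const 2).const_mul (β ei ei)).add
      ((((hw₂ t).pow 2).div_const 2).const_mul (σ ^ 2 * β ej ej))
    refine (h1.sub (((hw₁ t).mul (hw₂ t)).const_mul (σ * β ej ei))).congr_deriv ?_
    simp
    ring
  have hc1 : Continuous v₁ := (Polynomial.continuous _).comp (by fun_prop)
  have hc2 : Continuous v₂ := (Polynomial.continuous _).comp (by fun_prop)
  have hcw1 : Continuous w₁ := continuous_iff_continuousAt.2 fun t => (hw₁ t).continuousAt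
  have hcw2 : Continuous w₂ := continuous_iff_continuousAt.2 fun t => (hw₂ t).continuousAt
  have hGi : IntervalIntegrable (fun t => β ei ei * (v₁ t * w₁ t) +
      σ ^ 2 * β ej ej * (v₂ t * w₂ t) - σ * β ej ei * (v₂ t * w₁ t + v₁ t * w₂ t))
      volume τ (τ + h) := Continuous.intervalIntegrable (by fun_prop) _ _
  have hvi : IntervalIntegrable (fun t => lam * h * v₁ t ^ 2) volume τ (τ + h) :=
    Continuous.intervalIntegrable (by fun_prop) _ _
  have hz : w₁ τ = 0 ∧ w₂ τ = 0 ∧ w₁ (τ + h) = 0 ∧ w₂ (τ + h) = 0 := by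
    simp only [w₁, w₂, e0, e1, hp0, hp1, hp0', hp1', mul_zero, and_self]
  simp only [hb]
  rw [intervalIntegral.integral_sub hGi hvi,
    intervalIntegral.integral_eq_sub_of_hasDerivAt (fun t _ => hG t) hGi,
    intervalIntegral.integral_const_mul, hz.1, hz.2.1, hz.2.2.1, hz.2.2.2,
    intervalIntegral.integral_comp_div_sub (fun s => eval s (derivative p) ^ 2) hh, e0, e1,
    smul_eq_mul]
  ring

end BracketForm

/-- If f τ ≠ 0, then on a short interval f deviates from f τ by at most half of its size, so the
integral cannot vanish. -/
theorem eq_zero_of_short_integrals {f : ℝ → ℝ} {τ b₀ δ : ℝ} (hb : τ < b₀)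
    (hf : ContinuousOn f (Icc τ b₀)) (hδ : 0 < δ)
    (h : ∀ b, τ < b → b ≤ b₀ → b < τ + δ → ∫ t in τ..b, f t = 0) : f τ = 0 := by
  by_contra hne
  have hpos : 0 < ‖f τ‖ / 2 := by positivity
  obtain ⟨r, hr, hball⟩ := Metric.mem_nhdsWithin_iff.1
    (eventually_norm_sub_le (hf τ (left_mem_Icc.2 hb.le)) hpos)
  obtain ⟨b, hb1, hb2⟩ := exists_between (show τ < min b₀ (min (τ + δ) (τ + r)) by
    simp [hb, hδ, hr])
  simp only [lt_min_iff] at hb2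
  have hfb : ContinuousOn f (Icc τ b) := hf.mono (Icc_subset_Icc_right hb2.1.le)
  have h1 : ‖∫ t in τ..b, (f t - f τ)‖ ≤ ‖f τ‖ / 2 * |b - τ| := by
    refine intervalIntegral.norm_integral_le_of_norm_le_const fun t ht => ?_
    rw [uIoc_of_le hb1.le] at ht
    refine hball ⟨?_, ht.1.le, ht.2.trans hb2.1.le⟩
    rw [Metric.mem_ball, Real.dist_eq, abs_of_pos (sub_pos.2 ht.1)]
    linarith [ht.2, hb2.2.2]
  rw [intervalIntegral.integral_sub (hfb.intervalIntegrable_of_Icc hb1.le)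
    intervalIntegrable_const, h b hb1 hb2.1.le hb2.2.1, zero_sub, norm_neg,
    intervalIntegral.integral_const, norm_smul, Real.norm_eq_abs,
    abs_of_pos (sub_pos.2 hb1)] at h1
  have h2 : 0 < b - τ := sub_pos.2 hb1
  nlinarith

/-! ### Variations in the kernel of the first derivative. -/

section Goh

variable {n l : ℕ} {M : Type*} [TopologicalSpace M]
  [ChartedSpace (EuclideanSpace ℝ (Fin n)) M]

local notation "𝔼" => EuclideanSpace ℝ (Fin n)

variable {X : Fin l → (p : M) → TangentSpace (𝓡 n) p} {x : M}
  {Y : EuclideanSpace ℝ (Fin n) → Fin l → EuclideanSpace ℝ (Fin n)}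
  {V : Set (EuclideanSpace ℝ (Fin n))} {K : ℝ} {q : ℝ → M} {a b : ℝ}
  {u v : ℝ → EuclideanSpace ℝ (Fin l)}

/-- The solution of the linearised equation corresponding to the variation `v` of the control. -/
def IsAdapted.IsVariation (h : IsAdapted X u x Y V K q a b)
    (hv : IntervalIntegrable v volume a b) (ξ : C(Icc a b, EuclideanSpace ℝ (Fin n))) : Prop :=
  ξ = controlOp n h.le h.integrable (superposeDeriv Y h.contDiff h.path ξ) +
    controlOp n h.le hv (superpose ⟨Y, h.contDiff.continuous⟩ h.path)

theorem IsAdapted.exists_isVariation (h : IsAdapted X u x Y V K q a b)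
    (hv : IntervalIntegrable v volume a b) : ∃ ξ, h.IsVariation hv ξ :=
  exists_eq_affine h.norm_comp_superposeDeriv_lt _

theorem IsAdapted.IsVariation.isPrimitiveOn {h : IsAdapted X u x Y V K q a b}
    {hv : IntervalIntegrable v volume a b} {ξ : C(Icc a b, 𝔼)} (hξ : h.IsVariation hv ξ) :
    IsPrimitiveOn (IccExtend h.le ξ)
      (fun t => controlAction l 𝔼 (u t)
          (fderiv ℝ Y (extChartAt (𝓡 n) x (q t)) (IccExtend h.le ξ t)) +
        controlAction l 𝔼 (v t) (Y (extChartAt (𝓡 n) x (q t)))) a b := by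
  refine (((isPrimitiveOn_controlOp h.le h.integrable
    (superposeDeriv Y h.contDiff h.path ξ)).add (isPrimitiveOn_controlOp h.le hv
    (superpose ⟨Y, h.contDiff.continuous⟩ h.path))).congr_left fun t _ => ?_).congr_right ?_
  · conv_lhs => rw [hξ]
    rfl
  · filter_upwards [ae_restrict_mem measurableSet_Icc] with t ht
    simp only [IccExtend_of_mem _ _ ht]
    rfl

theorem IsAdapted.IsVariation.left {h : IsAdapted X u x Y V K q a b}
    {hv : IntervalIntegrable v volume a b} {ξ : C(Icc a b, 𝔼)} (hξ : h.IsVariation hv ξ) :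
    IccExtend h.le ξ a = 0 := by
  rw [IccExtend_of_mem _ _ (left_mem_Icc.2 h.le), hξ]
  simp [controlOp_left]

theorem IsAdapted.IsVariation.sum {h : IsAdapted X u x Y V K q a b} {ι : Type*} (s : Finset ι)
    {w : ι → ℝ → EuclideanSpace ℝ (Fin l)} {hw : ∀ k, IntervalIntegrable (w k) volume a b}
    {ξ : ι → C(Icc a b, 𝔼)} (hξ : ∀ k, h.IsVariation (hw k) (ξ k)) (c : ι → ℝ)
    {hv : IntervalIntegrable v volume a b} (hvw : ∀ t, v t = ∑ k ∈ s, c k • w k t) :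
    h.IsVariation hv (∑ k ∈ s, c k • ξ k) := by
  have h1 : controlOp n h.le hv (superpose ⟨Y, h.contDiff.continuous⟩ h.path) =
      ∑ k ∈ s, c k • controlOp n h.le (hw k) (superpose ⟨Y, h.contDiff.continuous⟩ h.path) := by
    ext1 t
    simp only [ContinuousMap.sum_apply, ContinuousMap.smul_apply, controlOp, integralOp_apply]
    have hi : ∀ k, IntervalIntegrable (fun r => controlAction l 𝔼 (w k r)
        (IccExtend h.le (superpose ⟨Y, h.contDiff.continuous⟩ h.path) r)) volume a t := fun k =>
      (isPrimitiveOn_controlOp h.le (hw k) _).intervalIntegrable (left_mem_Icc.2 h.le) t.2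
    simp only [← intervalIntegral.integral_smul]
    refine Eq.trans ?_ (intervalIntegral.integral_finsetSum fun k _ => (hi k).smul (c k))
    refine intervalIntegral.integral_congr fun r _ => ?_
    simp only [hvw r, map_sum, map_smul, sum_apply, smul_apply]
  rw [IsVariation, h1, map_sum, map_sum, ← Finset.sum_add_distrib]
  refine Finset.sum_congr rfl fun k _ => ?_
  conv_lhs => rw [hξ k]
  rw [map_smul, map_smul]
  exact smul_add (A := C(Icc a b, 𝔼)) (c k) _ _

/-- Among more than `n` variations some normalised linear combination does not move the
end point to first order. -/
theorem IsAdapted.exists_isVariation_right_eq_zero (h : IsAdapted X u x Y V K q a b) {N : ℕ}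
    (hN : n < N) {w : Fin N → ℝ → EuclideanSpace ℝ (Fin l)}
    (hw : ∀ k, IntervalIntegrable (w k) volume a b) :
    ∃ c : Fin N → ℝ, ‖c‖ = 1 ∧ ∃ ξ : C(Icc a b, 𝔼), ξ ⟨b, right_mem_Icc.2 h.le⟩ = 0 ∧
      ∀ (v : ℝ → EuclideanSpace ℝ (Fin l)) (hv : IntervalIntegrable v volume a b),
        (∀ t, v t = ∑ k, c k • w k t) → h.IsVariation hv ξ := by
  choose ξ hξ using fun k => h.exists_isVariation (hw k)
  let L : (Fin N → ℝ) →ₗ[ℝ] 𝔼 :=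
    -- L sends coefficients to the displacement of the combined variation at time b. More than n
    -- coefficients force a nonzero kernel.
    Fintype.linearCombination ℝ fun k => ξ k ⟨b, right_mem_Icc.2 h.le⟩
  have hker : LinearMap.ker L ≠ ⊥ := LinearMap.ker_ne_bot_of_finrank_lt (by simpa using hN)
  obtain ⟨c, hc, hc0⟩ := Submodule.exists_mem_ne_zero_of_ne_bot hker
  have hc' : ‖c‖ ≠ 0 := norm_ne_zero_iff.2 hc0
  refine ⟨‖c‖⁻¹ • c, by rw [norm_smul, norm_inv, norm_norm, inv_mul_cancel₀ hc'],
    ∑ k, (‖c‖⁻¹ • c) k • ξ k, ?_, fun v hv hvw => IsVariation.sum _ hξ _ hvw⟩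
  have h1 : L (‖c‖⁻¹ • c) = 0 := by rw [map_smul, LinearMap.mem_ker.1 hc, smul_zero]
  rw [Fintype.linearCombination_apply] at h1
  rw [ContinuousMap.sum_apply]
  exact h1

end Goh

/-! ### The Goh conditions before the final time. -/

section Conditions

variable {n l : ℕ} {M : Type*} [TopologicalSpace M]
  [ChartedSpace (EuclideanSpace ℝ (Fin n)) M]

local notation "𝔼" => EuclideanSpace ℝ (Fin n)

variable {X : Fin l → (p : M) → TangentSpace (𝓡 n) p} {q : ℝ → M} {T : ℝ} {u : Control T l}
  {φ : (t : ℝ) → TangentSpace (𝓡 n) (q t) →L[ℝ] ℝ}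

theorem continuousOn_coordCovector (hφ : PontrOn X u q φ 0 T) {x : M} {a b : ℝ} (ha : 0 ≤ a)
    (hab : a ≤ b) (hb : b ≤ T) (hx : ∀ t ∈ Icc a b, q t ∈ (extChartAt (𝓡 n) x).source) :
    ContinuousOn (fun t => coordCovector x (φ t)) (Icc a b) :=
  (hφ.ode x a b ha hab hb hx).continuousOn

theorem IsAdapted.coordField_eq {x : M} {Y : 𝔼 → Fin l → 𝔼} {V : Set 𝔼} {K a b : ℝ}
    (h : IsAdapted X u x Y V K q a b) {z : 𝔼} (hz : z ∈ V) (i : Fin l) :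
    coordField x (X i) z = Y z i ∧
      ∀ w, fderiv ℝ (coordField x (X i)) z w = fderiv ℝ Y z w i := by
  have h1 : coordField x (X i) =ᶠ[𝓝 z] fun z => Y z i := by
    filter_upwards [h.isOpen.mem_nhds hz] with w hw
    rw [h.eq w hw]
  refine ⟨h1.self_of_nhds, fun w => ?_⟩
  rw [h1.fderiv_eq]
  exact DFunLike.congr_fun ((ContinuousLinearMap.proj (R := ℝ) (φ := fun _ : Fin l => 𝔼)
    i).hasFDerivAt.comp z (h.contDiff.differentiable (by norm_num) z).hasFDerivAt).fderiv w

theorem controlAction_single {F : Type*} [NormedAddCommGroup F] [NormedSpace ℝ F] (i : Fin l)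
    (w : Fin l → F) : controlAction l F (EuclideanSpace.single i 1) w = w i := by
  rw [controlAction_apply, Finset.sum_eq_single i]
  · simp
  · intro j _ hj
    simp [hj]
  · simp

variable [IsManifold (𝓡 n) ∞ M] [T2Space M]
  (hX : ∀ i, ContMDiff (𝓡 n) (𝓡 n).tangent ∞
      (fun p => (⟨p, X i p⟩ : TangentBundle (𝓡 n) M)))
  (hq : TrajOn X u q 0 T) (hφ : PontrOn X u q φ 0 T)
  (φ₀ : TangentSpace (𝓡 n) (endPoint X (q 0) T u) →L[ℝ] ℝ)
  (hφ₀ : (φ T : EuclideanSpace ℝ (Fin n) →L[ℝ] ℝ) = (φ₀ : EuclideanSpace ℝ (Fin n) →L[ℝ] ℝ))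
  (hann : ∀ Δu : Control T l, φ₀ (dEnd X (q 0) T u Δu) = 0)
  (hindex : negIndex {Δu : Control T l | dEnd X (q 0) T u Δu = 0}
    (fun Δu => φ₀ (d2End X (q 0) T u Δu)) = 0)
include hX hq hφ hφ₀ hann hindex

/-- The first order condition for the constant variation e_i on [τ,b], with b decreasing to τ; this
is why τ < T is required. -/
theorem apply_field_eq_zero_of_lt {τ : ℝ} (hτ : τ ∈ Ico 0 T) (i : Fin l) :
    φ τ (X i (q τ)) = 0 := by
  have hu := intervalIntegrable_control hq.le u
  obtain ⟨Y, V, K, hzV, δ, hδ, had⟩ := exists_isAdapted hX hu hq.continuousOn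
    ⟨hτ.1, hτ.2.le⟩ (q τ) (mem_extChartAt_source _)
  obtain ⟨b₀, hb₀, hb₀'⟩ := exists_between (show τ < min T (τ + δ) by simp [hτ.2, hδ])
  rw [lt_min_iff] at hb₀'
  have h₀ := had τ b₀ hτ.1 hb₀.le hb₀'.1.le (by linarith) hb₀'.2
  have hp := continuousOn_coordCovector hφ hτ.1 hb₀.le hb₀'.1.le h₀.mem_source
  have hy := continuousOn_coord h₀.continuousOn h₀.mem_source
  have h1 : coordCovector (q τ) (φ τ) (Y (extChartAt (𝓡 n) (q τ) (q τ)) i) = 0 := by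
    refine eq_zero_of_short_integrals (f := fun t => coordCovector (q τ) (φ t)
      (Y (extChartAt (𝓡 n) (q τ) (q t)) i)) hb₀ (hp.clm_apply ((continuous_apply i).comp_continuousOn
      (h₀.contDiff.continuous.comp_continuousOn hy))) one_pos fun b hb hb' _ => ?_
    have h := h₀.mono le_rfl hb.le hb'
    have hv : Continuous fun _ : ℝ => EuclideanSpace.single i (1 : ℝ) := continuous_const
    obtain ⟨ξ, hξ⟩ := h.exists_isVariation (hv.intervalIntegrable τ b)
    have := (h.variation_conditions hX hq hτ.1 (hb'.trans hb₀'.1.le) hv hφ φ₀ hφ₀ hann hindex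
      hξ).1
    simpa only [controlAction_single] using this
  rw [← (h₀.coordField_eq hzV i).1] at h1
  rwa [coordCovector_coordField _ _ (mem_extChartAt_source _)] at h1

/-- If λ ≠ 0, a rescaled test control in the kernel has second variation at most -2|λ|mr² + |λ|mr² <
0 on an interval of length r, against the second order condition. -/
theorem apply_mlieBracket_eq_zero_of_lt {τ : ℝ} (hτ : τ ∈ Ico 0 T) (i j : Fin l) :
    φ τ (VectorField.mlieBracket (𝓡 n) (X i) (X j) (q τ)) = 0 := by
  have hu := intervalIntegrable_control hq.le u
  obtain ⟨Y, V, K, hzV, δ₀, hδ₀, had⟩ := exists_isAdapted hX hu hq.continuousOn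
    ⟨hτ.1, hτ.2.le⟩ (q τ) (mem_extChartAt_source _)
  obtain ⟨b₀, hb₀, hb₀'⟩ := exists_between (show τ < min T (τ + δ₀) by simp [hτ.2, hδ₀])
  rw [lt_min_iff] at hb₀'
  have h₀ := had τ b₀ hτ.1 hb₀.le hb₀'.1.le (by linarith) hb₀'.2
  have hp := continuousOn_coordCovector hφ hτ.1 hb₀.le hb₀'.1.le h₀.mem_source
  have hy := continuousOn_coord h₀.continuousOn h₀.mem_source
  set z := extChartAt (𝓡 n) (q τ) (q τ) with hz
  let P : 𝔼 →L[ℝ] ℝ := coordCovector (q τ) (φ τ)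
  let β : EuclideanSpace ℝ (Fin l) →ₗ[ℝ] EuclideanSpace ℝ (Fin l) →ₗ[ℝ] ℝ :=
    LinearMap.mk₂ ℝ (fun g g' => P (controlAction l 𝔼 g (fderiv ℝ Y z
      (controlAction l 𝔼 g' (Y z)))))
      (fun _ _ _ => by simp only [map_add, add_apply])
      (fun _ _ _ => by simp only [map_smul, smul_apply])
      (fun _ _ _ => by simp only [map_add, add_apply])
      (fun _ _ _ => by simp only [map_smul, smul_apply])
  set lam : ℝ := β (EuclideanSpace.single i 1) (EuclideanSpace.single j 1) -
    β (EuclideanSpace.single j 1) (EuclideanSpace.single i 1) with hlam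
  suffices hlam0 : lam = 0 by
    have hβ : ∀ i j, β (EuclideanSpace.single i 1) (EuclideanSpace.single j 1) =
        P (fderiv ℝ (coordField (q τ) (X i)) z (coordField (q τ) (X j) z)) := fun i j => by
      rw [(h₀.coordField_eq hzV i).2, (h₀.coordField_eq hzV j).1]
      show P (controlAction l 𝔼 _ (fderiv ℝ Y z (controlAction l 𝔼 _ (Y z)))) = _
      rw [controlAction_single, controlAction_single]
    rw [hβ, hβ, ← map_sub] at hlam
    have h2 : P (VectorField.lieBracket ℝ (coordField (q τ) (X i)) (coordField (q τ) (X j)) z) =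
        0 := by
      rw [VectorField.lieBracket, ← neg_sub, map_neg, ← hlam, hlam0, neg_zero]
    have h3 : P = (φ τ : 𝔼 →L[ℝ] ℝ) := coordCovector_self (φ τ)
    rw [h3] at h2
    exact (congrArg (φ τ) (mlieBracket_eq_lieBracket (X i) (X j) (q τ))).trans h2
  by_contra hne
  -- The sign of the second component is free, and it is chosen so that the leading term is
  -- negative.
  obtain ⟨σ, hσ, hσ1⟩ : ∃ σ : ℝ, σ * lam = |lam| ∧ |σ| ≤ 1 := by
    rcases lt_or_gt_of_ne hne with h | h
    · exact ⟨-1, by rw [abs_of_neg h]; ring, by simp⟩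
    · exact ⟨1, by rw [abs_of_pos h]; ring, by simp⟩
  obtain ⟨m, hm, C, hC⟩ := exists_testPoly_bounds n
  have hlam' : 0 < |lam| := abs_pos.2 hne
  -- The bound 2C covers both components since |σ| ≤ 1. The tolerance |lam| * m is half of the lower
  -- bound 2|lam|m for the main term, in units of r².
  obtain ⟨δ, hδ, hexp⟩ := exists_quadratic_expansion (controlAction l 𝔼) h₀.contDiff hb₀ hy hp
    h₀.integrable (2 * C) (ε := |lam| * m) (by positivity)
  obtain ⟨b, hb, hb'⟩ := exists_between (show τ < min b₀ (τ + δ) by simp [hb₀, hδ])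
  rw [lt_min_iff] at hb'
  have h := h₀.mono le_rfl hb.le hb'.1.le
  set r := b - τ with hr
  have hr0 : 0 < r := sub_pos.2 hb
  have hbr : b = τ + r := by rw [hr]; ring
  -- One test control for each of n + 1 basis polynomials, one more than the dimension. The bound
  -- index j inside the polynomial is unrelated to the direction j.
  let w : Fin (n + 1) → ℝ → EuclideanSpace ℝ (Fin l) := fun k =>
    testControl i j σ r (τ / r) (testPoly (n + 1) fun j => if k = j then 1 else 0)
  obtain ⟨c, hc, ξ, hξb, hξ⟩ := h.exists_isVariation_right_eq_zero (Nat.lt_succ_self n)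
    (w := w) fun k => (continuous_testControl i j σ _ _ r).intervalIntegrable _ _
  set p := testPoly (n + 1) c with hpdef
  have hv := continuous_testControl i j σ (τ / r) p r
  have hξv := hξ _ (hv.intervalIntegrable τ b) fun t => by
    rw [← testControl_sum, ← LinearMap.pi_apply_eq_sum_univ]
  obtain ⟨hCm, hCb⟩ := hC c hc
  have hC0 : 0 ≤ C := (abs_nonneg _).trans (hCb 0 ⟨le_rfl, zero_le_one⟩).1
  have hvb : ∀ t ∈ Icc τ b, ‖testControl i j σ r (τ / r) p t‖ ≤ 2 * C := fun t ht => by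
    have hs : t / r - τ / r ∈ Icc (0 : ℝ) 1 := by
      rw [← sub_div]
      exact ⟨div_nonneg (sub_nonneg.2 ht.1) hr0.le, (div_le_one hr0).2 (by linarith [ht.2])⟩
    refine (norm_testControl_le i j σ (τ / r) p (hCb _ hs).1 (hCb _ hs).2).trans ?_
    nlinarith
  have e0 : τ / r - τ / r = 0 := sub_self _
  have hE := hexp b hb hb'.1.le hb'.2 _ (testPrimitive i j σ r (τ / r) p) (IccExtend h.le ξ) hv hvb
    (hasDerivAt_testPrimitive i j σ (τ / r) p hr0.ne') (by
      simp only [testPrimitive, e0, eval_zero_testPoly, eval_zero_derivative_testPoly, hpdef]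
      simp) hξv.left hξv.isPrimitiveOn
  have hQ := (h.variation_conditions hX hq hτ.1 (hb'.1.le.trans hb₀'.1.le) hv hφ φ₀ hφ₀ hann
    hindex hξv).2 hξb
  have hI : ∫ t in τ..b, 2 * P (controlAction l 𝔼 (testControl i j σ r (τ / r) p t)
      (fderiv ℝ Y z (controlAction l 𝔼 (testPrimitive i j σ r (τ / r) p t) (Y z)))) =
      -(2 * (|lam| * r ^ 2 *
        ∫ s in (0 : ℝ)..1, Polynomial.eval s (Polynomial.derivative p) ^ 2)) := by
    have := integral_bilin_testControl i j σ p β (τ := τ) hr0.ne' (eval_zero_testPoly c)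
      (eval_one_testPoly c) (eval_zero_derivative_testPoly c) (eval_one_derivative_testPoly c)
    rw [← hbr, ← hlam, hσ] at this
    rw [intervalIntegral.integral_const_mul, ← mul_neg, ← this]
    rfl
  rw [hI, Real.norm_eq_abs] at hE
  have h5 := (abs_le.1 hE).2
  have h6 : |lam| * r ^ 2 * m ≤ |lam| * r ^ 2 *
      ∫ s in (0 : ℝ)..1, Polynomial.eval s (Polynomial.derivative p) ^ 2 := by gcongr
  have h7 : 0 < |lam| * r ^ 2 * m := by positivity
  nlinarith

end Conditions

theorem exists_sum_smul_eq_of_linearIndependent {n : ℕ}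
    {b : Fin n → EuclideanSpace ℝ (Fin n) →L[ℝ] ℝ} (hb : LinearIndependent ℝ b)
    (μ : EuclideanSpace ℝ (Fin n) →L[ℝ] ℝ) : ∃ c : Fin n → ℝ, ∑ a, c a • b a = μ := by
  have hcard : Fintype.card (Fin n) = Module.finrank ℝ (EuclideanSpace ℝ (Fin n) →L[ℝ] ℝ) := by
    rw [← LinearMap.toContinuousLinearMap.finrank_eq]
    simp
  refine (Submodule.mem_span_range_iff_exists_fun ℝ).1 ?_
  rw [hb.span_eq_top_of_card_eq_finrank' hcard]
  trivial

/-! ### The final time, coframes, and conclusion. -/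

section Assembly

variable {n l : ℕ} {M : Type*} [TopologicalSpace M]
  [ChartedSpace (EuclideanSpace ℝ (Fin n)) M] [IsManifold (𝓡 n) ∞ M]

local notation "𝔼" => EuclideanSpace ℝ (Fin n)

variable {X : Fin l → (p : M) → TangentSpace (𝓡 n) p} {q : ℝ → M} {T : ℝ} {u : Control T l}
  {φ : (t : ℝ) → TangentSpace (𝓡 n) (q t) →L[ℝ] ℝ}

/-- A covector along `q` which annihilates a vector field on `[0,T)` annihilates it at time `T`. -/
theorem apply_right_eq_zero (hT : 0 < T) (hq : TrajOn X u q 0 T) (hφ : PontrOn X u q φ 0 T)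
    {V : (p : M) → TangentSpace (𝓡 n) p}
    (hV : ContMDiff (𝓡 n) (𝓡 n).tangent ∞ (fun p => (⟨p, V p⟩ : TangentBundle (𝓡 n) M)))
    (h : ∀ t ∈ Ico 0 T, φ t (V (q t)) = 0) : φ T (V (q T)) = 0 := by
  have hTm : T ∈ Icc 0 T := right_mem_Icc.2 hT.le
  have hnhds := (hq.continuousOn T hTm).eventually_mem
    ((isOpen_extChartAt_source (I := 𝓡 n) (q T)).mem_nhds (mem_extChartAt_source (q T)))
  obtain ⟨δ, hδ, hball⟩ := Metric.mem_nhdsWithin_iff.1 hnhds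
  obtain ⟨a, ha, haT⟩ := exists_between (show max 0 (T - δ) < T by simp [hT, hδ])
  rw [max_lt_iff] at ha
  have hsrc : ∀ t ∈ Icc a T, q t ∈ (extChartAt (𝓡 n) (q T)).source := fun t ht =>
    hball ⟨by
      rw [Metric.mem_ball, Real.dist_eq, abs_sub_comm, abs_of_nonneg (sub_nonneg.2 ht.2)]
      linarith [ht.1], ha.1.le.trans ht.1, ht.2⟩
  have hp := continuousOn_coordCovector hφ ha.1.le haT.le le_rfl hsrc
  have hy := continuousOn_coord (hq.continuousOn.mono (Icc_subset_Icc_left ha.1.le)) hsrc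
  have hc : ContinuousOn (fun t => coordCovector (q T) (φ t)
      (coordField (q T) V (extChartAt (𝓡 n) (q T) (q t)))) (Icc a T) :=
    hp.clm_apply fun t ht => (contDiffAt_coordField hV (hsrc t ht)).continuousAt.comp_continuousWithinAt
      (f := fun t => extChartAt (𝓡 n) (q T) (q t)) (hy t ht)
  have hz : EqOn (fun t => coordCovector (q T) (φ t)
      (coordField (q T) V (extChartAt (𝓡 n) (q T) (q t)))) (fun _ => 0) (Ico a T) := fun t ht =>
    (coordCovector_coordField (φ t) V (hsrc t ⟨ht.1, ht.2.le⟩)).trans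
      (h t ⟨ha.1.le.trans ht.1, ht.2⟩)
  have hz' := hz.of_subset_closure hc continuousOn_const Ico_subset_Icc_self
    (by rw [closure_Ico haT.ne]) (right_mem_Icc.2 haT.le)
  exact (coordCovector_coordField (φ T) V (mem_extChartAt_source _)).symm.trans hz'

theorem contMDiff_mlieBracket {V W : (p : M) → TangentSpace (𝓡 n) p}
    (hV : ContMDiff (𝓡 n) (𝓡 n).tangent ∞ (fun p => (⟨p, V p⟩ : TangentBundle (𝓡 n) M)))
    (hW : ContMDiff (𝓡 n) (𝓡 n).tangent ∞ (fun p => (⟨p, W p⟩ : TangentBundle (𝓡 n) M))) :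
    ContMDiff (𝓡 n) (𝓡 n).tangent ∞
      (fun p => (⟨p, VectorField.mlieBracket (𝓡 n) V W p⟩ : TangentBundle (𝓡 n) M)) := by
  have h1 : IsManifold (𝓡 n) (minSmoothness ℝ 2) M := by
    rw [minSmoothness_of_isRCLikeNormedField]
    exact IsManifold.of_le (n := ∞) (WithTop.coe_le_coe.2 le_top)
  have h2 : IsManifold (𝓡 n) (((⊤ : ℕ∞) : WithTop ℕ∞) + 1) M := by
    rw [show ((⊤ : ℕ∞) : WithTop ℕ∞) + 1 = ∞ from rfl]
    infer_instance
  intro p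
  refine ContMDiffAt.mlieBracket_vectorField (m := ⊤) (n := ⊤) (hV p) (hW p) ?_
  rw [minSmoothness_of_isRCLikeNormedField]
  exact le_rfl

theorem exists_isAdaptedCoframe (hX : ∀ i, ContMDiff (𝓡 n) (𝓡 n).tangent ∞
      (fun p => (⟨p, X i p⟩ : TangentBundle (𝓡 n) M))) (hq : TrajOn X u q 0 T) :
    ∃ Φ : Fin n → (t : ℝ) → TangentSpace (𝓡 n) (q t) →L[ℝ] ℝ, IsAdaptedCoframe X T u q Φ := by
  have hu := intervalIntegrable_control hq.le u
  obtain ⟨B⟩ : Nonempty (Module.Basis (Fin n) ℝ (𝔼 →L[ℝ] ℝ)) := by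
    refine ⟨Module.finBasisOfFinrankEq ℝ _ ?_⟩
    rw [← LinearMap.toContinuousLinearMap.finrank_eq]
    simp
  have hB : ∀ a, ∃ φ : (t : ℝ) → TangentSpace (𝓡 n) (q t) →L[ℝ] ℝ,
      PontrOn X u q φ 0 T ∧ φ 0 = B a := fun a => exists_pontrOn hX hu hq (B a)
  choose Φ hΦ hΦ0 using hB
  have e : (fun a => (Φ a 0 : 𝔼 →L[ℝ] ℝ)) = B := funext hΦ0
  refine ⟨Φ, fun a => (isPontryagin_iff hX hq.le hu hq.continuousOn).2 (hΦ a), ?_, ?_⟩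
  · have := B.linearIndependent
    rw [← e] at this
    exact this
  · have := B.span_eq
    rw [← e] at this
    exact this

/-- The values of a coframe of Pontryagin covectors span the cotangent space at time `T`. -/
theorem exists_sum_smul_eq (hX : ∀ i, ContMDiff (𝓡 n) (𝓡 n).tangent ∞
      (fun p => (⟨p, X i p⟩ : TangentBundle (𝓡 n) M))) (hq : TrajOn X u q 0 T)
    {Φ : Fin n → (t : ℝ) → TangentSpace (𝓡 n) (q t) →L[ℝ] ℝ}
    (hΦ : ∀ a, PontrOn X u q (Φ a) 0 T) (hΦ0 : LinearIndependent ℝ fun a => Φ a 0)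
    (μ : TangentSpace (𝓡 n) (q T) →L[ℝ] ℝ) : ∃ c : Fin n → ℝ, ∑ a, c a • Φ a T = μ := by
  have hu := intervalIntegrable_control hq.le u
  have hind : LinearIndependent ℝ fun a => (Φ a T : 𝔼 →L[ℝ] ℝ) := by
    refine Fintype.linearIndependent_iff.2 fun c hc => Fintype.linearIndependent_iff.1 hΦ0 c ?_
    exact (PontrOn.eq_zero_iff hX hu hq (PontrOn.sum Finset.univ hq.le c fun a _ => hΦ a) le_rfl
      hq.le le_rfl).2 hc
  exact exists_sum_smul_eq_of_linearIndependent hind μ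

end Assembly

end Goh

end

theorem lemma5 {n l : ℕ} {M : Type*} [TopologicalSpace M] [T2Space M]
    [ChartedSpace (EuclideanSpace ℝ (Fin n)) M] [IsManifold (𝓡 n) ∞ M]
    (X : Fin l → (p : M) → TangentSpace (𝓡 n) p)
    (hX : ∀ i, ContMDiff (𝓡 n) (𝓡 n).tangent ∞
      (fun p => (⟨p, X i p⟩ : TangentBundle (𝓡 n) M)))
    (q₀ : M) (T : ℝ) (hT : 0 < T) (u : Goh.Control T l) (q : ℝ → M)
    (hq : Goh.IsTrajectory X q₀ T u q)
    (φ₀ : TangentSpace (𝓡 n) (Goh.endPoint X q₀ T u) →L[ℝ] ℝ) (hφ₀ : φ₀ ≠ 0)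
    (hann : ∀ Δu : Goh.Control T l, φ₀ (Goh.dEnd X q₀ T u Δu) = 0)
    (hindex : Goh.negIndex {Δu : Goh.Control T l | Goh.dEnd X q₀ T u Δu = 0}
      (fun Δu => φ₀ (Goh.d2End X q₀ T u Δu)) = 0) :
    (∃ Φ : Fin n → (t : ℝ) → TangentSpace (𝓡 n) (q t) →L[ℝ] ℝ,
      Goh.IsAdaptedCoframe X T u q Φ) ∧
    ∀ Φ : Fin n → (t : ℝ) → TangentSpace (𝓡 n) (q t) →L[ℝ] ℝ,
      Goh.IsAdaptedCoframe X T u q Φ →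
      ∃ c : Fin n → ℝ, c ≠ 0 ∧
        Goh.IsPontryagin X T u q (fun t => ∑ a, c a • Φ a t) ∧
        ∀ t ∈ Set.Icc (0 : ℝ) T,
          (∑ a, c a • Φ a t) ≠ 0 ∧
          (∀ i, (∑ a, c a • Φ a t) (X i (q t)) = 0) ∧
          ∀ i j, (∑ a, c a • Φ a t)
            (VectorField.mlieBracket (𝓡 n) (X i) (X j) (q t)) = 0 := by
  have hu := Goh.intervalIntegrable_control hT.le u
  obtain ⟨hq', rfl⟩ := (Goh.isTrajectory_iff hX hT.le hu).1 hq
  refine ⟨Goh.exists_isAdaptedCoframe hX hq', fun Φ hΦ => ?_⟩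
  have hΦp : ∀ a, Goh.PontrOn X u q (Φ a) 0 T := fun a =>
    (Goh.isPontryagin_iff hX hT.le hu hq'.continuousOn).1 (hΦ.pontryagin a)
  -- The coefficients of φ₀ in the basis of values at time T. The points End^T(u) and q(T) coincide
  -- but their tangent spaces are distinct types, so φ₀ is compared in the dual of ℝⁿ, through the
  -- same preferred chart.
  obtain ⟨c, hc⟩ := Goh.exists_sum_smul_eq hX hq' hΦp hΦ.linearIndependent
    (φ₀ : EuclideanSpace ℝ (Fin n) →L[ℝ] ℝ)
  have hφ := Goh.PontrOn.sum Finset.univ hT.le c fun a _ => hΦp a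
  have hc0 : c ≠ 0 := by
    rintro rfl
    refine hφ₀ (Eq.trans ?_ (hc.symm.trans ?_))
    · rfl
    · exact Finset.sum_eq_zero fun a _ => zero_smul ℝ (Φ a T)
  have hX0 := fun i t ht => Goh.apply_field_eq_zero_of_lt hX hq' hφ φ₀ hc hann hindex (τ := t) ht i
  have hX1 := fun i j t ht =>
    Goh.apply_mlieBracket_eq_zero_of_lt hX hq' hφ φ₀ hc hann hindex (τ := t) ht i j
  refine ⟨c, hc0, (Goh.isPontryagin_iff hX hT.le hu hq'.continuousOn).2 hφ, fun t ht => ?_⟩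
  refine ⟨fun h0 => hφ₀ ?_, fun i => ?_, fun i j => ?_⟩
  · exact hc.symm.trans ((Goh.PontrOn.eq_zero_iff hX hu hq' hφ ht.1 ht.2 le_rfl).1 h0)
  · rcases ht.2.eq_or_lt with rfl | hlt
    · exact Goh.apply_right_eq_zero hT hq' hφ (hX i) (hX0 i)
    · exact hX0 i t ⟨ht.1, hlt⟩
  · rcases ht.2.eq_or_lt with rfl | hlt
    · exact Goh.apply_right_eq_zero hT hq' hφ (Goh.contMDiff_mlieBracket (hX i) (hX j)) (hX1 i j)
    · exact hX1 i j t ⟨ht.1, hlt⟩
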